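/- **System.** Two users $a,b$ transmit to two remote radio heads (RRHs) $i,j$. For an RRH $k$ and a user $m$ the path-loss factor is $l_{km}=c\,d_{km}^{-n}$ with $c,d_{km}>0$, and the fading coefficients $h_{km}\sim\mathcal{CN}(0,1)$ are independent. Put $\gamma_a=P_a/\sigma^2$, $\gamma_b=P_b/\sigma^2$ with $P_a,P_b,\sigma^2>0$. Let $0<\alpha<1$ (the predetermined power split), $0<\beta\le 1$, target rates $R_a,R_b>0$, and $\theta_1=2^{R_a}-1$, $\theta_{11}=2^{\beta R_a}-1$, $\theta_{12}=2^{(1-\beta)R_a}-1$, $\theta_2=2^{R_b}-1$. With $S_k=l_{ka}\gamma_a|h_{ka}|^2$ and $I_k=l_{kb}\gamma_b|h_{kb}|^2$ the SINRs are $$\gamma_{1a,k}=\frac{\alpha S_k}{(1-\alpha)S_k+I_k+1},\quad \gamma_{b,k}=\frac{I_k}{(1-\alpha)S_k+1},\quad \gamma_{2a,k}=(1-\alpha)S_k$$ for RSMA with decoding order $(x_{1a},x_b,x_{2a})$, and, for NOMA, $$\gamma^{ab}_{a,k}=\frac{S_k}{I_k+1},\quad \gamma^{ba}_{b,k}=\frac{I_k}{S_k+1},\quad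 \gamma^{ba}_{a,k}=S_k .$$ The RRHs exchange decoded messages over an ideal link, so a decoding stage succeeds if at least one RRH succeeds. NOMA delivers the message of $a$ if $\gamma^{ab}_{a,k}\ge\theta_1$ for some $k$, or if $\gamma^{ba}_{b,k}\ge\theta_2$ for some $k$ and $\gamma^{ba}_{a,k'}\ge\theta_1$ for some $k'$. RSMA delivers it if $\gamma_{1a,k}\ge\theta_{11}$ for some $k$, $\gamma_{b,k'}\ge\theta_2$ for some $k'$, and $\gamma_{2a,k''}\ge\theta_{12}$ for some $k''$. A 1-bit feedback $z$, a function of the channel gains, selects the scheme: $z=0$ (NOMA) if NOMA delivers the message of $a$, $z=1$ (RSMA) if only RSMA delivers it, and $z$ is arbitrary if neither does. User $a$ is in outage if the selected scheme does not deliver its message. **Theorem.** For every such feedback, the outage probability of user $a$ is $$\begin{aligned}P_a^o={}&G_1^iG_1^j+G_2^iG_2^j+G_2^iG_3^j+G_3^iG_2^j+G_4^iG_4^j+G_4^iG_5^j+G_5^iG_4^j+G_4^iG_6^j+G_4^iG_7^j\\&+G_5^iG_6^j+G_6^iG_4^j+G_6^iG_5^j+G_7^iG_4^j+G_8^iG_8^j+G_8^iG_9^j+G_9^iG_8^j,\end{aligned}$$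 where the factors $G_m^k$, $k\in\{i,j\}$, are as follows. *Auxiliary quantities.* Let $A=\alpha-\theta_{11}(1-\alpha)$, $F_1=-(\alpha-\theta_{11}(1-\alpha)(1+\theta_2))$, $F_2=-(\alpha-\theta_{11}(1-\alpha+\theta_2))$, $F_3=1-\theta_1\theta_2(1-\alpha)$, $E=1-\theta_1\theta_2$, $D=\theta_{11}-\theta_1A$. For a fixed $k$ put $u=l_{ka}\gamma_a$, $v=l_{kb}\gamma_b$, $\tau=\theta_2/v$, $\kappa=e^{-\theta_{12}/((1-\alpha)u)}$, and $$f_1=\frac{\theta_2\alpha}{-vF_1},\quad f_3=\frac{\theta_2(\theta_{12}+1)}{v},\quad f_4=\frac{\theta_2(1+\theta_1(1-\alpha))}{vF_3},\quad f_5=\frac{\theta_{12}-\theta_1(1-\alpha)}{v\theta_1(1-\alpha)},\quad f_6=\frac{\theta_2\alpha(1+\theta_{11})}{-vF_2},$$ $$f_7=\frac{\theta_{12}A-\theta_{11}(1-\alpha)}{v\theta_{11}(1-\alpha)},\quad f_8=\frac{\theta_2(\theta_{12}+1-\alpha)}{v(1-\alpha)},\quad f_9=\frac{\theta_2(\theta_1+1)}{vE},$$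 (each is used only where its denominator is non-zero), and $$\Phi_1(t)=\frac{uA\,e^{-\frac{\theta_{11}(vt+1)}{uA}-t}}{uA+v\theta_{11}},\quad \Phi_2(t)=\frac{u\theta_2(1-\alpha)e^{-\frac{vt-\theta_2}{u\theta_2(1-\alpha)}-t}}{u\theta_2(1-\alpha)+v},\quad \Phi_3(t)=\frac{u\theta_2e^{-\frac{vt-\theta_2}{u\theta_2}-t}}{u\theta_2+v},\quad \Phi_4(t)=\frac{u\,e^{-\frac{\theta_1(vt+1)}{u}-t}}{u+v\theta_1}.$$ For a function $\psi$ write $\Delta_x^y\psi=\psi(y)-\psi(x)$, and $K_x^y=\kappa(e^{-y}-e^{-x})$. Let $(\mathrm S)$ be the condition "$\frac{\alpha}{1-\alpha}>\theta_{11}$ and $D<0$" and $(\mathrm N)$ its negation "$\frac{\alpha}{1-\alpha}\le\theta_{11}$ or $D\ge0$". In each list, a term equals the given expression when all the conditions of one of its rows hold (the rows of one term exclude each other), and $0$ when no row applies. *$G_1=G_{11}+G_{12}$.* - $G_{11}$: if (S), $F_2<0$, $f_6>\tau$: $1-e^{-\tau}+\Delta_0^{f_6}\Phi_1-\Delta_\tau^{f_6}\Phi_3$;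 if (S), $F_2\ge0$: $1-e^{-\tau}-\Phi_1(0)+\Phi_3(\tau)$. - $G_{12}$: if (N), $E>0$, $f_9>\tau$: $1-e^{-\tau}+\Delta_0^{f_9}\Phi_4-\Delta_\tau^{f_9}\Phi_3$; if (N), $E\le0$: $1-e^{-\tau}-\Phi_4(0)+\Phi_3(\tau)$. *$G_2=G_{21}+G_{22}$.* - $G_{21}$: if (S), $F_1<0$: $\Delta_0^{f_1}(\Phi_4-\Phi_1)$; if (S), $F_1\ge0$: $\Phi_1(0)-\Phi_4(0)$. - $G_{22}$: if $F_1<0$, $F_3>0$, $\frac{\alpha}{1-\alpha}>\theta_{11}$, $f_4>f_1$: $\Delta_{f_1}^{f_4}(\Phi_4-\Phi_2)$; if $F_1<0$, $F_3\le0$, $\frac{\alpha}{1-\alpha}>\theta_{11}$: $\Phi_2(f_1)-\Phi_4(f_1)$. *$G_3=G_{31}+G_{32}$.* - $G_{31}$: if (S), $F_1\ge0$: $1-e^{-\tau}-\Phi_1(0)+\Phi_2(\tau)$; if (S), $F_1<0$: $1-e^{-\tau}+\Delta_0^{f_1}\Phi_1-\Delta_\tau^{f_1}\Phi_2$. - $G_{32}$: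 if (N), $F_3\le0$: $1-e^{-\tau}-\Phi_4(0)+\Phi_2(\tau)$; if (N), $F_3>0$: $1-e^{-\tau}+\Delta_0^{f_4}\Phi_4-\Delta_\tau^{f_4}\Phi_2$. *$G_4=G_{41}+\dots+G_{48}$.* - $G_{41}$, for $F_3>0$, $D<0$: if $F_2\ge0$, $f_5>f_4$: $\Delta_{f_4}^{f_5}(\Phi_4-\Phi_1)$; if $F_2<0$, $y=\min(f_5,f_6)>f_4$: $\Delta_{f_4}^{y}(\Phi_4-\Phi_1)$. - $G_{42}$, for $F_1<0$: $\Delta_{f_1}^{y}(\Phi_2-\Phi_1)$ if $y>f_1$, where $y=f_3$ if $F_2\ge0,F_3\le0$; $y=\min(f_3,f_4)$ if $F_2\ge0,F_3>0$; $y=\min(f_3,f_6)$ if $F_2<0,F_3\le0$; $y=\min(f_3,f_4,f_6)$ if $F_2<0,F_3>0$. - $G_{43}$, for $F_3>0$, with $x=\max(f_4,f_5)$: $K_x^y-\Delta_x^y\Phi_1$ if $y>x$, where $y=f_7$ if $F_2\ge0$; $y=\min(f_6,f_7)$ if $F_2<0$. - $G_{44}$: $K_{f_3}^y-\Delta_{f_3}^y\Phi_1$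 if $y>f_3$, where $y=f_7$ if $F_2\ge0,F_3\le0$; $y=\min(f_4,f_7)$ if $F_2\ge0,F_3>0$; $y=\min(f_6,f_7)$ if $F_2<0,F_3\le0$; $y=\min(f_4,f_6,f_7)$ if $F_2<0,F_3>0$. - $G_{45}$, for $F_2<0$, $F_3>0$, with $x=\max(f_4,f_6)$: $\Delta_x^y(\Phi_4-\Phi_3)$ if $y>x$, where $y=f_5$ if $E\le0$; $y=\min(f_5,f_9)$ if $E>0$. - $G_{46}$, for $F_2<0$: $\Delta_{f_6}^y(\Phi_2-\Phi_3)$ if $y>f_6$, where $y=f_3$ if $F_3\le0$; $y=\min(f_3,f_4)$ if $F_3>0$. - $G_{47}$: if $F_2<0$, $F_3>0$, $f_8>x=\max(f_4,f_5,f_6)$: $K_x^{f_8}-\Delta_x^{f_8}\Phi_3$. - $G_{48}$, for $F_2<0$, with $x=\max(f_3,f_6)$: $K_x^y-\Delta_x^y\Phi_3$ if $y>x$, where $y=f_8$ if $F_3\le0$; $y=\min(f_4,f_8)$ if $F_3>0$. *$G_5=G_{51}+\dots+G_{54}$, all rows requiring $\frac{\alpha}{1-\alpha}>\theta_{11}$.*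 - $G_{51}$, for $D<0$: $\Delta_0^y(\Phi_4-\Phi_1)$ if $y>0$, where $y=\min(f_1,f_5)$ if $F_1<0$; $y=f_5$ if $F_1\ge0$. - $G_{52}$, for $F_1<0$: $\Delta_{f_1}^y(\Phi_4-\Phi_2)$ if $y>f_1$, where $y=f_5$ if $F_3\le0$; $y=\min(f_4,f_5)$ if $F_3>0$. - $G_{53}$: $K_{f_5}^y-\Delta_{f_5}^y\Phi_1$ if $y>f_5$, where $y=\min(f_1,f_7)$ if $F_1<0$; $y=f_7$ if $F_1\ge0$. - $G_{54}$: if $F_1<0$, $f_3>x=\max(f_1,f_5)$: $K_x^{f_3}-\Delta_x^{f_3}\Phi_2$. *$G_6=G_{61}+\dots+G_{68}$; $G_{61},\dots,G_{64}$ require (S), and $G_{65},\dots,G_{68}$ require (N).* - $G_{61}$, for $F_1<0$: $\Delta_{f_1}^y(\Phi_1-\Phi_3)$ if $y>f_1$, where $y=\min(f_6,f_7)$ if $F_2<0$; $y=f_7$ if $F_2\ge0$. - $G_{62}$: if $F_1<0$, $f_8>x=\max(f_1,f_7)$: $K_x^{f_8}-\Delta_x^{f_8}\Phi_3$. - $G_{63}$: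 $\Delta_\tau^y(\Phi_2-\Phi_3)$ if $y>\tau$, where $y=\min(f_1,f_3)$ if $F_1<0$; $y=f_3$ if $F_1\ge0$. - $G_{64}$: $K_{f_3}^y-\Delta_{f_3}^y\Phi_3$ if $y>f_3$, where $y=\min(f_1,f_8)$ if $F_1<0$; $y=f_8$ if $F_1\ge0$. - $G_{65}$, for $F_3>0$: $\Delta_{f_4}^y(\Phi_4-\Phi_3)$ if $y>f_4$, where $y=\min(f_5,f_9)$ if $E>0$; $y=f_5$ if $E\le0$. - $G_{66}$: if $F_3>0$, $f_8>x=\max(f_4,f_5)$: $K_x^{f_8}-\Delta_x^{f_8}\Phi_3$. - $G_{67}$: $\Delta_\tau^y(\Phi_2-\Phi_3)$ if $y>\tau$, where $y=\min(f_3,f_4)$ if $F_3>0$; $y=f_3$ if $F_3\le0$. - $G_{68}$: $K_{f_3}^y-\Delta_{f_3}^y\Phi_3$ if $y>f_3$, where $y=\min(f_4,f_8)$ if $F_3>0$; $y=f_8$ if $F_3\le0$. *$G_7=G_{71}+\dots+G_{74}$; $G_{71},G_{72}$ require (S), and $G_{73},G_{74}$ require (N).* - $G_{71}$: $1-e^{-\tau}+\Delta_0^y\Phi_1-\Delta_\tau^y\Phi_2$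 if $y>0$, where $y=f_7$ if $F_1\ge0$; $y=\min(f_1,f_7)$ if $F_1<0$. - $G_{72}$: if $f_3>x=\max(f_7,0)$: $K_x^{f_3}-\Delta_x^{f_3}\Phi_2$. - $G_{73}$: $1-e^{-\tau}+\Delta_0^y\Phi_4-\Delta_\tau^y\Phi_2$ if $y>0$, where $y=\min(f_4,f_5)$ if $F_3>0$; $y=f_5$ if $F_3\le0$. - $G_{74}$: if $f_3>x=\max(f_5,\tau)$: $1-e^{-\tau}+K_{\max(f_5,0)}^{f_3}-\Delta_x^{f_3}\Phi_2$. *$G_8$ and $G_9$.* $$G_8=\frac{v\,e^{-\frac{\theta_2}{v}}}{v+u\theta_2}-\frac{v\,e^{-\frac{\theta_2(1+\theta_1)}{v}-\frac{\theta_1}{u}}}{v+u\theta_2},$$ $$G_9=1-e^{-\frac{\theta_1}{u}}\Bigl(1-e^{-\frac{\theta_2(\theta_1+1)}{v}}\Bigr)-e^{-\frac{\theta_2}{v}}-\left(\frac{u\theta_2e^{-\frac{\theta_1\theta_2}{u\theta_2}-\frac{\theta_2(\theta_1+1)}{v}}}{u\theta_2+v}-\frac{u\theta_2e^{-\frac{\theta_2}{v}}}{u\theta_2+v}\right).$$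 -/

import Mathlib

open MeasureTheory ProbabilityTheory

noncomputable section

namespace DURSMA

/-- The two remote radio heads. -/
inductive RRH where
  | i : RRH
  | j : RRH

/-- The two users; `a` is the one that splits its message. -/
inductive User where
  | a : User
  | b : User

/-- The parameters of the network: transmit powers, noise variance, path-loss law, distances, the
predetermined power split `α` used when RSMA is selected, the target-rate factor `β`, and the
target rates. -/
structure Network where
  Pa : ℝ
  Pb : ℝ
  noiseVar : ℝ
  c : ℝ
  pathLossExp : ℝ
  dist : RRH → User → ℝ
  α : ℝ
  β : ℝ
  Ra : ℝ
  Rb : ℝ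
  Pa_pos : 0 < Pa
  Pb_pos : 0 < Pb
  noiseVar_pos : 0 < noiseVar
  c_pos : 0 < c
  dist_pos : ∀ k m, 0 < dist k m
  α_pos : 0 < α
  α_lt_one : α < 1
  β_pos : 0 < β
  β_le_one : β ≤ 1
  Ra_pos : 0 < Ra
  Rb_pos : 0 < Rb

/-- A realization of the four channel power gains `|h_{km}|²`. -/
abbrev Gains : Type := RRH → User → ℝ

/-- The standard circularly symmetric complex Gaussian law `CN(0,1)`, given by its density
`exp(-|w|²)/π`. -/
def stdComplexGaussian : Measure ℂ :=
  volume.withDensity fun w => ENNReal.ofReal (Real.exp (-‖w‖ ^ 2) / Real.pi)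

/-- The power gains of given fading coefficients. -/
def gains {Ω : Type*} (h : RRH → User → Ω → ℂ) (ω : Ω) : Gains :=
  fun k m => ‖h k m ω‖ ^ 2

namespace Network

variable (N : Network)

/-! ### Derived parameters -/

/-- Path-loss factor. -/
def l (k : RRH) (m : User) : ℝ := N.c * N.dist k m ^ (-N.pathLossExp)

/-- Transmit SNR of user `a`. -/
def γa : ℝ := N.Pa / N.noiseVar

/-- Transmit SNR of user `b`. -/
def γb : ℝ := N.Pb / N.noiseVar

def θ₁ : ℝ := 2 ^ N.Ra - 1

def θ₁₁ : ℝ := 2 ^ (N.β * N.Ra) - 1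

def θ₁₂ : ℝ := 2 ^ ((1 - N.β) * N.Ra) - 1

def θ₂ : ℝ := 2 ^ N.Rb - 1

/-! ### SINRs -/

/-- SINR of `x_{1a}` under RSMA with power split `α`. -/
def sinr1a (α : ℝ) (g : Gains) (k : RRH) : ℝ :=
  α * N.l k .a * N.γa * g k .a /
    ((1 - α) * N.l k .a * N.γa * g k .a + N.l k .b * N.γb * g k .b + 1)

/-- SINR of `x_b` under RSMA, after removal of `x_{1a}`. -/
def sinrB (α : ℝ) (g : Gains) (k : RRH) : ℝ :=
  N.l k .b * N.γb * g k .b / ((1 - α) * N.l k .a * N.γa * g k .a + 1)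

/-- SINR of `x_{2a}` under RSMA, after removal of `x_{1a}` and `x_b`. -/
def sinr2a (α : ℝ) (g : Gains) (k : RRH) : ℝ :=
  (1 - α) * N.l k .a * N.γa * g k .a

/-- NOMA, `b` decoded first: SINR of user `b`. -/
def sinrBAb (g : Gains) (k : RRH) : ℝ :=
  N.l k .b * N.γb * g k .b / (N.l k .a * N.γa * g k .a + 1)

/-- NOMA, `b` decoded first: SINR of user `a`, after removal of `x_b`. -/
def sinrBAa (g : Gains) (k : RRH) : ℝ :=
  N.l k .a * N.γa * g k .a

/-- NOMA, `a` decoded first: SINR of user `a`. -/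
def sinrABa (g : Gains) (k : RRH) : ℝ :=
  N.l k .a * N.γa * g k .a / (N.l k .b * N.γb * g k .b + 1)

/-! ### Decoding with cooperating RRHs

A message decoded at one RRH is passed over the ideal feedback link and is removed at both, so a
stage of successive interference cancellation succeeds when at least one RRH decodes the message. -/

/-- NOMA delivers the message of user `a`, in one of the two decoding orders. -/
def NomaDecodesA (g : Gains) : Prop :=
  (∃ k, N.θ₁ ≤ N.sinrABa g k) ∨
    ((∃ k, N.θ₂ ≤ N.sinrBAb g k) ∧ ∃ k, N.θ₁ ≤ N.sinrBAa g k)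

/-- RSMA, with power split `α` and decoding order `(x_{1a}, x_b, x_{2a})`, delivers both parts of
the message of user `a`. -/
def RsmaDecodesA (α : ℝ) (g : Gains) : Prop :=
  (∃ k, N.θ₁₁ ≤ N.sinr1a α g k) ∧ (∃ k, N.θ₂ ≤ N.sinrB α g k) ∧
    ∃ k, N.θ₁₂ ≤ N.sinr2a α g k

/-- A 1-bit feedback to user `a`, computed from the channel gains: the bit is `0` (NOMA) when NOMA
delivers the message of user `a`, and `1` (RSMA) when RSMA is the only way to deliver it. When
neither delivers it, the bit may be either. -/
structure IsFeedback (z : Gains → Fin 2) : Prop where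
  noma : ∀ g : Gains, (∀ k m, 0 ≤ g k m) → N.NomaDecodesA g → z g = 0
  rsma : ∀ g : Gains, (∀ k m, 0 ≤ g k m) → ¬ N.NomaDecodesA g → N.RsmaDecodesA N.α g → z g = 1

/-- User `a` is in outage: its message is not delivered by the scheme that the bit selects. -/
def OutageA (z : Fin 2) (g : Gains) : Prop :=
  if z = 0 then ¬ N.NomaDecodesA g else ¬ N.RsmaDecodesA N.α g

/-! ### Auxiliary functions -/

def f₁ (x : ℝ) : ℝ :=
  N.θ₂ * N.α / (x * N.γb * (N.α - N.θ₁₁ * (1 - N.α) * (1 + N.θ₂)))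

def f₂ (x : ℝ) : ℝ :=
  (N.α * N.θ₁₂ - N.θ₁₁ * (1 - N.α) * (N.θ₁₂ + 1)) / (x * N.γb * N.θ₁₁ * (1 - N.α))

def f₃ (x : ℝ) : ℝ :=
  N.θ₂ * (N.θ₁₂ + 1) / (x * N.γb)

def f₄ (x : ℝ) : ℝ :=
  N.θ₂ * (1 + N.θ₁ * (1 - N.α)) / (x * N.γb * (1 - N.θ₁ * N.θ₂ * (1 - N.α)))

def f₅ (x : ℝ) : ℝ :=
  (N.θ₁₂ - N.θ₁ * (1 - N.α)) / (x * N.γb * N.θ₁ * (1 - N.α))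

def f₆ (x : ℝ) : ℝ :=
  N.θ₂ * N.α * (1 + N.θ₁₁) / (x * N.γb * (N.α - N.θ₁₁ * (1 - N.α + N.θ₂)))

def f₇ (x : ℝ) : ℝ :=
  (N.θ₁₂ * (N.α - N.θ₁₁ * (1 - N.α)) - N.θ₁₁ * (1 - N.α)) / (x * N.γb * N.θ₁₁ * (1 - N.α))

def f₈ (x : ℝ) : ℝ :=
  N.θ₂ * (N.θ₁₂ + 1 - N.α) / (x * N.γb * (1 - N.α))

def f₉ (x : ℝ) : ℝ :=
  N.θ₂ * (N.θ₁ + 1) / (x * N.γb * (1 - N.θ₁ * N.θ₂))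

def F₁ : ℝ := -(N.α - N.θ₁₁ * (1 - N.α) * (1 + N.θ₂))

def F₂ : ℝ := -(N.α - N.θ₁₁ * (1 - N.α + N.θ₂))

def F₃ : ℝ := 1 - N.θ₁ * N.θ₂ * (1 - N.α)

def Φ₁ (x y z : ℝ) : ℝ :=
  x * N.γa * (N.α - N.θ₁₁ * (1 - N.α)) *
      Real.exp (-((N.θ₁₁ * y * N.γb * z + N.θ₁₁) /
        (x * N.γa * (N.α - N.θ₁₁ * (1 - N.α)))) - z) /
    (x * N.γa * (N.α - N.θ₁₁ * (1 - N.α)) + N.γb * y * N.θ₁₁)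

def Φ₂ (x y z : ℝ) : ℝ :=
  x * N.θ₂ * N.γa * (1 - N.α) *
      Real.exp (-((y * N.γb * z - N.θ₂) / (x * N.γa * N.θ₂ * (1 - N.α))) - z) /
    (x * N.θ₂ * N.γa * (1 - N.α) + N.γb * y)

def Φ₃ (x y z : ℝ) : ℝ :=
  x * N.θ₂ * N.γa * Real.exp (-((y * N.γb * z - N.θ₂) / (x * N.γa * N.θ₂)) - z) /
    (x * N.θ₂ * N.γa + N.γb * y)

def Φ₄ (x y z : ℝ) : ℝ :=
  x * N.γa * Real.exp (-((N.θ₁ * y * N.γb * z + N.θ₁) / (x * N.γa)) - z) /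
    (x * N.γa + N.γb * y * N.θ₁)

/-! ### The closed forms, for the RRH `k` -/

/-- `θ₂ / (l_{kb} γ_b)`. -/
def τ (k : RRH) : ℝ := N.θ₂ / (N.l k .b * N.γb)

/-- `exp(-θ₁₂ / ((1-α) l_{ka} γ_a))`. -/
def κ (k : RRH) : ℝ := Real.exp (-(N.θ₁₂ / ((1 - N.α) * N.l k .a * N.γa)))

/-- `α/(1-α) > θ₁₁` and `θ₁₁ - θ₁(α - θ₁₁(1-α)) < 0`. -/
def Split : Prop :=
  N.α / (1 - N.α) > N.θ₁₁ ∧ N.θ₁₁ - N.θ₁ * (N.α - N.θ₁₁ * (1 - N.α)) < 0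

/-- `α/(1-α) ≤ θ₁₁` or `θ₁₁ - θ₁(α - θ₁₁(1-α)) ≥ 0`. -/
def NonSplit : Prop :=
  N.α / (1 - N.α) ≤ N.θ₁₁ ∨ N.θ₁₁ - N.θ₁ * (N.α - N.θ₁₁ * (1 - N.α)) ≥ 0

instance : Decidable N.Split := inferInstanceAs (Decidable (_ ∧ _))

instance : Decidable N.NonSplit := inferInstanceAs (Decidable (_ ∨ _))

/-! Short names for `Φ₁, …, Φ₄` and `f₁, …, f₉` at the path-loss factors of the RRH `k`. -/
def ph1 (k : RRH) (t : ℝ) : ℝ := N.Φ₁ (N.l k .a) (N.l k .b) t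

def ph2 (k : RRH) (t : ℝ) : ℝ := N.Φ₂ (N.l k .a) (N.l k .b) t

def ph3 (k : RRH) (t : ℝ) : ℝ := N.Φ₃ (N.l k .a) (N.l k .b) t

def ph4 (k : RRH) (t : ℝ) : ℝ := N.Φ₄ (N.l k .a) (N.l k .b) t

def g1 (k : RRH) : ℝ := N.f₁ (N.l k .b)

def g3 (k : RRH) : ℝ := N.f₃ (N.l k .b)

def g4 (k : RRH) : ℝ := N.f₄ (N.l k .b)

def g5 (k : RRH) : ℝ := N.f₅ (N.l k .b)

def g6 (k : RRH) : ℝ := N.f₆ (N.l k .b)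

def g7 (k : RRH) : ℝ := N.f₇ (N.l k .b)

def g8 (k : RRH) : ℝ := N.f₈ (N.l k .b)

def g9 (k : RRH) : ℝ := N.f₉ (N.l k .b)

/-! #### `G₁` -/

def G₁₁ (k : RRH) : ℝ :=
  if N.Split ∧ N.F₂ < 0 ∧ N.g6 k > N.τ k then
    1 + N.ph1 k (N.g6 k) - N.ph1 k 0 - Real.exp (-N.τ k) - N.ph3 k (N.g6 k) + N.ph3 k (N.τ k)
  else if N.Split ∧ N.F₂ ≥ 0 then
    1 - N.ph1 k 0 - Real.exp (-N.τ k) + N.ph3 k (N.τ k)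
  else 0

def G₁₂ (k : RRH) : ℝ :=
  if N.NonSplit ∧ 1 - N.θ₁ * N.θ₂ > 0 ∧ N.g9 k > N.τ k then
    1 + N.ph4 k (N.g9 k) - N.ph4 k 0 - Real.exp (-N.τ k) - N.ph3 k (N.g9 k) + N.ph3 k (N.τ k)
  else if N.NonSplit ∧ 1 - N.θ₁ * N.θ₂ ≤ 0 then
    1 - N.ph4 k 0 - Real.exp (-N.τ k) + N.ph3 k (N.τ k)
  else 0

def G₁ (k : RRH) : ℝ := N.G₁₁ k + N.G₁₂ k

/-! #### `G₂` -/

def G₂₁ (k : RRH) : ℝ :=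
  if N.Split ∧ N.F₁ < 0 then
    N.ph4 k (N.g1 k) - N.ph4 k 0 - N.ph1 k (N.g1 k) + N.ph1 k 0
  else if N.Split ∧ N.F₁ ≥ 0 then
    N.ph1 k 0 - N.ph4 k 0
  else 0

def G₂₂ (k : RRH) : ℝ :=
  if N.F₁ < 0 ∧ N.F₃ > 0 ∧ N.α / (1 - N.α) > N.θ₁₁ ∧ N.g4 k > N.g1 k then
    N.ph4 k (N.g4 k) - N.ph4 k (N.g1 k) - N.ph2 k (N.g4 k) + N.ph2 k (N.g1 k)
  else if N.F₁ < 0 ∧ N.F₃ ≤ 0 ∧ N.α / (1 - N.α) > N.θ₁₁ then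
    N.ph2 k (N.g1 k) - N.ph4 k (N.g1 k)
  else 0

def G₂ (k : RRH) : ℝ := N.G₂₁ k + N.G₂₂ k

/-! #### `G₃` -/

def G₃₁ (k : RRH) : ℝ :=
  if N.F₁ ≥ 0 ∧ N.Split then
    1 - N.ph1 k 0 - Real.exp (-N.τ k) + N.ph2 k (N.τ k)
  else if N.F₁ < 0 ∧ N.Split then
    1 + N.ph1 k (N.g1 k) - N.ph1 k 0 - Real.exp (-N.τ k) - N.ph2 k (N.g1 k) + N.ph2 k (N.τ k)
  else 0

def G₃₂ (k : RRH) : ℝ :=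
  if N.F₃ ≤ 0 ∧ N.NonSplit then
    1 - N.ph4 k 0 - Real.exp (-N.τ k) + N.ph2 k (N.τ k)
  else if N.F₃ > 0 ∧ N.NonSplit then
    1 + N.ph4 k (N.g4 k) - N.ph4 k 0 - Real.exp (-N.τ k) - N.ph2 k (N.g4 k) + N.ph2 k (N.τ k)
  else 0

def G₃ (k : RRH) : ℝ := N.G₃₁ k + N.G₃₂ k

/-! #### `G₄` -/

def G₄₁ (k : RRH) : ℝ :=
  if N.F₂ ≥ 0 ∧ N.F₃ > 0 ∧ N.θ₁₁ - N.θ₁ * N.α + N.θ₁ * N.θ₁₁ * (1 - N.α) < 0 ∧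
      N.g5 k > N.g4 k then
    N.ph4 k (N.g5 k) - N.ph4 k (N.g4 k) + N.ph1 k (N.g4 k) - N.ph1 k (N.g5 k)
  else if N.F₂ < 0 ∧ N.F₃ > 0 ∧ N.θ₁₁ - N.θ₁ * N.α + N.θ₁ * N.θ₁₁ * (1 - N.α) < 0 ∧
      min (N.g5 k) (N.g6 k) > N.g4 k then
    N.ph4 k (min (N.g5 k) (N.g6 k)) - N.ph4 k (N.g4 k)
      - N.ph1 k (min (N.g5 k) (N.g6 k)) + N.ph1 k (N.g4 k)
  else 0

def G₄₂ (k : RRH) : ℝ :=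
  if N.F₂ ≥ 0 ∧ N.F₁ < 0 ∧ N.F₃ ≤ 0 ∧ N.g3 k > N.g1 k then
    N.ph2 k (N.g3 k) - N.ph2 k (N.g1 k) - N.ph1 k (N.g3 k) + N.ph1 k (N.g1 k)
  else if N.F₂ ≥ 0 ∧ N.F₁ < 0 ∧ N.F₃ > 0 ∧ min (N.g3 k) (N.g4 k) > N.g1 k then
    N.ph2 k (min (N.g3 k) (N.g4 k)) - N.ph2 k (N.g1 k)
      - N.ph1 k (min (N.g3 k) (N.g4 k)) + N.ph1 k (N.g1 k)
  else if N.F₂ < 0 ∧ N.F₁ < 0 ∧ N.F₃ ≤ 0 ∧ min (N.g3 k) (N.g6 k) > N.g1 k then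
    N.ph2 k (min (N.g3 k) (N.g6 k)) - N.ph2 k (N.g1 k)
      - N.ph1 k (min (N.g3 k) (N.g6 k)) + N.ph1 k (N.g1 k)
  else if N.F₂ < 0 ∧ N.F₁ < 0 ∧ N.F₃ > 0 ∧
      min (N.g3 k) (min (N.g4 k) (N.g6 k)) > N.g1 k then
    N.ph2 k (min (N.g3 k) (min (N.g4 k) (N.g6 k))) - N.ph2 k (N.g1 k)
      - N.ph1 k (min (N.g3 k) (min (N.g4 k) (N.g6 k))) + N.ph1 k (N.g1 k)
  else 0

def G₄₃ (k : RRH) : ℝ :=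
  if N.F₂ ≥ 0 ∧ N.F₃ > 0 ∧ N.g7 k > max (N.g4 k) (N.g5 k) then
    N.κ k * (Real.exp (-N.g7 k) - Real.exp (-max (N.g4 k) (N.g5 k)))
      - N.ph1 k (N.g7 k) + N.ph1 k (max (N.g4 k) (N.g5 k))
  else if N.F₂ < 0 ∧ N.F₃ > 0 ∧ min (N.g6 k) (N.g7 k) > max (N.g4 k) (N.g5 k) then
    N.κ k * (Real.exp (-min (N.g6 k) (N.g7 k)) - Real.exp (-max (N.g4 k) (N.g5 k)))
      - N.ph1 k (min (N.g6 k) (N.g7 k)) + N.ph1 k (max (N.g4 k) (N.g5 k))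
  else 0

def G₄₄ (k : RRH) : ℝ :=
  if N.F₂ ≥ 0 ∧ N.F₃ ≤ 0 ∧ N.g7 k > N.g3 k then
    N.κ k * (Real.exp (-N.g7 k) - Real.exp (-N.g3 k)) - N.ph1 k (N.g7 k) + N.ph1 k (N.g3 k)
  else if N.F₂ ≥ 0 ∧ N.F₃ > 0 ∧ min (N.g4 k) (N.g7 k) > N.g3 k then
    N.κ k * (Real.exp (-min (N.g4 k) (N.g7 k)) - Real.exp (-N.g3 k))
      - (N.ph1 k (min (N.g4 k) (N.g7 k)) - N.ph1 k (N.g3 k))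
  else if N.F₂ < 0 ∧ N.F₃ ≤ 0 ∧ min (N.g6 k) (N.g7 k) > N.g3 k then
    N.κ k * (Real.exp (-min (N.g6 k) (N.g7 k)) - Real.exp (-N.g3 k))
      - (N.ph1 k (min (N.g6 k) (N.g7 k)) - N.ph1 k (N.g3 k))
  else if N.F₂ < 0 ∧ N.F₃ > 0 ∧ min (N.g4 k) (min (N.g6 k) (N.g7 k)) > N.g3 k then
    N.κ k * (Real.exp (-min (N.g4 k) (min (N.g6 k) (N.g7 k))) - Real.exp (-N.g3 k))
      - (N.ph1 k (min (N.g4 k) (min (N.g6 k) (N.g7 k))) - N.ph1 k (N.g3 k))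
  else 0

def G₄₅ (k : RRH) : ℝ :=
  if N.F₂ < 0 ∧ N.F₃ > 0 ∧ 1 - N.θ₁ * N.θ₂ ≤ 0 ∧ N.g5 k > max (N.g4 k) (N.g6 k) then
    N.ph4 k (N.g5 k) - N.ph4 k (max (N.g4 k) (N.g6 k))
      - N.ph3 k (N.g5 k) + N.ph3 k (max (N.g4 k) (N.g6 k))
  else if N.F₂ < 0 ∧ N.F₃ > 0 ∧ 1 - N.θ₁ * N.θ₂ > 0 ∧
      min (N.g5 k) (N.g9 k) > max (N.g4 k) (N.g6 k) then
    N.ph4 k (min (N.g5 k) (N.g9 k)) - N.ph4 k (max (N.g4 k) (N.g6 k))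
      - N.ph3 k (min (N.g5 k) (N.g9 k)) + N.ph3 k (max (N.g4 k) (N.g6 k))
  else 0

def G₄₆ (k : RRH) : ℝ :=
  if N.F₂ < 0 ∧ N.F₃ ≤ 0 ∧ N.g3 k > N.g6 k then
    N.ph2 k (N.g3 k) - N.ph2 k (N.g6 k) - N.ph3 k (N.g3 k) + N.ph3 k (N.g6 k)
  else if N.F₂ < 0 ∧ N.F₃ > 0 ∧ min (N.g3 k) (N.g4 k) > N.g6 k then
    N.ph2 k (min (N.g3 k) (N.g4 k)) - N.ph2 k (N.g6 k)
      - N.ph3 k (min (N.g3 k) (N.g4 k)) + N.ph3 k (N.g6 k)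
  else 0

def G₄₇ (k : RRH) : ℝ :=
  if N.F₂ < 0 ∧ N.F₃ > 0 ∧ N.g8 k > max (N.g4 k) (max (N.g5 k) (N.g6 k)) then
    N.κ k * (Real.exp (-N.g8 k) - Real.exp (-max (N.g4 k) (max (N.g5 k) (N.g6 k))))
      - (N.ph3 k (N.g8 k) - N.ph3 k (max (N.g4 k) (max (N.g5 k) (N.g6 k))))
  else 0

def G₄₈ (k : RRH) : ℝ :=
  if N.F₂ < 0 ∧ N.F₃ ≤ 0 ∧ N.g8 k > max (N.g3 k) (N.g6 k) then
    N.κ k * (Real.exp (-N.g8 k) - Real.exp (-max (N.g3 k) (N.g6 k)))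
      - (N.ph3 k (N.g8 k) - N.ph3 k (max (N.g3 k) (N.g6 k)))
  else if N.F₂ < 0 ∧ N.F₃ > 0 ∧ min (N.g4 k) (N.g8 k) > max (N.g3 k) (N.g6 k) then
    N.κ k * (Real.exp (-min (N.g4 k) (N.g8 k)) - Real.exp (-max (N.g3 k) (N.g6 k)))
      - (N.ph3 k (min (N.g4 k) (N.g8 k)) - N.ph3 k (max (N.g3 k) (N.g6 k)))
  else 0

def G₄ (k : RRH) : ℝ :=
  N.G₄₁ k + N.G₄₂ k + N.G₄₃ k + N.G₄₄ k + N.G₄₅ k + N.G₄₆ k + N.G₄₇ k + N.G₄₈ k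

/-! #### `G₅` -/

def G₅₁ (k : RRH) : ℝ :=
  if N.α / (1 - N.α) > N.θ₁₁ ∧ N.F₁ < 0 ∧
      N.θ₁₁ - N.θ₁ * N.α + N.θ₁ * N.θ₁₁ * (1 - N.α) < 0 ∧ min (N.g1 k) (N.g5 k) > 0 then
    N.ph4 k (min (N.g1 k) (N.g5 k)) - N.ph4 k 0 + N.ph1 k 0 - N.ph1 k (min (N.g1 k) (N.g5 k))
  else if N.α / (1 - N.α) > N.θ₁₁ ∧ N.F₁ ≥ 0 ∧
      N.θ₁₁ - N.θ₁ * N.α + N.θ₁ * N.θ₁₁ * (1 - N.α) < 0 ∧ N.g5 k > 0 then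
    N.ph4 k (N.g5 k) - N.ph4 k 0 + N.ph1 k 0 - N.ph1 k (N.g5 k)
  else 0

def G₅₂ (k : RRH) : ℝ :=
  if N.α / (1 - N.α) > N.θ₁₁ ∧ N.F₁ < 0 ∧ N.F₃ ≤ 0 ∧ N.g5 k > N.g1 k then
    N.ph4 k (N.g5 k) - N.ph4 k (N.g1 k) + N.ph2 k (N.g1 k) - N.ph2 k (N.g5 k)
  else if N.α / (1 - N.α) > N.θ₁₁ ∧ N.F₁ < 0 ∧ N.F₃ > 0 ∧
      min (N.g4 k) (N.g5 k) > N.g1 k then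
    N.ph4 k (min (N.g4 k) (N.g5 k)) - N.ph4 k (N.g1 k)
      + N.ph2 k (N.g1 k) - N.ph2 k (min (N.g4 k) (N.g5 k))
  else 0

def G₅₃ (k : RRH) : ℝ :=
  if N.α / (1 - N.α) > N.θ₁₁ ∧ N.F₁ < 0 ∧ min (N.g1 k) (N.g7 k) > N.g5 k then
    N.κ k * (Real.exp (-min (N.g1 k) (N.g7 k)) - Real.exp (-N.g5 k))
      - (N.ph1 k (min (N.g1 k) (N.g7 k)) - N.ph1 k (N.g5 k))
  else if N.α / (1 - N.α) > N.θ₁₁ ∧ N.F₁ ≥ 0 ∧ N.g7 k > N.g5 k then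
    N.κ k * (Real.exp (-N.g7 k) - Real.exp (-N.g5 k)) - (N.ph1 k (N.g7 k) - N.ph1 k (N.g5 k))
  else 0

def G₅₄ (k : RRH) : ℝ :=
  if N.α / (1 - N.α) > N.θ₁₁ ∧ N.F₁ < 0 ∧ N.g3 k > max (N.g1 k) (N.g5 k) then
    N.κ k * (Real.exp (-N.g3 k) - Real.exp (-max (N.g1 k) (N.g5 k)))
      - (N.ph2 k (N.g3 k) - N.ph2 k (max (N.g1 k) (N.g5 k)))
  else 0

def G₅ (k : RRH) : ℝ := N.G₅₁ k + N.G₅₂ k + N.G₅₃ k + N.G₅₄ k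

/-! #### `G₆` -/

def G₆₁ (k : RRH) : ℝ :=
  if N.Split ∧ N.F₁ < 0 ∧ N.F₂ < 0 ∧ min (N.g6 k) (N.g7 k) > N.g1 k then
    N.ph1 k (min (N.g6 k) (N.g7 k)) - N.ph1 k (N.g1 k)
      + N.ph3 k (N.g1 k) - N.ph3 k (min (N.g6 k) (N.g7 k))
  else if N.Split ∧ N.F₁ < 0 ∧ N.F₂ ≥ 0 ∧ N.g7 k > N.g1 k then
    N.ph1 k (N.g7 k) - N.ph1 k (N.g1 k) + N.ph3 k (N.g1 k) - N.ph3 k (N.g7 k)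
  else 0

def G₆₂ (k : RRH) : ℝ :=
  if N.Split ∧ N.F₁ < 0 ∧ N.g8 k > max (N.g1 k) (N.g7 k) then
    N.κ k * (Real.exp (-N.g8 k) - Real.exp (-max (N.g1 k) (N.g7 k)))
      - N.ph3 k (N.g8 k) + N.ph3 k (max (N.g1 k) (N.g7 k))
  else 0

def G₆₃ (k : RRH) : ℝ :=
  if N.Split ∧ N.F₁ < 0 ∧ min (N.g1 k) (N.g3 k) > N.τ k then
    N.ph2 k (min (N.g1 k) (N.g3 k)) - N.ph2 k (N.τ k)
      + N.ph3 k (N.τ k) - N.ph3 k (min (N.g1 k) (N.g3 k))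
  else if N.Split ∧ N.F₁ ≥ 0 ∧ N.g3 k > N.τ k then
    N.ph2 k (N.g3 k) - N.ph2 k (N.τ k) + N.ph3 k (N.τ k) - N.ph3 k (N.g3 k)
  else 0

def G₆₄ (k : RRH) : ℝ :=
  if N.Split ∧ N.F₁ < 0 ∧ min (N.g1 k) (N.g8 k) > N.g3 k then
    N.κ k * (Real.exp (-min (N.g1 k) (N.g8 k)) - Real.exp (-N.g3 k))
      - N.ph3 k (min (N.g1 k) (N.g8 k)) + N.ph3 k (N.g3 k)
  else if N.Split ∧ N.F₁ ≥ 0 ∧ N.g8 k > N.g3 k then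
    N.κ k * (Real.exp (-N.g8 k) - Real.exp (-N.g3 k)) - N.ph3 k (N.g8 k) + N.ph3 k (N.g3 k)
  else 0

def G₆₅ (k : RRH) : ℝ :=
  if N.NonSplit ∧ N.F₃ > 0 ∧ 1 - N.θ₁ * N.θ₂ > 0 ∧ min (N.g5 k) (N.g9 k) > N.g4 k then
    N.ph4 k (min (N.g5 k) (N.g9 k)) - N.ph4 k (N.g4 k)
      + N.ph3 k (N.g4 k) - N.ph3 k (min (N.g5 k) (N.g9 k))
  else if N.NonSplit ∧ N.F₃ > 0 ∧ 1 - N.θ₁ * N.θ₂ ≤ 0 ∧ N.g5 k > N.g4 k then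
    N.ph4 k (N.g5 k) - N.ph4 k (N.g4 k) + N.ph3 k (N.g4 k) - N.ph3 k (N.g5 k)
  else 0

def G₆₆ (k : RRH) : ℝ :=
  if N.NonSplit ∧ N.F₃ > 0 ∧ N.g8 k > max (N.g4 k) (N.g5 k) then
    N.κ k * (Real.exp (-N.g8 k) - Real.exp (-max (N.g4 k) (N.g5 k)))
      - N.ph3 k (N.g8 k) + N.ph3 k (max (N.g4 k) (N.g5 k))
  else 0

def G₆₇ (k : RRH) : ℝ :=
  if N.NonSplit ∧ N.F₃ > 0 ∧ min (N.g3 k) (N.g4 k) > N.τ k then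
    N.ph2 k (min (N.g3 k) (N.g4 k)) - N.ph2 k (N.τ k)
      + N.ph3 k (N.τ k) - N.ph3 k (min (N.g3 k) (N.g4 k))
  else if N.NonSplit ∧ N.F₃ ≤ 0 ∧ N.g3 k > N.τ k then
    N.ph2 k (N.g3 k) - N.ph2 k (N.τ k) + N.ph3 k (N.τ k) - N.ph3 k (N.g3 k)
  else 0

def G₆₈ (k : RRH) : ℝ :=
  if N.NonSplit ∧ N.F₃ > 0 ∧ min (N.g4 k) (N.g8 k) > N.g3 k then
    N.κ k * (Real.exp (-min (N.g4 k) (N.g8 k)) - Real.exp (-N.g3 k))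
      - N.ph3 k (min (N.g4 k) (N.g8 k)) + N.ph3 k (N.g3 k)
  else if N.NonSplit ∧ N.F₃ ≤ 0 ∧ N.g8 k > N.g3 k then
    N.κ k * (Real.exp (-N.g8 k) - Real.exp (-N.g3 k)) - N.ph3 k (N.g8 k) + N.ph3 k (N.g3 k)
  else 0

def G₆ (k : RRH) : ℝ :=
  N.G₆₁ k + N.G₆₂ k + N.G₆₃ k + N.G₆₄ k + N.G₆₅ k + N.G₆₆ k + N.G₆₇ k + N.G₆₈ k

/-! #### `G₇` -/

def G₇₁ (k : RRH) : ℝ :=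
  if N.Split ∧ N.F₁ ≥ 0 ∧ N.g7 k > 0 then
    1 - Real.exp (-N.τ k) + N.ph1 k (N.g7 k) - N.ph1 k 0 - N.ph2 k (N.g7 k) + N.ph2 k (N.τ k)
  else if N.Split ∧ N.F₁ < 0 ∧ min (N.g1 k) (N.g7 k) > 0 then
    1 - Real.exp (-N.τ k) + N.ph1 k (min (N.g1 k) (N.g7 k)) - N.ph1 k 0
      - N.ph2 k (min (N.g1 k) (N.g7 k)) + N.ph2 k (N.τ k)
  else 0

def G₇₂ (k : RRH) : ℝ :=
  if N.Split ∧ N.g3 k > max (N.g7 k) 0 then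
    N.κ k * (Real.exp (-N.g3 k) - Real.exp (-max (N.g7 k) 0))
      - N.ph2 k (N.g3 k) + N.ph2 k (max (N.g7 k) 0)
  else 0

def G₇₃ (k : RRH) : ℝ :=
  if N.NonSplit ∧ N.F₃ > 0 ∧ min (N.g4 k) (N.g5 k) > 0 then
    1 - Real.exp (-N.τ k) + N.ph4 k (min (N.g4 k) (N.g5 k)) - N.ph4 k 0
      - N.ph2 k (min (N.g4 k) (N.g5 k)) + N.ph2 k (N.τ k)
  else if N.NonSplit ∧ N.F₃ ≤ 0 ∧ N.g5 k > 0 then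
    1 - Real.exp (-N.τ k) + N.ph4 k (N.g5 k) - N.ph4 k 0 - N.ph2 k (N.g5 k) + N.ph2 k (N.τ k)
  else 0

def G₇₄ (k : RRH) : ℝ :=
  if N.NonSplit ∧ N.g3 k > max (N.g5 k) (N.τ k) then
    1 - Real.exp (-N.τ k) + N.κ k * (Real.exp (-N.g3 k) - Real.exp (-max (N.g5 k) 0))
      - N.ph2 k (N.g3 k) + N.ph2 k (max (N.g5 k) (N.τ k))
  else 0

def G₇ (k : RRH) : ℝ := N.G₇₁ k + N.G₇₂ k + N.G₇₃ k + N.G₇₄ k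

/-! #### `G₈` and `G₉` -/

def G₈ (k : RRH) : ℝ :=
  N.l k .b * N.γb * Real.exp (-(N.θ₂ / (N.l k .b * N.γb))) /
      (N.l k .b * N.γb + N.l k .a * N.γa * N.θ₂)
    - N.l k .b * N.γb *
        Real.exp (-(N.θ₂ * (1 + N.θ₁) / (N.l k .b * N.γb)) - N.θ₁ / (N.l k .a * N.γa)) /
      (N.l k .b * N.γb + N.l k .a * N.γa * N.θ₂)

def G₉ (k : RRH) : ℝ :=
  1 - Real.exp (-(N.θ₁ / (N.l k .a * N.γa))) *
        (1 - Real.exp (-(N.θ₂ * (N.θ₁ + 1) / (N.l k .b * N.γb))))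
    - Real.exp (-(N.θ₂ / (N.l k .b * N.γb)))
    - (N.l k .a * N.θ₂ * N.γa *
          Real.exp (-(N.θ₁ * N.θ₂ / (N.l k .a * N.θ₂ * N.γa))
            - N.θ₂ * (N.θ₁ + 1) / (N.l k .b * N.γb)) /
        (N.l k .a * N.θ₂ * N.γa + N.l k .b * N.γb)
      - N.l k .a * N.θ₂ * N.γa * Real.exp (-(N.θ₂ / (N.l k .b * N.γb))) /
        (N.l k .a * N.θ₂ * N.γa + N.l k .b * N.γb))

end Network

end DURSMA

end

noncomputable section

namespace DURSMA

open Set Filter Topology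

/-! ### Power gains of complex Gaussian coefficients -/

/-! With the prescribed feedback, outage means that neither scheme delivers the message
(`outageA_iff`), so `z` disappears. At one RRH each decoding condition puts the point (gain of a,
gain of b) on one side of a line: `regA`, `regB`, `regC` for the RSMA stages, `regN`, `regM`, `regO`
for NOMA. A stage succeeds if one of the two RRHs has its point in the region, so outage is a
Boolean combination of twelve memberships.

Three implications simplify it. User b is decoded under RSMA wherever it is decoded first under NOMA
(`regM_subset_regB`); user a gains from the removal of interference (`regN_subset_regO`); and since
(1+θ₁₁)(1+θ₁₂) = 1+θ₁, points outside `regO` never allow both x_{1a} and x_{2a} to be decoded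
(`not_regA_and_regC`). If no first NOMA stage succeeds, RSMA must fail at its first, second or third
stage, which gives products of cells 1, of cells 2 and 3, and of cells 4 to 7. If b is decoded first
somewhere, outage means that both points miss `regO`; RSMA then fails by itself, which gives
products of cells 8 and 9. The result is a union of sixteen disjoint rectangles (`outageA_iff_mem`,
`real_outageRegion`).

The four power gains are independent exponential variables (`hasLaw_gains`), so a rectangle has the
product of its cell probabilities, and it remains to compute each cell. At a fixed gain t of user b,
a cell cuts out an interval of gains of user a, from a maximum L(t) of lines to a minimum U(t), of
weight exp(-L(t)-t) - exp(-U(t)-t) (`pairLaw_real_eq`). For an affine L the tail integrals of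
exp(-L(t)-t) are explicit (`IsTail.of_affine`); they are Φ₁, Φ₂, Φ₃, Φ₄ for `lineA`, `lineB`,
`lineM`, `lineN`. The lines attaining the maximum and the minimum change only at crossings, and the
signs of D, F₁, F₂, F₃, E decide which crossings occur at positive t. Splitting by the active pair
of lines gives slabs over intervals between crossings (`slab_Ioo`, `slab_Ioi`), and these integrate
to the terms of the closed forms. -/

lemma stdComplexGaussian_real_norm_sq_le {x : ℝ} (hx : 0 ≤ x) :
    stdComplexGaussian.real {w : ℂ | ‖w‖ ^ 2 ≤ x} = 1 - Real.exp (-x) := by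
  have hmeas : MeasurableSet {w : ℂ | ‖w‖ ^ 2 ≤ x} :=
    measurableSet_le (by fun_prop) measurable_const
  have hderiv : ∀ r ∈ uIcc 0 (√x),
      HasDerivAt (fun r : ℝ => -Real.exp (-r ^ 2)) (2 * (r * Real.exp (-r ^ 2))) r := by
    intro r _
    have h := (((hasDerivAt_pow 2 r).neg).exp).neg
    refine h.congr_deriv ?_
    simp
    ring
  have hradial : ∫ r in (0 : ℝ)..√x, 2 * (r * Real.exp (-r ^ 2)) = 1 - Real.exp (-x) := by
    rw [intervalIntegral.integral_eq_sub_of_hasDerivAt hderiv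
      (Continuous.intervalIntegrable (by fun_prop) _ _)]
    simp [Real.sq_sqrt hx]; ring
  let f : ℝ → ℝ := fun r => if r ^ 2 ≤ x then Real.exp (-r ^ 2) / Real.pi else 0
  have hint : ∫ w : ℂ, f ‖w‖ = 1 - Real.exp (-x) := by
    -- Polar coordinates: the circumference factor 2πr turns exp(-r²)/π into 2r·exp(-r²), which has
    -- the primitive -exp(-r²).
    rw [integral_fun_norm_addHaar (volume : Measure ℂ) f, Complex.finrank_real_complex]
    have hball : (volume : Measure ℂ).real (Metric.ball 0 1) = Real.pi := by
      simp [Measure.real, Complex.volume_ball]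
    rw [hball]
    have h1 : ∫ y in Ioi (0 : ℝ), y ^ (2 - 1) • f y =
        ∫ y in Ioc (0 : ℝ) (√x), y * (Real.exp (-y ^ 2) / Real.pi) := by
      rw [← integral_indicator measurableSet_Ioi, ← integral_indicator measurableSet_Ioc]
      congr 1
      ext y
      by_cases hy : 0 < y
      · have : y ^ 2 ≤ x ↔ y ≤ √x := by
          rw [Real.le_sqrt hy.le hx]
        by_cases h2 : y ^ 2 ≤ x
        · simp [indicator, f, hy, h2, this.1 h2]
        · simp [indicator, f, hy, h2, mt this.2 h2]
      · simp [indicator, hy]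
    rw [h1, ← intervalIntegral.integral_of_le (Real.sqrt_nonneg x), ← hradial]
    rw [intervalIntegral.integral_const_mul]
    have : (fun y : ℝ => y * (Real.exp (-y ^ 2) / Real.pi)) =
        fun y => Real.pi⁻¹ * (y * Real.exp (-y ^ 2)) := by
      ext y; ring
    rw [this, intervalIntegral.integral_const_mul]
    simp only [nsmul_eq_mul, smul_eq_mul]
    field_simp
    push_cast
    ring
  rw [← hint, Measure.real, stdComplexGaussian, withDensity_apply _ hmeas,
    integral_eq_lintegral_of_nonneg_ae]
  · rw [← lintegral_indicator hmeas]
    congr 2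
    ext w
    by_cases hw : ‖w‖ ^ 2 ≤ x
    · simp [indicator, f, hw]
    · simp [indicator, f, hw]
  · refine Eventually.of_forall fun w => ?_
    simp only [f, Pi.zero_apply]
    split_ifs
    · positivity
    · exact le_rfl
  · refine Measurable.aestronglyMeasurable ?_
    exact Measurable.ite hmeas (by fun_prop) measurable_const

instance : IsProbabilityMeasure (expMeasure 1) := isProbabilityMeasure_expMeasure one_pos

/-- Both sides are probability measures with the same distribution function. That the Gaussian
density has total mass one is an instance argument; `hasLaw_gains` inherits it from the assumed laws
of the fading coefficients. -/
lemma map_norm_sq_eq_expMeasure [IsProbabilityMeasure stdComplexGaussian] :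
    stdComplexGaussian.map (fun w : ℂ => ‖w‖ ^ 2) = expMeasure 1 := by
  have hm : Measurable fun w : ℂ => ‖w‖ ^ 2 := by fun_prop
  have := Measure.isProbabilityMeasure_map (μ := stdComplexGaussian) hm.aemeasurable
  refine Measure.eq_of_cdf _ _ ?_
  ext x
  rw [cdf_expMeasure_eq one_pos, cdf_eq_real, map_measureReal_apply hm measurableSet_Iic]
  split_ifs with hx
  · rw [one_mul]
    exact stdComplexGaussian_real_norm_sq_le hx
  · have : (fun w : ℂ => ‖w‖ ^ 2) ⁻¹' Iic x = ∅ := by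
      ext w
      simp only [mem_preimage, mem_Iic, mem_empty_iff_false, iff_false, not_le]
      exact (not_le.1 hx).trans_le (by positivity)
    simp [this]

/-- The law of the pair of gains of the two users at one RRH. -/
def pairLaw : Measure (ℝ × ℝ) := (expMeasure 1).prod (expMeasure 1)

instance : IsProbabilityMeasure pairLaw := by unfold pairLaw; infer_instance

/-- The gains at the RRH `k`. -/
def Gains.at (g : Gains) (k : RRH) : ℝ × ℝ := (g k .a, g k .b)

/-- Independence of the four coefficients is used twice: between the users at one RRH, and between
the pairs belonging to the two RRHs. -/
lemma hasLaw_gains {Ω : Type*} [MeasurableSpace Ω] (P : Measure Ω) [IsProbabilityMeasure P]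
    (h : RRH → User → Ω → ℂ) (hlaw : ∀ k m, HasLaw (h k m) stdComplexGaussian P)
    (hindep : iIndepFun (fun km : RRH × User => h km.1 km.2) P) :
    HasLaw (fun ω => ((gains h ω).at .i, (gains h ω).at .j)) (pairLaw.prod pairLaw) P := by
  have : IsProbabilityMeasure stdComplexGaussian :=
    (hlaw .i .a).isProbabilityMeasure_iff.1 inferInstance
  have hg : ∀ k m, HasLaw (fun ω => ‖h k m ω‖ ^ 2) (expMeasure 1) P := by
    intro k m
    have := HasLaw.comp (Y := fun w : ℂ => ‖w‖ ^ 2) (ν := expMeasure 1)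
      ⟨by fun_prop, map_norm_sq_eq_expMeasure⟩ (hlaw k m)
    exact this
  have hind : iIndepFun (fun (km : RRH × User) ω => ‖h km.1 km.2 ω‖ ^ 2) P :=
    hindep.comp (fun _ w => ‖w‖ ^ 2) (fun _ => by fun_prop)
  have hpair : ∀ k, HasLaw (fun ω => (gains h ω).at k) pairLaw P := by
    intro k
    exact (indepFun_iff_hasLaw_prodMk_prod (hg k .a) (hg k .b)).1
      (hind.indepFun (i := (k, .a)) (j := (k, .b)) (by simp))
  refine (indepFun_iff_hasLaw_prodMk_prod (hpair .i) (hpair .j)).1 ?_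
  exact hind.indepFun_prodMk_prodMk₀ (fun km => (hg km.1 km.2).aemeasurable)
    (.i, .a) (.i, .b) (.j, .a) (.j, .b) (by simp) (by simp) (by simp) (by simp)

/-! ### Integrals over regions bounded by lines -/

/-- `Ψ` is the tail integral `t ↦ ∫ s in Ioi t, exp (-L s - s)`. -/
structure IsTail (L Ψ : ℝ → ℝ) : Prop where
  hasDerivAt : ∀ t, HasDerivAt Ψ (-Real.exp (-L t - t)) t
  tendsto : Tendsto Ψ atTop (𝓝 0)

namespace IsTail

variable {L Ψ : ℝ → ℝ}

lemma integrableOn (h : IsTail L Ψ) (p : ℝ) :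
    IntegrableOn (fun t => Real.exp (-L t - t)) (Ioi p) := by
  have := integrableOn_Ioi_deriv_of_nonpos' (a := p) (fun t _ => h.hasDerivAt t)
    (fun t _ => by simpa using (Real.exp_pos _).le) h.tendsto
  simpa using this.neg

lemma integral_Ioi (h : IsTail L Ψ) (p : ℝ) : ∫ t in Ioi p, Real.exp (-L t - t) = Ψ p := by
  have := integral_Ioi_of_hasDerivAt_of_nonpos' (a := p) (fun t _ => h.hasDerivAt t)
    (fun t _ => by simpa using (Real.exp_pos _).le) h.tendsto
  rw [integral_neg] at this
  linarith

lemma integral_Ioc (h : IsTail L Ψ) {p q : ℝ} (hpq : p ≤ q) :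
    ∫ t in Ioc p q, Real.exp (-L t - t) = Ψ p - Ψ q := by
  have h1 := h.integral_Ioi p
  rw [← Ioc_union_Ioi_eq_Ioi hpq, setIntegral_union (Ioc_disjoint_Ioi le_rfl) measurableSet_Ioi
    ((h.integrableOn p).mono_set Ioc_subset_Ioi_self) (h.integrableOn q), h.integral_Ioi q] at h1
  linarith

/-- Nonnegativity of the slope keeps the exponent -(1+p)t - q tending to -∞; the factor 1/(1+p)
becomes the fraction in front of each Φ once denominators are cleared. -/
lemma of_affine {p q : ℝ} (hp : 0 ≤ p) (hL : ∀ t, L t = p * t + q)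
    (hΨ : ∀ t, Ψ t = Real.exp (-(p * t + q) - t) / (1 + p)) : IsTail L Ψ := by
  obtain rfl : L = fun t => p * t + q := funext hL
  obtain rfl : Ψ = fun t => Real.exp (-(p * t + q) - t) / (1 + p) := funext hΨ
  have hp1 : 1 + p ≠ 0 := by positivity
  refine ⟨fun t => ?_, ?_⟩
  · have h1 : HasDerivAt (fun t : ℝ => -(p * t + q) - t) (-(1 + p)) t := by
      have := ((((hasDerivAt_id t).const_mul p).add_const q).neg).sub (hasDerivAt_id t)
      exact this.congr_deriv (by simp; ring)
    exact (h1.exp.div_const (1 + p)).congr_deriv (by field_simp)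
  · have h1 : Tendsto (fun t : ℝ => -(p * t + q) - t) atTop atBot := by
      have h2 : Tendsto (fun t : ℝ => (1 + p) * t + q) atTop atTop :=
        tendsto_atTop_add_const_right _ _ (tendsto_id.const_mul_atTop (by positivity))
      refine (tendsto_neg_atTop_atBot.comp h2).congr fun t => ?_
      simp only [Function.comp]
      ring
    simpa using (Real.tendsto_exp_atBot.comp h1).div_const (1 + p)

lemma const (c : ℝ) : IsTail (fun _ => c) (fun t => Real.exp (-c) * Real.exp (-t)) :=
  of_affine (p := 0) (q := c) le_rfl (by simp) fun t => by
    rw [← Real.exp_add]; simp [sub_eq_add_neg]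

end IsTail

/-- `f` is integrable on the positive half-line, with integral `v`. -/
def HasTotal (f : ℝ → ℝ) (v : ℝ) : Prop :=
  IntegrableOn f (Ioi 0) ∧ ∫ t in Ioi 0, f t = v

lemma HasTotal.add {f g : ℝ → ℝ} {v w : ℝ} (hf : HasTotal f v) (hg : HasTotal g w) :
    HasTotal (fun t => f t + g t) (v + w) :=
  ⟨hf.1.add hg.1, by rw [integral_add hf.1 hg.1, hf.2, hg.2]⟩

lemma HasTotal.congr {f g : ℝ → ℝ} {v : ℝ} (hf : HasTotal f v)
    (h : ∀ t, 0 < t → g t = f t) : HasTotal g v := by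
  have h' : EqOn g f (Ioi 0) := fun t ht => h t ht
  exact ⟨hf.1.congr_fun h'.symm measurableSet_Ioi,
    by rw [setIntegral_congr_fun measurableSet_Ioi h', hf.2]⟩

/-- Equality almost everywhere suffices, so nothing has to be known at the endpoints of an interval
of parameters. -/
lemma HasTotal.of_ae_eq_indicator {f g : ℝ → ℝ} {s : Set ℝ} (hs : MeasurableSet s)
    (hs0 : s ⊆ Ioi 0) (hf : IntegrableOn f s)
    (h : ∀ᵐ t, 0 < t → g t = s.indicator f t) : HasTotal g (∫ t in s, f t) := by
  have h' : g =ᵐ[volume.restrict (Ioi 0)] s.indicator f :=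
    (ae_restrict_iff' measurableSet_Ioi).2 h
  refine ⟨Integrable.congr ?_ h'.symm, ?_⟩
  · exact ((integrable_indicator_iff hs).2 hf).integrableOn
  · rw [integral_congr_ae h', setIntegral_indicator hs, inter_eq_self_of_subset_right hs0]

/-- The density at `t` of the pairs of gains whose first component exceeds `x`. -/
def weight (t x : ℝ) : ℝ := Real.exp (-x - t)

open Classical in
/-- The contribution of the parameters `t` with `S t` to the probability of the region between the
graphs of `L` and `U`. -/
def slab (L U : ℝ → ℝ) (S : ℝ → Prop) (t : ℝ) : ℝ :=
  if S t then weight t (L t) - weight t (U t) else 0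

lemma HasTotal.of_eq {f : ℝ → ℝ} {v w : ℝ} (h : HasTotal f v) (hvw : w = v) : HasTotal f w :=
  hvw ▸ h

lemma slab_empty {L U : ℝ → ℝ} {S : ℝ → Prop} (h : ∀ t, 0 < t → ¬ S t) :
    HasTotal (slab L U S) 0 := by
  have := HasTotal.of_ae_eq_indicator (g := slab L U S) (f := fun _ => 0) MeasurableSet.empty
    (empty_subset (Ioi 0)) (by simp) (Eventually.of_forall fun t ht => by simp [slab, h t ht])
  simpa using this

lemma ae_ne_and_ne (p q : ℝ) : ∀ᵐ t : ℝ, t ≠ p ∧ t ≠ q := by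
  filter_upwards [(measure_eq_zero_iff_ae_notMem (μ := volume)).1 (measure_singleton p),
    (measure_eq_zero_iff_ae_notMem (μ := volume)).1 (measure_singleton q)] with t h1 h2
  exact ⟨by simpa using h1, by simpa using h2⟩

/-- The condition `S` is only squeezed between the open and the closed interval, so strict and weak
inequalities at a crossing need not be distinguished. -/
lemma slab_Ioc {L U ΨL ΨU : ℝ → ℝ} (hL : IsTail L ΨL) (hU : IsTail U ΨU) {S : ℝ → Prop}
    {p q : ℝ} (hp : 0 ≤ p) (hpq : p ≤ q)
    (h : ∀ t, 0 < t → (p < t → t < q → S t) ∧ (S t → p ≤ t ∧ t ≤ q)) :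
    HasTotal (slab L U S) ((ΨU q - ΨU p) - (ΨL q - ΨL p)) := by
  have h1 := fun t ht => (h t ht).1
  have h2 := fun t ht => (h t ht).2
  have hiL := (hL.integrableOn p).mono_set (Ioc_subset_Ioi_self : Ioc p q ⊆ Ioi p)
  have hiU := (hU.integrableOn p).mono_set (Ioc_subset_Ioi_self : Ioc p q ⊆ Ioi p)
  have := HasTotal.of_ae_eq_indicator (g := slab L U S) measurableSet_Ioc
    (fun t ht => hp.trans_lt ht.1) (hiL.sub hiU) (by
      filter_upwards [ae_ne_and_ne p q] with t ht ht0
      have : S t ↔ t ∈ Ioc p q :=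
        ⟨fun hS => ⟨lt_of_le_of_ne (h2 t ht0 hS).1 ht.1.symm, (h2 t ht0 hS).2⟩,
          fun hS => h1 t ht0 hS.1 (lt_of_le_of_ne hS.2 ht.2)⟩
      by_cases hS : S t
      · simp [slab, weight, hS, this.1 hS]
      · simp [slab, hS, mt this.2 hS])
  convert this using 1
  simp only [Pi.sub_apply]
  rw [integral_sub hiL hiU, hL.integral_Ioc hpq, hU.integral_Ioc hpq]
  ring

/-- The value has the conditional shape of the closed forms. The left end has to be nonnegative only
when the interval is nonempty, because some crossings may be negative. -/
lemma slab_Ioo {L U ΨL ΨU : ℝ → ℝ} (hL : IsTail L ΨL) (hU : IsTail U ΨU) {S : ℝ → Prop}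
    {p q : ℝ} (hp : p < q → 0 ≤ p)
    (h : ∀ t, 0 < t → (p < t → t < q → S t) ∧ (S t → p ≤ t ∧ t ≤ q)) :
    HasTotal (slab L U S) (if q > p then (ΨU q - ΨU p) - (ΨL q - ΨL p) else 0) := by
  have h1 := fun t ht => (h t ht).1
  have h2 := fun t ht => (h t ht).2
  split_ifs with hpq
  · exact slab_Ioc hL hU (hp hpq) (le_of_lt hpq) h
  -- Even when the open interval is empty, `S` may hold at the single point `p = q`, a null set.
  · by_cases hq : 0 ≤ p ∧ p = q
    · obtain ⟨hp0, rfl⟩ := hq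
      simpa using slab_Ioc hL hU hp0 le_rfl h
    · refine slab_empty fun t ht hS => hq ?_
      obtain ⟨ha, hb⟩ := h2 t ht hS
      have : p = q := le_antisymm (ha.trans hb) (not_lt.1 hpq)
      subst this
      exact ⟨by linarith, rfl⟩

lemma slab_Ioi {L U ΨL ΨU : ℝ → ℝ} (hL : IsTail L ΨL) (hU : IsTail U ΨU) {S : ℝ → Prop}
    {p : ℝ} (hp : 0 ≤ p) (h : ∀ t, 0 < t → (p < t → S t) ∧ (S t → p ≤ t)) :
    HasTotal (slab L U S) (ΨL p - ΨU p) := by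
  have h1 := fun t ht => (h t ht).1
  have h2 := fun t ht => (h t ht).2
  have := HasTotal.of_ae_eq_indicator (g := slab L U S) measurableSet_Ioi
    (fun t (ht : p < t) => hp.trans_lt ht) ((hL.integrableOn p).sub (hU.integrableOn p)) (by
      filter_upwards [ae_ne_and_ne p p] with t ht ht0
      have : S t ↔ t ∈ Ioi p :=
        ⟨fun hS => lt_of_le_of_ne (h2 t ht0 hS) ht.1.symm, fun hS => h1 t ht0 hS⟩
      by_cases hS : S t
      · simp only [slab, weight, hS, if_true, indicator_of_mem (this.1 hS), Pi.sub_apply]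
      · simp only [slab, hS, if_false, indicator_of_notMem (mt this.2 hS)])
  convert this using 1
  simp only [Pi.sub_apply]
  rw [integral_sub (hL.integrableOn p) (hU.integrableOn p), hL.integral_Ioi, hU.integral_Ioi]

/-! ### Probabilities of planar regions -/

lemma expMeasure_real_Iic (x : ℝ) :
    (expMeasure 1).real (Iic x) = if 0 ≤ x then 1 - Real.exp (-x) else 0 := by
  rw [← cdf_eq_real, cdf_expMeasure_eq one_pos]
  simp

lemma expMeasure_eq_withDensity : expMeasure 1 = volume.withDensity (exponentialPDF 1) := rfl

lemma measurable_exponentialPDF : Measurable (exponentialPDF 1) :=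
  (measurable_exponentialPDFReal 1).ennreal_ofReal

instance : NullSingletonClass (expMeasure 1) := by
  rw [expMeasure_eq_withDensity]; infer_instance

lemma expMeasure_real_of_Ioo_subset {L U : ℝ} (hL : 0 ≤ L) {s : Set ℝ} (h1 : Ioo L U ⊆ s)
    (h2 : s ⊆ Icc L U) :
    (expMeasure 1).real s = if L < U then Real.exp (-L) - Real.exp (-U) else 0 := by
  have hs : (expMeasure 1).real s = (expMeasure 1).real (Ioc L U) := by
    refine le_antisymm ?_ ?_
    · exact (measureReal_mono h2).trans_eq (measureReal_congr Ioc_ae_eq_Icc.symm)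
    · exact (measureReal_congr (μ := expMeasure 1) Ioo_ae_eq_Ioc).symm.trans_le
        (measureReal_mono h1)
  rw [hs]
  split_ifs with h
  · have : Ioc L U = Iic U \ Iic L := by ext; simp [and_comm]
    rw [this, measureReal_sdiff (Iic_subset_Iic.2 h.le) measurableSet_Iic, expMeasure_real_Iic,
      expMeasure_real_Iic, if_pos hL, if_pos (hL.trans h.le)]
    ring
  · simp [Ioc_eq_empty h]

lemma integral_expMeasure (f : ℝ → ℝ) :
    ∫ t, f t ∂expMeasure 1 = ∫ t in Ioi 0, Real.exp (-t) * f t := by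
  rw [expMeasure_eq_withDensity, integral_withDensity_eq_integral_toReal_smul
    measurable_exponentialPDF (by simp [exponentialPDF]),
    ← integral_indicator measurableSet_Ioi]
  refine integral_congr_ae ?_
  filter_upwards [ae_ne_and_ne 0 0] with t ht
  rcases lt_or_gt_of_ne ht.1 with h | h
  · simp [exponentialPDF_of_neg h, indicator, h.le]
  · simp [exponentialPDF_of_nonneg h.le, indicator, h, (Real.exp_pos _).le]

/-- Fubini along the gain t of user b, with a section that is an interval up to its endpoints; the
exponential law has no atoms and no mass on t ≤ 0. The integrand `f` is separate from the formula in
`L` and `U` so that it can be a sum of slabs. -/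
lemma pairLaw_real_eq {s : Set (ℝ × ℝ)} (hs : MeasurableSet s) {L U f : ℝ → ℝ} {v : ℝ}
    (hL : ∀ t, 0 < t → 0 ≤ L t)
    (h1 : ∀ t, 0 < t → ∀ x, L t < x → x < U t → (x, t) ∈ s)
    (h2 : ∀ t, 0 < t → ∀ x, (x, t) ∈ s → L t ≤ x ∧ x ≤ U t)
    (hv : HasTotal f v)
    (hf : ∀ t, 0 < t → f t = if L t < U t then weight t (L t) - weight t (U t) else 0) :
    pairLaw.real s = v := by
  have key : pairLaw.real s = ∫ t, (expMeasure 1).real ((fun x => (x, t)) ⁻¹' s) ∂expMeasure 1 := by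
    rw [Measure.real, pairLaw, Measure.prod_apply_symm hs, integral_eq_lintegral_of_nonneg_ae
      (Eventually.of_forall fun _ => measureReal_nonneg)]
    · simp [Measure.real]
    · exact (measurable_measure_prodMk_right hs).ennreal_toReal.aestronglyMeasurable
  rw [key, integral_expMeasure, ← hv.2]
  refine setIntegral_congr_fun measurableSet_Ioi fun t ht => ?_
  rw [hf t ht, expMeasure_real_of_Ioo_subset (s := (fun x => (x, t)) ⁻¹' s) (hL t ht)
    (fun x hx => h1 t ht x hx.1 hx.2)
    (fun x hx => h2 t ht x hx)]
  split_ifs with h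
  · rw [weight, weight, mul_sub, ← Real.exp_add, ← Real.exp_add, sub_eq_add_neg
      (-L t), sub_eq_add_neg (-U t),
      add_comm (-t), add_comm (-t)]
  · simp

lemma pairLaw_real_eq_zero {s : Set (ℝ × ℝ)} (hs : MeasurableSet s)
    (h : ∀ x t, 0 < t → (x, t) ∉ s) : pairLaw.real s = 0 := by
  refine pairLaw_real_eq hs (L := 0) (U := 0) (f := slab 0 0 fun _ => False) (fun _ _ => le_rfl)
    (fun t _ x hx hx' => (lt_asymm hx hx').elim) (fun t ht x hx => (h x t ht hx).elim)
    (slab_empty fun _ _ h => h) (fun t _ => by simp [slab])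

namespace Network

variable (N : Network)

/-! ### Signs of the parameters, the rate identity and the sign of D -/

lemma θ₁_pos : 0 < N.θ₁ :=
  sub_pos.2 (Real.one_lt_rpow one_lt_two N.Ra_pos)

lemma θ₁₁_pos : 0 < N.θ₁₁ :=
  sub_pos.2 (Real.one_lt_rpow one_lt_two (mul_pos N.β_pos N.Ra_pos))

lemma θ₁₂_nonneg : 0 ≤ N.θ₁₂ :=
  sub_nonneg.2 (Real.one_le_rpow one_le_two
    (mul_nonneg (sub_nonneg.2 N.β_le_one) N.Ra_pos.le))

lemma θ₂_pos : 0 < N.θ₂ :=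
  sub_pos.2 (Real.one_lt_rpow one_lt_two N.Rb_pos)

/-- The two parts of the split message carry the full rate: (1+θ₁₁)(1+θ₁₂) = 1+θ₁. -/
lemma θ₁_eq : N.θ₁ = N.θ₁₁ + N.θ₁₂ + N.θ₁₁ * N.θ₁₂ := by
  have : (2 : ℝ) ^ N.Ra = 2 ^ (N.β * N.Ra) * 2 ^ ((1 - N.β) * N.Ra) := by
    rw [← Real.rpow_add two_pos]
    ring_nf
  simp only [θ₁, θ₁₁, θ₁₂, this]
  ring

/-- The residual share `1 - α` of the power. -/
def ρ : ℝ := 1 - N.α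

lemma ρ_pos : 0 < N.ρ := sub_pos.2 N.α_lt_one

/-- The coefficient of the gain of user `a` in the decoding condition for `x_{1a}`. -/
def A : ℝ := N.α - N.θ₁₁ * (1 - N.α)

/-- Average received SNR of user `a`. -/
def u (k : RRH) : ℝ := N.l k .a * N.γa

/-- Average received SNR of user `b`. -/
def v (k : RRH) : ℝ := N.l k .b * N.γb

lemma l_pos (k : RRH) (m : User) : 0 < N.l k m :=
  mul_pos N.c_pos (Real.rpow_pos_of_pos (N.dist_pos k m) _)

lemma γa_pos : 0 < N.γa := div_pos N.Pa_pos N.noiseVar_pos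

lemma γb_pos : 0 < N.γb := div_pos N.Pb_pos N.noiseVar_pos

lemma u_pos (k : RRH) : 0 < N.u k := mul_pos (N.l_pos k _) N.γa_pos

lemma v_pos (k : RRH) : 0 < N.v k := mul_pos (N.l_pos k _) N.γb_pos

lemma θ₁₁_lt_iff : N.α / (1 - N.α) > N.θ₁₁ ↔ 0 < N.A := by
  rw [gt_iff_lt, lt_div_iff₀ (show 0 < 1 - N.α from N.ρ_pos), A, sub_pos]

/-- The sign of this quantity decides whether decoding `x_{1a}` is easier than decoding `x_a`. -/
def D : ℝ := N.θ₁₁ - N.θ₁ * N.A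

lemma split_iff : N.Split ↔ 0 < N.A ∧ N.D < 0 := by
  rw [Split, θ₁₁_lt_iff]; rfl

lemma nonSplit_iff : N.NonSplit ↔ ¬ N.Split := by
  simp only [NonSplit, Split, not_and_or, not_lt, ge_iff_le, gt_iff_lt]

/-- If A ≤ 0 then D ≥ θ₁₁ > 0, so the first alternative of (N) is contained in the second. The
dichotomy (S)/(N) thus depends on the sign of D alone. -/
lemma nonSplit_iff_D : N.NonSplit ↔ 0 ≤ N.D := by
  rw [nonSplit_iff, split_iff, not_and_or, not_lt, not_lt, or_iff_right_iff_imp]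
  intro h
  have := mul_nonpos_of_nonneg_of_nonpos N.θ₁_pos.le h
  have := N.θ₁₁_pos
  simp only [D]
  linarith

lemma split_iff_D : N.Split ↔ N.D < 0 := by
  rw [← not_le, ← nonSplit_iff_D, nonSplit_iff, not_not]

/-- A consequence of the rate identity. The second factor is the negative of the numerator of f₅, so
D < 0 exactly when `lineN` meets `lineC` at a positive gain. -/
lemma D_eq : N.D = (1 + N.θ₁₁) * (N.θ₁ * N.ρ - N.θ₁₂) := by
  have := N.θ₁_eq
  simp only [D, A, ρ]
  linear_combination (-1 : ℝ) * this

/-! ### The lines that bound the decoding regions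

At the gain `t` of user `b`, the RRH `k` decodes `x_{1a}` iff the gain of user `a` is at least
`lineA`, and so on. -/

/-- Threshold for decoding `x_{1a}` under RSMA. -/
def lineA (k : RRH) (t : ℝ) : ℝ := N.θ₁₁ * (N.v k * t + 1) / (N.u k * N.A)

/-- Threshold for decoding `x_b` under RSMA. -/
def lineB (k : RRH) (t : ℝ) : ℝ := (N.v k * t - N.θ₂) / (N.u k * N.θ₂ * N.ρ)

/-- Threshold for decoding `x_{2a}` under RSMA. -/
def lineC (k : RRH) (_ : ℝ) : ℝ := N.θ₁₂ / (N.u k * N.ρ)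

/-- Threshold for decoding user `b` first under NOMA. -/
def lineM (k : RRH) (t : ℝ) : ℝ := (N.v k * t - N.θ₂) / (N.u k * N.θ₂)

/-- Threshold for decoding user `a` first under NOMA. -/
def lineN (k : RRH) (t : ℝ) : ℝ := N.θ₁ * (N.v k * t + 1) / N.u k

variable (k : RRH)

/-- Positivity of A makes the line increase, as `IsTail.of_affine` requires. -/
lemma isTail_lineA (hA : 0 < N.A) : IsTail (N.lineA k) (N.ph1 k) := by
  have := N.u_pos k; have := N.v_pos k; have := N.θ₁₁_pos
  refine .of_affine (p := N.θ₁₁ * N.v k / (N.u k * N.A)) (q := N.θ₁₁ / (N.u k * N.A))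
    (by positivity) (fun t => by simp only [lineA]; ring) fun t => ?_
  have h1 : N.ph1 k t = N.u k * N.A * Real.exp (-((N.θ₁₁ * N.v k * t + N.θ₁₁) / (N.u k * N.A)) - t)
      / (N.u k * N.A + N.v k * N.θ₁₁) := by
    simp only [ph1, Φ₁, u, v, A]
    ring_nf
  rw [h1]
  have h2 : -(N.θ₁₁ * N.v k / (N.u k * N.A) * t + N.θ₁₁ / (N.u k * N.A)) - t =
      -((N.θ₁₁ * N.v k * t + N.θ₁₁) / (N.u k * N.A)) - t := by ring
  rw [h2]
  field_simp

lemma isTail_lineB : IsTail (N.lineB k) (N.ph2 k) := by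
  have := N.u_pos k; have := N.v_pos k; have := N.θ₂_pos; have := N.ρ_pos
  refine .of_affine (p := N.v k / (N.u k * N.θ₂ * N.ρ)) (q := -(N.θ₂ / (N.u k * N.θ₂ * N.ρ)))
    (by positivity) (fun t => by simp only [lineB]; ring) fun t => ?_
  have h1 : N.ph2 k t = N.u k * N.θ₂ * N.ρ * Real.exp (-((N.v k * t - N.θ₂) /
    (N.u k * N.θ₂ * N.ρ)) - t)
      / (N.u k * N.θ₂ * N.ρ + N.v k) := by
    simp only [ph2, Φ₂, u, v, ρ]
    ring_nf
  rw [h1]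
  have h2 : -(N.v k / (N.u k * N.θ₂ * N.ρ) * t + -(N.θ₂ / (N.u k * N.θ₂ * N.ρ))) - t =
      -((N.v k * t - N.θ₂) / (N.u k * N.θ₂ * N.ρ)) - t := by ring
  rw [h2]
  field_simp

lemma isTail_lineM : IsTail (N.lineM k) (N.ph3 k) := by
  have := N.u_pos k; have := N.v_pos k; have := N.θ₂_pos
  refine .of_affine (p := N.v k / (N.u k * N.θ₂)) (q := -(N.θ₂ / (N.u k * N.θ₂)))
    (by positivity) (fun t => by simp only [lineM]; ring) fun t => ?_
  have h1 : N.ph3 k t = N.u k * N.θ₂ * Real.exp (-((N.v k * t - N.θ₂) / (N.u k * N.θ₂)) - t)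
      / (N.u k * N.θ₂ + N.v k) := by
    simp only [ph3, Φ₃, u, v]
    ring_nf
  rw [h1]
  have h2 : -(N.v k / (N.u k * N.θ₂) * t + -(N.θ₂ / (N.u k * N.θ₂))) - t =
      -((N.v k * t - N.θ₂) / (N.u k * N.θ₂)) - t := by ring
  rw [h2]
  field_simp

lemma isTail_lineN : IsTail (N.lineN k) (N.ph4 k) := by
  have := N.u_pos k; have := N.v_pos k; have := N.θ₁_pos
  refine .of_affine (p := N.θ₁ * N.v k / N.u k) (q := N.θ₁ / N.u k)
    (by positivity) (fun t => by simp only [lineN]; ring) fun t => ?_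
  have h1 : N.ph4 k t = N.u k * Real.exp (-((N.θ₁ * N.v k * t + N.θ₁) / N.u k) - t)
      / (N.u k + N.v k * N.θ₁) := by
    simp only [ph4, Φ₄, u, v]
    ring_nf
  rw [h1]
  have h2 : -(N.θ₁ * N.v k / N.u k * t + N.θ₁ / N.u k) - t =
      -((N.θ₁ * N.v k * t + N.θ₁) / N.u k) - t := by ring
  rw [h2]
  field_simp

/-- The threshold is constant in t, which is why it enters the closed forms only through κ times
differences of exponentials. -/
lemma isTail_lineC : IsTail (N.lineC k) (fun t => N.κ k * Real.exp (-t)) := by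
  have : N.κ k = Real.exp (-(N.θ₁₂ / (N.u k * N.ρ))) := by
    simp only [κ, u, ρ]; ring_nf
  rw [this]
  exact IsTail.const _

/-- The edge of the quadrant serves as lower boundary where `lineB` and `lineM` are not positive; it
produces the terms 1 - e^{-τ}. -/
lemma isTail_zero : IsTail (fun _ => 0) (fun t => Real.exp (-t)) := by
  simpa using IsTail.const 0

/-! ### Where the lines cross -/

lemma τ_pos : 0 < N.τ k := div_pos N.θ₂_pos (N.v_pos k)

lemma lineA_pos (hA : 0 < N.A) {t : ℝ} (ht : 0 < t) : 0 < N.lineA k t := by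
  have := N.u_pos k; have := N.v_pos k; have := N.θ₁₁_pos
  unfold lineA; positivity

lemma lineN_pos {t : ℝ} (ht : 0 < t) : 0 < N.lineN k t := by
  have := N.u_pos k; have := N.v_pos k; have := N.θ₁_pos
  unfold lineN; positivity

lemma lineC_nonneg (t : ℝ) : 0 ≤ N.lineC k t :=
  div_nonneg N.θ₁₂_nonneg (mul_pos (N.u_pos k) N.ρ_pos).le

/-- Two lines differ by a constant multiple of the distance to their crossing; this turns the
comparison of lines into one between t and the crossing. -/
lemma lt_iff_of_sub_eq {x y c p q : ℝ} (hc : 0 < c) (h : y - x = c * (q - p)) :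
    x < y ↔ p < q := by
  rw [← sub_pos, h, mul_pos_iff_of_pos_left hc, sub_pos]

lemma lineB_pos_iff (t : ℝ) : 0 < N.lineB k t ↔ N.τ k < t := by
  have := N.u_pos k; have := N.v_pos k; have := N.θ₂_pos; have := N.ρ_pos
  refine lt_iff_of_sub_eq (c := N.v k / (N.u k * N.θ₂ * N.ρ)) (by positivity) ?_
  have h : N.τ k = N.θ₂ / N.v k := rfl
  rw [h, lineB]
  field_simp
  ring

lemma lineM_pos_iff (t : ℝ) : 0 < N.lineM k t ↔ N.τ k < t := by
  have := N.u_pos k; have := N.v_pos k; have := N.θ₂_pos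
  refine lt_iff_of_sub_eq (c := N.v k / (N.u k * N.θ₂)) (by positivity) ?_
  have h : N.τ k = N.θ₂ / N.v k := rfl
  rw [h, lineM]
  field_simp
  ring

/-- Both lines vanish at τ, and `lineB` is steeper by the factor 1/(1-α). -/
lemma lineM_lt_lineB_iff (t : ℝ) : N.lineM k t < N.lineB k t ↔ N.τ k < t := by
  have := N.u_pos k; have := N.v_pos k; have := N.θ₂_pos; have := N.ρ_pos; have hα := N.α_pos
  refine lt_iff_of_sub_eq (c := N.α * N.v k / (N.u k * N.θ₂ * N.ρ)) (by positivity) ?_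
  have h : N.τ k = N.θ₂ / N.v k := rfl
  have h' : N.α = 1 - N.ρ := by simp [ρ]
  rw [h, h', lineM, lineB]
  field_simp

/-- Both lines are multiples of v·t+1, so they do not cross at positive t and their order is the
same throughout. -/
lemma lineA_lt_lineN_iff (hA : 0 < N.A) {t : ℝ} (ht : 0 < t) :
    N.lineA k t < N.lineN k t ↔ N.D < 0 := by
  have := N.u_pos k; have := N.v_pos k
  refine lt_iff_of_sub_eq (c := (N.v k * t + 1) / (N.u k * N.A)) (by positivity) ?_
  rw [lineA, lineN, D]
  field_simp
  ring

lemma lineN_lt_lineC_iff (t : ℝ) : N.lineN k t < N.lineC k t ↔ t < N.g5 k := by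
  have := N.u_pos k; have := N.v_pos k; have := N.θ₁_pos; have := N.ρ_pos
  refine lt_iff_of_sub_eq (c := N.θ₁ * N.v k / N.u k) (by positivity) ?_
  have h : N.g5 k = (N.θ₁₂ - N.θ₁ * N.ρ) / (N.v k * N.θ₁ * N.ρ) := rfl
  rw [h, lineN, lineC]
  field_simp
  ring

lemma lineB_lt_lineC_iff (t : ℝ) : N.lineB k t < N.lineC k t ↔ t < N.g3 k := by
  have := N.u_pos k; have := N.v_pos k; have := N.θ₂_pos; have := N.ρ_pos
  refine lt_iff_of_sub_eq (c := N.v k / (N.u k * N.θ₂ * N.ρ)) (by positivity) ?_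
  have h : N.g3 k = N.θ₂ * (N.θ₁₂ + 1) / N.v k := rfl
  rw [h, lineB, lineC]
  field_simp
  ring

lemma lineM_lt_lineC_iff (t : ℝ) : N.lineM k t < N.lineC k t ↔ t < N.g8 k := by
  have := N.u_pos k; have := N.v_pos k; have := N.θ₂_pos; have := N.ρ_pos
  refine lt_iff_of_sub_eq (c := N.v k / (N.u k * N.θ₂)) (by positivity) ?_
  have h : N.g8 k = N.θ₂ * (N.θ₁₂ + N.ρ) / (N.v k * N.ρ) := by
    simp only [g8, f₈, v, ρ]; ring
  rw [h, lineM, lineC]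
  field_simp
  ring

lemma lineA_lt_lineC_iff (hA : 0 < N.A) (t : ℝ) : N.lineA k t < N.lineC k t ↔ t < N.g7 k := by
  have := N.u_pos k; have := N.v_pos k; have := N.θ₁₁_pos; have := N.ρ_pos
  refine lt_iff_of_sub_eq (c := N.θ₁₁ * N.v k / (N.u k * N.A)) (by positivity) ?_
  have h : N.g7 k = (N.θ₁₂ * N.A - N.θ₁₁ * N.ρ) / (N.v k * N.θ₁₁ * N.ρ) := rfl
  rw [h, lineA, lineC]
  field_simp
  ring

/-- The constant term θ₂α is positive, so a crossing at positive t exists exactly when F₁ < 0. F₂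
plays the same role for `lineM`, and F₃ and E do so for the comparisons with `lineN`. -/
lemma lineB_sub_lineA (hA : 0 < N.A) (t : ℝ) : N.lineB k t - N.lineA k t =
    -(N.F₁ * (N.v k * t) + N.θ₂ * N.α) / (N.u k * N.A * N.θ₂ * N.ρ) := by
  have := N.u_pos k; have := N.θ₂_pos; have := N.ρ_pos
  have h' : N.α = N.A + N.θ₁₁ * N.ρ := by simp [ρ, A]
  have h1 : N.F₁ = -(N.A - N.θ₁₁ * N.ρ * N.θ₂) := by simp only [F₁, A, ρ]; ring
  rw [h1, h', lineA, lineB]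
  field_simp
  ring

lemma lineA_lt_lineB_iff (hA : 0 < N.A) (hF : N.F₁ < 0) (t : ℝ) :
    N.lineA k t < N.lineB k t ↔ N.g1 k < t := by
  have := N.u_pos k; have hv := N.v_pos k; have := N.θ₂_pos; have := N.ρ_pos
  refine lt_iff_of_sub_eq (c := -N.F₁ * N.v k / (N.u k * N.A * N.θ₂ * N.ρ)) ?_ ?_
  · have := neg_pos.2 hF; positivity
  have h : N.g1 k = N.θ₂ * N.α / (N.v k * (-N.F₁)) := by simp [g1, f₁, F₁, v]
  have hF0 := hF.ne
  rw [h, N.lineB_sub_lineA k hA]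
  field_simp
  ring

lemma not_lineA_lt_lineB (hA : 0 < N.A) (hF : 0 ≤ N.F₁) {t : ℝ} (ht : 0 < t) :
    ¬ N.lineA k t < N.lineB k t := by
  have := N.u_pos k; have hv := N.v_pos k; have := N.θ₂_pos; have := N.ρ_pos; have := N.α_pos
  rw [← sub_pos, N.lineB_sub_lineA k hA, neg_div, neg_pos, not_lt]
  positivity

lemma lineM_sub_lineA (hA : 0 < N.A) (t : ℝ) : N.lineM k t - N.lineA k t =
    -(N.F₂ * (N.v k * t) + N.θ₂ * (N.α * (1 + N.θ₁₁))) / (N.u k * N.A * N.θ₂) := by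
  have := N.u_pos k; have := N.θ₂_pos
  have h' : N.α * (1 + N.θ₁₁) = N.A + N.θ₁₁ := by simp only [A]; ring
  have h1 : N.F₂ = -(N.A - N.θ₁₁ * N.θ₂) := by simp only [F₂, A]; ring
  rw [h1, h', lineA, lineM]
  field_simp
  ring

lemma lineA_lt_lineM_iff (hA : 0 < N.A) (hF : N.F₂ < 0) (t : ℝ) :
    N.lineA k t < N.lineM k t ↔ N.g6 k < t := by
  have := N.u_pos k; have hv := N.v_pos k; have := N.θ₂_pos
  refine lt_iff_of_sub_eq (c := -N.F₂ * N.v k / (N.u k * N.A * N.θ₂)) ?_ ?_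
  · have := neg_pos.2 hF; positivity
  have h : N.g6 k = N.θ₂ * (N.α * (1 + N.θ₁₁)) / (N.v k * (-N.F₂)) := by
    simp only [g6, f₆, F₂, v, neg_neg]; ring
  have hF0 := hF.ne
  rw [h, N.lineM_sub_lineA k hA]
  field_simp
  ring

lemma not_lineA_lt_lineM (hA : 0 < N.A) (hF : 0 ≤ N.F₂) {t : ℝ} (ht : 0 < t) :
    ¬ N.lineA k t < N.lineM k t := by
  have := N.u_pos k; have hv := N.v_pos k; have := N.θ₂_pos; have := N.α_pos; have := N.θ₁₁_pos
  rw [← sub_pos, N.lineM_sub_lineA k hA, neg_div, neg_pos, not_lt]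
  positivity

lemma lineN_sub_lineB (t : ℝ) : N.lineN k t - N.lineB k t =
    (N.θ₂ * (1 + N.θ₁ * N.ρ) - N.v k * t * N.F₃) / (N.u k * N.θ₂ * N.ρ) := by
  have := N.u_pos k; have := N.θ₂_pos; have := N.ρ_pos
  have h1 : N.F₃ = 1 - N.θ₁ * N.θ₂ * N.ρ := rfl
  rw [h1, lineN, lineB]
  field_simp
  ring

lemma lineB_lt_lineN_iff (hF : 0 < N.F₃) (t : ℝ) :
    N.lineB k t < N.lineN k t ↔ t < N.g4 k := by
  have := N.u_pos k; have hv := N.v_pos k; have := N.θ₂_pos; have := N.ρ_pos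
  refine lt_iff_of_sub_eq (c := N.F₃ * N.v k / (N.u k * N.θ₂ * N.ρ)) (by positivity) ?_
  have h : N.g4 k = N.θ₂ * (1 + N.θ₁ * N.ρ) / (N.v k * N.F₃) := rfl
  rw [h, N.lineN_sub_lineB k]
  field_simp

lemma lineB_lt_lineN (hF : N.F₃ ≤ 0) {t : ℝ} (ht : 0 < t) : N.lineB k t < N.lineN k t := by
  have := N.u_pos k; have hv := N.v_pos k; have := N.θ₂_pos; have := N.ρ_pos; have := N.θ₁_pos
  rw [← sub_pos, N.lineN_sub_lineB k]
  refine div_pos ?_ (by positivity)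
  have h1 := mul_nonpos_of_nonneg_of_nonpos (mul_pos hv ht).le hF
  have h2 : 0 < N.θ₂ * (1 + N.θ₁ * N.ρ) := by positivity
  linarith

lemma lineN_sub_lineM (t : ℝ) : N.lineN k t - N.lineM k t =
    (N.θ₂ * (N.θ₁ + 1) - N.v k * t * (1 - N.θ₁ * N.θ₂)) / (N.u k * N.θ₂) := by
  have := N.u_pos k; have := N.θ₂_pos
  rw [lineN, lineM]
  field_simp
  ring

lemma lineM_lt_lineN_iff (hE : 0 < 1 - N.θ₁ * N.θ₂) (t : ℝ) :
    N.lineM k t < N.lineN k t ↔ t < N.g9 k := by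
  have := N.u_pos k; have hv := N.v_pos k; have := N.θ₂_pos
  refine lt_iff_of_sub_eq (c := (1 - N.θ₁ * N.θ₂) * N.v k / (N.u k * N.θ₂)) (by positivity) ?_
  have h : N.g9 k = N.θ₂ * (N.θ₁ + 1) / (N.v k * (1 - N.θ₁ * N.θ₂)) := rfl
  rw [h, N.lineN_sub_lineM k]
  generalize 1 - N.θ₁ * N.θ₂ = e at *
  field_simp

lemma lineM_lt_lineN (hE : 1 - N.θ₁ * N.θ₂ ≤ 0) {t : ℝ} (ht : 0 < t) :
    N.lineM k t < N.lineN k t := by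
  have := N.u_pos k; have hv := N.v_pos k; have := N.θ₂_pos; have := N.θ₁_pos
  rw [← sub_pos, N.lineN_sub_lineM k]
  refine div_pos ?_ (by positivity)
  have h1 := mul_nonpos_of_nonneg_of_nonpos (mul_pos hv ht).le hE
  have h2 : 0 < N.θ₂ * (N.θ₁ + 1) := by positivity
  linarith

section Crossings

variable {N} {t : ℝ}

lemma lineA_lt_lineB_iff_of_pos (hA : 0 < N.A) (ht : 0 < t) :
    N.lineA k t < N.lineB k t ↔ N.F₁ < 0 ∧ N.g1 k < t := by
  by_cases h : N.F₁ < 0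
  · simp [h, N.lineA_lt_lineB_iff k hA h]
  · simp [h, N.not_lineA_lt_lineB k hA (not_lt.1 h) ht]

lemma lineA_lt_lineM_iff_of_pos (hA : 0 < N.A) (ht : 0 < t) :
    N.lineA k t < N.lineM k t ↔ N.F₂ < 0 ∧ N.g6 k < t := by
  by_cases h : N.F₂ < 0
  · simp [h, N.lineA_lt_lineM_iff k hA h]
  · simp [h, N.not_lineA_lt_lineM k hA (not_lt.1 h) ht]

lemma lineB_lt_lineN_iff_of_pos (ht : 0 < t) : N.lineB k t < N.lineN k t ↔
  (0 < N.F₃ → t < N.g4 k) := by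
  by_cases h : 0 < N.F₃
  · simp [h, N.lineB_lt_lineN_iff k h]
  · simp [h, N.lineB_lt_lineN k (not_lt.1 h) ht]

lemma lineM_lt_lineN_iff_of_pos (ht : 0 < t) :
    N.lineM k t < N.lineN k t ↔ (0 < 1 - N.θ₁ * N.θ₂ → t < N.g9 k) := by
  by_cases h : 0 < 1 - N.θ₁ * N.θ₂
  · simp only [h, N.lineM_lt_lineN_iff k h, forall_const]
  · simp only [h, N.lineM_lt_lineN k (not_lt.1 h) ht, false_imp_iff]

/-- The negated reverse comparison would leave equality at the crossing, so the strict version is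
derived from the same difference. -/
lemma lineM_lt_lineA_iff_of_pos (hA : 0 < N.A) (ht : 0 < t) :
    N.lineM k t < N.lineA k t ↔ (N.F₂ < 0 → t < N.g6 k) := by
  have := N.u_pos k; have hv := N.v_pos k; have := N.θ₂_pos; have := N.α_pos
  have := N.θ₁₁_pos
  by_cases h : N.F₂ < 0
  · have hF := neg_pos.2 h
    have hF0 := h.ne
    rw [lt_iff_of_sub_eq (c := -N.F₂ * N.v k / (N.u k * N.A * N.θ₂)) (by positivity)
      (p := t) (q := N.g6 k)]
    · simp [h]
    · rw [← neg_sub, N.lineM_sub_lineA k hA]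
      have h : N.g6 k = N.θ₂ * (N.α * (1 + N.θ₁₁)) / (N.v k * (-N.F₂)) := by
        simp only [g6, f₆, F₂, v, neg_neg]; ring
      rw [h]
      field_simp
      ring
  · have hF := not_lt.1 h
    simp only [h, false_imp_iff, iff_true]
    rw [← sub_neg, N.lineM_sub_lineA k hA, neg_div, neg_neg_iff_pos]
    positivity

lemma lineB_lt_lineA_iff_of_pos (hA : 0 < N.A) (ht : 0 < t) :
    N.lineB k t < N.lineA k t ↔ (N.F₁ < 0 → t < N.g1 k) := by
  have := N.u_pos k; have hv := N.v_pos k; have := N.θ₂_pos; have := N.α_pos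
  have := N.ρ_pos
  by_cases h : N.F₁ < 0
  · have hF := neg_pos.2 h
    have hF0 := h.ne
    rw [lt_iff_of_sub_eq (c := -N.F₁ * N.v k / (N.u k * N.A * N.θ₂ * N.ρ)) (by positivity)
      (p := t) (q := N.g1 k)]
    · simp [h]
    · rw [← neg_sub, N.lineB_sub_lineA k hA]
      have h : N.g1 k = N.θ₂ * N.α / (N.v k * (-N.F₁)) := by simp [g1, f₁, F₁, v]
      rw [h]
      field_simp
      ring
  · have hF := not_lt.1 h
    simp only [h, false_imp_iff, iff_true]
    rw [← sub_neg, N.lineB_sub_lineA k hA, neg_div, neg_neg_iff_pos]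
    positivity

variable (N)

/-! ### Relative order of the crossings -/

lemma τ_lt_g1 (hA : 0 < N.A) (hF : N.F₁ < 0) : N.τ k < N.g1 k := by
  by_contra! h
  rcases h.lt_or_eq with h | h
  · have h1 := (lineA_lt_lineB_iff_of_pos k hA (N.τ_pos k)).2 ⟨hF, h⟩
    have h2 := N.lineA_pos k hA (N.τ_pos k)
    exact lt_irrefl _ ((N.lineB_pos_iff k _).1 (h2.trans h1))
  · have h1 := (lineB_lt_lineA_iff_of_pos k hA (N.τ_pos k)).not.2 (by simp [hF, h])
    have h2 := N.lineA_pos k hA (N.τ_pos k)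
    exact lt_irrefl _ ((N.lineB_pos_iff k _).1 (h2.trans_le (not_lt.1 h1)))

lemma τ_lt_g6 (hA : 0 < N.A) (hF : N.F₂ < 0) : N.τ k < N.g6 k := by
  by_contra! h
  have h1 := (lineM_lt_lineA_iff_of_pos k hA (N.τ_pos k)).not.2 (by simp [hF, h])
  have h2 := N.lineA_pos k hA (N.τ_pos k)
  exact lt_irrefl _ ((N.lineM_pos_iff k _).1 (h2.trans_le (not_lt.1 h1)))

lemma τ_lt_g4 (hF : 0 < N.F₃) : N.τ k < N.g4 k := by
  by_contra! h
  have h1 : ¬ N.lineB k (N.τ k) < N.lineN k (N.τ k) := by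
    rw [lineB_lt_lineN_iff_of_pos k (N.τ_pos k)]; exact fun h' => h.not_gt (h' hF)
  have h2 := N.lineN_pos k (N.τ_pos k)
  exact lt_irrefl _ ((N.lineB_pos_iff k _).1 (h2.trans_le (not_lt.1 h1)))

lemma τ_lt_g9 (hE : 0 < 1 - N.θ₁ * N.θ₂) : N.τ k < N.g9 k := by
  by_contra! h
  have h1 : ¬ N.lineM k (N.τ k) < N.lineN k (N.τ k) := by
    rw [lineM_lt_lineN_iff_of_pos k (N.τ_pos k)]; exact fun h' => h.not_gt (h' hE)
  have h2 := N.lineN_pos k (N.τ_pos k)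
  exact lt_irrefl _ ((N.lineM_pos_iff k _).1 (h2.trans_le (not_lt.1 h1)))

lemma τ_le_g3 : N.τ k ≤ N.g3 k := by
  have := N.v_pos k; have := N.θ₂_pos; have := N.θ₁₂_nonneg
  have h1 : N.τ k = N.θ₂ / N.v k := rfl
  have h3 : N.g3 k = N.θ₂ * (N.θ₁₂ + 1) / N.v k := rfl
  rw [h1, h3]
  gcongr
  nlinarith

lemma g5_pos_iff : 0 < N.g5 k ↔ N.D < 0 := by
  have := N.v_pos k; have := N.θ₁_pos; have := N.ρ_pos; have := N.θ₁₁_pos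
  have h : N.g5 k = (N.θ₁₂ - N.θ₁ * N.ρ) / (N.v k * N.θ₁ * N.ρ) := rfl
  rw [h, D_eq, div_pos_iff_of_pos_right (by positivity), ← neg_pos, ← mul_neg,
    mul_pos_iff_of_pos_left (by positivity), neg_sub]

/-- D < 0 gives both θ₁₁ < θ₁A and, through f₅ > 0, θ₁ρ < θ₁₂. Hence θ₁₁ρ < θ₁Aρ < θ₁₂A. -/
lemma g7_pos (hA : 0 < N.A) (hD : N.D < 0) : 0 < N.g7 k := by
  have hv := N.v_pos k; have h1 := N.θ₁_pos; have hρ := N.ρ_pos; have h11 := N.θ₁₁_pos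
  have h : N.g7 k = (N.θ₁₂ * N.A - N.θ₁₁ * N.ρ) / (N.v k * N.θ₁₁ * N.ρ) := rfl
  rw [h, div_pos_iff_of_pos_right (by positivity), sub_pos]
  have h5 := (N.g5_pos_iff k).2 hD
  have h' : N.g5 k = (N.θ₁₂ - N.θ₁ * N.ρ) / (N.v k * N.θ₁ * N.ρ) := rfl
  rw [h', div_pos_iff_of_pos_right (by positivity), sub_pos] at h5
  simp only [D] at hD
  nlinarith

/-- For A > 0, D ≥ 0 puts `lineA` on or above `lineN`, so it reaches the constant `lineC` no later.
The algebraic proof also covers A ≤ 0. -/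
lemma g7_le_g5 (hD : 0 ≤ N.D) : N.g7 k ≤ N.g5 k := by
  have := N.v_pos k; have := N.θ₁_pos; have := N.ρ_pos; have := N.θ₁₁_pos
  have h12 := N.θ₁₂_nonneg
  have h : N.g7 k = (N.θ₁₂ * N.A / N.θ₁₁ - N.ρ) / (N.v k * N.ρ) := by
    simp only [g7, f₇, v, ρ, A]; field_simp
  have h' : N.g5 k = (N.θ₁₂ / N.θ₁ - N.ρ) / (N.v k * N.ρ) := by
    simp only [g5, f₅, v, ρ]; field_simp
  rw [h, h', mul_div_assoc, div_eq_mul_one_div N.θ₁₂ N.θ₁]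
  have h1 : N.A / N.θ₁₁ ≤ 1 / N.θ₁ := by
    rw [div_le_div_iff₀ ‹_› ‹_›]
    simp only [D] at hD
    linarith
  gcongr

end Crossings

/-- Collecting the comparisons lets one rewrite turn any slab condition into a Boolean combination
of inequalities between t and crossings, which `grind` can settle. -/
lemma crossings {t : ℝ} (ht : 0 < t) :
    (0 < N.lineB k t ↔ N.τ k < t) ∧ (0 < N.lineM k t ↔ N.τ k < t) ∧
    (N.lineM k t < N.lineB k t ↔ N.τ k < t) ∧
    (N.lineB k t < N.lineN k t ↔ (0 < N.F₃ → t < N.g4 k)) ∧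
    (N.lineM k t < N.lineN k t ↔ (0 < 1 - N.θ₁ * N.θ₂ → t < N.g9 k)) ∧
    (N.lineN k t < N.lineC k t ↔ t < N.g5 k) ∧ (N.lineB k t < N.lineC k t ↔ t < N.g3 k) ∧
    (N.lineM k t < N.lineC k t ↔ t < N.g8 k) :=
  ⟨N.lineB_pos_iff k t, N.lineM_pos_iff k t, N.lineM_lt_lineB_iff k t,
    lineB_lt_lineN_iff_of_pos k ht, lineM_lt_lineN_iff_of_pos k ht,
    N.lineN_lt_lineC_iff k t, N.lineB_lt_lineC_iff k t, N.lineM_lt_lineC_iff k t⟩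

lemma crossings_lineA (hA : 0 < N.A) {t : ℝ} (ht : 0 < t) :
    (N.lineA k t < N.lineB k t ↔ N.F₁ < 0 ∧ N.g1 k < t) ∧
    (N.lineB k t < N.lineA k t ↔ (N.F₁ < 0 → t < N.g1 k)) ∧
    (N.lineA k t < N.lineM k t ↔ N.F₂ < 0 ∧ N.g6 k < t) ∧
    (N.lineM k t < N.lineA k t ↔ (N.F₂ < 0 → t < N.g6 k)) ∧
    (N.lineA k t < N.lineN k t ↔ N.D < 0) ∧ (N.lineA k t < N.lineC k t ↔ t < N.g7 k) :=
  ⟨lineA_lt_lineB_iff_of_pos k hA ht, lineB_lt_lineA_iff_of_pos k hA ht,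
    lineA_lt_lineM_iff_of_pos k hA ht, lineM_lt_lineA_iff_of_pos k hA ht,
      N.lineA_lt_lineN_iff k hA ht,
    N.lineA_lt_lineC_iff k hA t⟩

/-- The last component identifies D with the expanded expression that occurs in `G₄₁` and `G₅₁`. -/
lemma crossing_bounds : 0 < N.τ k ∧ N.τ k ≤ N.g3 k ∧ (0 < N.F₃ → N.τ k < N.g4 k) ∧
    (0 < 1 - N.θ₁ * N.θ₂ → N.τ k < N.g9 k) ∧ (0 < N.g5 k ↔ N.D < 0) ∧
    (0 ≤ N.D → N.g7 k ≤ N.g5 k) ∧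
    N.θ₁₁ - N.θ₁ * N.α + N.θ₁ * N.θ₁₁ * (1 - N.α) = N.D :=
  ⟨N.τ_pos k, N.τ_le_g3 k, N.τ_lt_g4 k, N.τ_lt_g9 k, N.g5_pos_iff k, N.g7_le_g5 k, by
    simp only [D, A]; ring⟩

lemma crossing_bounds_of_A_pos (hA : 0 < N.A) : (N.F₁ < 0 → N.τ k < N.g1 k) ∧
    (N.F₂ < 0 → N.τ k < N.g6 k) ∧ (N.D < 0 → 0 < N.g7 k) ∧ N.α / (1 - N.α) > N.θ₁₁ :=
  ⟨N.τ_lt_g1 k hA, N.τ_lt_g6 k hA, N.g7_pos k hA, N.θ₁₁_lt_iff.2 hA⟩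

lemma A_pos_of_D_neg (hD : N.D < 0) : 0 < N.A := (N.split_iff.1 (N.split_iff_D.2 hD)).1

lemma split_of_D_neg (hD : N.D < 0) : N.Split ∧ ¬ N.NonSplit :=
  ⟨N.split_iff_D.2 hD, fun h => (N.nonSplit_iff_D.1 h).not_gt hD⟩

lemma nonSplit_of_D_nonneg (hD : 0 ≤ N.D) : N.NonSplit ∧ ¬ N.Split :=
  ⟨N.nonSplit_iff_D.2 hD, fun h => (N.split_iff_D.1 h).not_ge hD⟩

/-- Where `lineA` reaches `lineC` it already lies below `lineB`, so `lineB` has reached `lineC`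
before. With the next lemma this limits the arrangements of the three lines that matter for `G₇`. -/
lemma g3_le_of_g1_lt_g7 (hA : 0 < N.A) (hD : N.D < 0) (hF : N.F₁ < 0) (h : N.g1 k < N.g7 k) :
    N.g3 k ≤ N.g7 k := by
  have ht := N.g7_pos k hA hD
  have h1 := (lineA_lt_lineB_iff_of_pos k hA ht).2 ⟨hF, h⟩
  have h2 := (N.lineA_lt_lineC_iff k hA (N.g7 k)).not.2 (lt_irrefl _)
  rw [← not_lt, ← N.lineB_lt_lineC_iff k]
  exact fun h3 => h2 (h1.trans h3)

lemma g1_lt_of_g3_lt_g7 (hA : 0 < N.A) (h : N.g3 k < N.g7 k) :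
    N.F₁ < 0 ∧ N.g1 k < N.g3 k := by
  have ht := (N.τ_pos k).trans_le (N.τ_le_g3 k)
  rw [← lineA_lt_lineB_iff_of_pos k hA ht]
  have h2 := (N.lineA_lt_lineC_iff k hA _).2 h
  have h3 := (N.lineB_lt_lineC_iff k (N.g3 k)).not.2 (lt_irrefl _)
  exact h2.trans_le (not_lt.1 h3)

/-! ### The closed forms as integrals of slabs -/

/-- The eight slabs of `G₄` come from two lower boundaries, `lineA` or `lineM`, and four cases for
the upper one: first the smaller of `lineB` and `lineN`, then the smaller of that and `lineC`. So
`lineC` occurs in two cases. The last condition of each slab says that the section is nonempty. -/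
lemma hasTotal_G₄₁ (hA : 0 < N.A) :
    HasTotal (slab (N.lineA k) (N.lineN k) fun t =>
      ¬ N.lineB k t < N.lineN k t ∧ N.lineN k t < N.lineC k t ∧ ¬ N.lineA k t < N.lineM k t ∧
      N.lineA k t < N.lineN k t)
      (N.G₄₁ k) := by
  have hb := N.crossing_bounds k
  have hb' := N.crossing_bounds_of_A_pos k hA
  by_cases h1 : 0 < N.F₃ ∧ N.D < 0
  · by_cases h2 : N.F₂ < 0
    · exact (slab_Ioo (N.isTail_lineA k hA) (N.isTail_lineN k) (p := N.g4 k)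
        (q := min (N.g5 k) (N.g6 k)) (by grind)
        (fun t ht => by simp only [N.crossings k ht, N.crossings_lineA k hA ht]; grind)).of_eq
          (by grind [G₄₁])
    · exact (slab_Ioo (N.isTail_lineA k hA) (N.isTail_lineN k) (p := N.g4 k)
        (q := N.g5 k) (by grind)
        (fun t ht => by simp only [N.crossings k ht, N.crossings_lineA k hA ht]; grind)).of_eq
          (by grind [G₄₁])
  · exact (slab_empty fun t ht => by
      simp only [N.crossings k ht, N.crossings_lineA k hA ht]; grind).of_eq (by grind [G₄₁])

lemma hasTotal_G₄₂ (hA : 0 < N.A) :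
    HasTotal (slab (N.lineA k) (N.lineB k) fun t =>
      N.lineB k t < N.lineN k t ∧ N.lineB k t < N.lineC k t ∧ ¬ N.lineA k t < N.lineM k t ∧
      N.lineA k t < N.lineB k t)
      (N.G₄₂ k) := by
  have hb := N.crossing_bounds k
  have hb' := N.crossing_bounds_of_A_pos k hA
  by_cases h1 : N.F₁ < 0
  · by_cases h2 : N.F₂ < 0
    · by_cases h3 : 0 < N.F₃
      · exact (slab_Ioo (N.isTail_lineA k hA) (N.isTail_lineB k) (p := N.g1 k)
          (q := min (N.g3 k) (min (N.g4 k) (N.g6 k))) (by grind)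
          (fun t ht => by simp only [N.crossings k ht, N.crossings_lineA k hA ht]; grind)).of_eq
            (by grind [G₄₂])
      · exact (slab_Ioo (N.isTail_lineA k hA) (N.isTail_lineB k) (p := N.g1 k)
          (q := min (N.g3 k) (N.g6 k)) (by grind)
          (fun t ht => by simp only [N.crossings k ht, N.crossings_lineA k hA ht]; grind)).of_eq
            (by grind [G₄₂])
    · by_cases h4 : 0 < N.F₃
      · exact (slab_Ioo (N.isTail_lineA k hA) (N.isTail_lineB k) (p := N.g1 k)
          (q := min (N.g3 k) (N.g4 k)) (by grind)
          (fun t ht => by simp only [N.crossings k ht, N.crossings_lineA k hA ht]; grind)).of_eq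
            (by grind [G₄₂])
      · exact (slab_Ioo (N.isTail_lineA k hA) (N.isTail_lineB k) (p := N.g1 k)
          (q := N.g3 k) (by grind)
          (fun t ht => by simp only [N.crossings k ht, N.crossings_lineA k hA ht]; grind)).of_eq
            (by grind [G₄₂])
  · exact (slab_empty fun t ht => by
      simp only [N.crossings k ht, N.crossings_lineA k hA ht]; grind).of_eq (by grind [G₄₂])

lemma hasTotal_G₄₃ (hA : 0 < N.A) :
    HasTotal (slab (N.lineA k) (N.lineC k) fun t =>
      ¬ N.lineB k t < N.lineN k t ∧ ¬ N.lineN k t < N.lineC k t ∧ ¬ N.lineA k t < N.lineM k t ∧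
      N.lineA k t < N.lineC k t)
      (N.G₄₃ k) := by
  have hb := N.crossing_bounds k
  have hb' := N.crossing_bounds_of_A_pos k hA
  by_cases h1 : 0 < N.F₃
  · by_cases h2 : N.F₂ < 0
    · exact (slab_Ioo (N.isTail_lineA k hA) (N.isTail_lineC k) (p := max (N.g4 k) (N.g5 k))
        (q := min (N.g6 k) (N.g7 k)) (by grind)
        (fun t ht => by simp only [N.crossings k ht, N.crossings_lineA k hA ht]; grind)).of_eq
          (by grind [G₄₃])
    · exact (slab_Ioo (N.isTail_lineA k hA) (N.isTail_lineC k) (p := max (N.g4 k) (N.g5 k))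
        (q := N.g7 k) (by grind)
        (fun t ht => by simp only [N.crossings k ht, N.crossings_lineA k hA ht]; grind)).of_eq
          (by grind [G₄₃])
  · exact (slab_empty fun t ht => by
      simp only [N.crossings k ht, N.crossings_lineA k hA ht]; grind).of_eq (by grind [G₄₃])

lemma hasTotal_G₄₄ (hA : 0 < N.A) :
    HasTotal (slab (N.lineA k) (N.lineC k) fun t =>
      N.lineB k t < N.lineN k t ∧ ¬ N.lineB k t < N.lineC k t ∧ ¬ N.lineA k t < N.lineM k t ∧
      N.lineA k t < N.lineC k t)
      (N.G₄₄ k) := by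
  have hb := N.crossing_bounds k
  have hb' := N.crossing_bounds_of_A_pos k hA
  by_cases h1 : N.F₂ < 0
  · by_cases h2 : 0 < N.F₃
    · exact (slab_Ioo (N.isTail_lineA k hA) (N.isTail_lineC k) (p := N.g3 k)
        (q := min (N.g4 k) (min (N.g6 k) (N.g7 k))) (by grind)
        (fun t ht => by simp only [N.crossings k ht, N.crossings_lineA k hA ht]; grind)).of_eq
          (by grind [G₄₄])
    · exact (slab_Ioo (N.isTail_lineA k hA) (N.isTail_lineC k) (p := N.g3 k)
        (q := min (N.g6 k) (N.g7 k)) (by grind)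
        (fun t ht => by simp only [N.crossings k ht, N.crossings_lineA k hA ht]; grind)).of_eq
          (by grind [G₄₄])
  · by_cases h3 : 0 < N.F₃
    · exact (slab_Ioo (N.isTail_lineA k hA) (N.isTail_lineC k) (p := N.g3 k)
        (q := min (N.g4 k) (N.g7 k)) (by grind)
        (fun t ht => by simp only [N.crossings k ht, N.crossings_lineA k hA ht]; grind)).of_eq
          (by grind [G₄₄])
    · exact (slab_Ioo (N.isTail_lineA k hA) (N.isTail_lineC k) (p := N.g3 k)
        (q := N.g7 k) (by grind)
        (fun t ht => by simp only [N.crossings k ht, N.crossings_lineA k hA ht]; grind)).of_eq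
          (by grind [G₄₄])

lemma hasTotal_G₄₅ (hA : 0 < N.A) :
    HasTotal (slab (N.lineM k) (N.lineN k) fun t =>
      ¬ N.lineB k t < N.lineN k t ∧ N.lineN k t < N.lineC k t ∧ N.lineA k t < N.lineM k t ∧
      N.lineM k t < N.lineN k t)
      (N.G₄₅ k) := by
  have hb := N.crossing_bounds k
  have hb' := N.crossing_bounds_of_A_pos k hA
  by_cases h1 : N.F₂ < 0 ∧ 0 < N.F₃
  · by_cases h2 : 0 < 1 - N.θ₁ * N.θ₂
    · exact (slab_Ioo (N.isTail_lineM k) (N.isTail_lineN k) (p := max (N.g4 k) (N.g6 k))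
        (q := min (N.g5 k) (N.g9 k)) (by grind)
        (fun t ht => by simp only [N.crossings k ht, N.crossings_lineA k hA ht]; grind)).of_eq
          (by grind [G₄₅])
    · exact (slab_Ioo (N.isTail_lineM k) (N.isTail_lineN k) (p := max (N.g4 k) (N.g6 k))
        (q := N.g5 k) (by grind)
        (fun t ht => by simp only [N.crossings k ht, N.crossings_lineA k hA ht]; grind)).of_eq
          (by grind [G₄₅])
  · exact (slab_empty fun t ht => by
      simp only [N.crossings k ht, N.crossings_lineA k hA ht]; grind).of_eq (by grind [G₄₅])

lemma hasTotal_G₄₆ (hA : 0 < N.A) :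
    HasTotal (slab (N.lineM k) (N.lineB k) fun t =>
      N.lineB k t < N.lineN k t ∧ N.lineB k t < N.lineC k t ∧ N.lineA k t < N.lineM k t ∧
      N.lineM k t < N.lineB k t)
      (N.G₄₆ k) := by
  have hb := N.crossing_bounds k
  have hb' := N.crossing_bounds_of_A_pos k hA
  by_cases h1 : N.F₂ < 0
  · by_cases h2 : 0 < N.F₃
    · exact (slab_Ioo (N.isTail_lineM k) (N.isTail_lineB k) (p := N.g6 k)
        (q := min (N.g3 k) (N.g4 k)) (by grind)
        (fun t ht => by simp only [N.crossings k ht, N.crossings_lineA k hA ht]; grind)).of_eq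
          (by grind [G₄₆])
    · exact (slab_Ioo (N.isTail_lineM k) (N.isTail_lineB k) (p := N.g6 k)
        (q := N.g3 k) (by grind)
        (fun t ht => by simp only [N.crossings k ht, N.crossings_lineA k hA ht]; grind)).of_eq
          (by grind [G₄₆])
  · exact (slab_empty fun t ht => by
      simp only [N.crossings k ht, N.crossings_lineA k hA ht]; grind).of_eq (by grind [G₄₆])

lemma hasTotal_G₄₇ (hA : 0 < N.A) :
    HasTotal (slab (N.lineM k) (N.lineC k) fun t =>
      ¬ N.lineB k t < N.lineN k t ∧ ¬ N.lineN k t < N.lineC k t ∧ N.lineA k t < N.lineM k t ∧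
      N.lineM k t < N.lineC k t)
      (N.G₄₇ k) := by
  have hb := N.crossing_bounds k
  have hb' := N.crossing_bounds_of_A_pos k hA
  by_cases h1 : N.F₂ < 0 ∧ 0 < N.F₃
  · exact (slab_Ioo (N.isTail_lineM k) (N.isTail_lineC k) (p := max (N.g4 k) (max (N.g5 k)
      (N.g6 k)))
      (q := N.g8 k) (by grind)
      (fun t ht => by simp only [N.crossings k ht, N.crossings_lineA k hA ht]; grind)).of_eq
        (by grind [G₄₇])
  · exact (slab_empty fun t ht => by
      simp only [N.crossings k ht, N.crossings_lineA k hA ht]; grind).of_eq (by grind [G₄₇])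

lemma hasTotal_G₄₈ (hA : 0 < N.A) :
    HasTotal (slab (N.lineM k) (N.lineC k) fun t =>
      N.lineB k t < N.lineN k t ∧ ¬ N.lineB k t < N.lineC k t ∧ N.lineA k t < N.lineM k t ∧
      N.lineM k t < N.lineC k t)
      (N.G₄₈ k) := by
  have hb := N.crossing_bounds k
  have hb' := N.crossing_bounds_of_A_pos k hA
  by_cases h1 : N.F₂ < 0
  · by_cases h2 : 0 < N.F₃
    · exact (slab_Ioo (N.isTail_lineM k) (N.isTail_lineC k) (p := max (N.g3 k) (N.g6 k))
        (q := min (N.g4 k) (N.g8 k)) (by grind)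
        (fun t ht => by simp only [N.crossings k ht, N.crossings_lineA k hA ht]; grind)).of_eq
          (by grind [G₄₈])
    · exact (slab_Ioo (N.isTail_lineM k) (N.isTail_lineC k) (p := max (N.g3 k) (N.g6 k))
        (q := N.g8 k) (by grind)
        (fun t ht => by simp only [N.crossings k ht, N.crossings_lineA k hA ht]; grind)).of_eq
          (by grind [G₄₈])
  · exact (slab_empty fun t ht => by
      simp only [N.crossings k ht, N.crossings_lineA k hA ht]; grind).of_eq (by grind [G₄₈])

/-- In cell 5 the lower boundary is the larger of `lineA` and `lineB`, the upper one the smaller of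
`lineN` and `lineC`; this gives the four slabs of `G₅`. -/
lemma hasTotal_G₅₁ (hA : 0 < N.A) :
    HasTotal (slab (N.lineA k) (N.lineN k) fun t =>
      ¬ N.lineA k t < N.lineB k t ∧ N.lineN k t < N.lineC k t ∧ N.lineA k t < N.lineN k t)
      (N.G₅₁ k) := by
  have hb := N.crossing_bounds k
  have hb' := N.crossing_bounds_of_A_pos k hA
  by_cases h1 : N.D < 0
  · by_cases h2 : N.F₁ < 0
    · exact (slab_Ioo (N.isTail_lineA k hA) (N.isTail_lineN k) (p := 0)
        (q := min (N.g1 k) (N.g5 k)) (by grind)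
        (fun t ht => by simp only [N.crossings k ht, N.crossings_lineA k hA ht]; grind)).of_eq
          (by grind [G₅₁])
    · exact (slab_Ioo (N.isTail_lineA k hA) (N.isTail_lineN k) (p := 0)
        (q := N.g5 k) (by grind)
        (fun t ht => by simp only [N.crossings k ht, N.crossings_lineA k hA ht]; grind)).of_eq
          (by grind [G₅₁])
  · exact (slab_empty fun t ht => by
      simp only [N.crossings k ht, N.crossings_lineA k hA ht]; grind).of_eq (by grind [G₅₁])

lemma hasTotal_G₅₂ (hA : 0 < N.A) :
    HasTotal (slab (N.lineB k) (N.lineN k) fun t =>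
      N.lineA k t < N.lineB k t ∧ N.lineN k t < N.lineC k t ∧ N.lineB k t < N.lineN k t)
      (N.G₅₂ k) := by
  have hb := N.crossing_bounds k
  have hb' := N.crossing_bounds_of_A_pos k hA
  by_cases h1 : N.F₁ < 0
  · by_cases h2 : 0 < N.F₃
    · exact (slab_Ioo (N.isTail_lineB k) (N.isTail_lineN k) (p := N.g1 k)
        (q := min (N.g4 k) (N.g5 k)) (by grind)
        (fun t ht => by simp only [N.crossings k ht, N.crossings_lineA k hA ht]; grind)).of_eq
          (by grind [G₅₂])
    · exact (slab_Ioo (N.isTail_lineB k) (N.isTail_lineN k) (p := N.g1 k)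
        (q := N.g5 k) (by grind)
        (fun t ht => by simp only [N.crossings k ht, N.crossings_lineA k hA ht]; grind)).of_eq
          (by grind [G₅₂])
  · exact (slab_empty fun t ht => by
      simp only [N.crossings k ht, N.crossings_lineA k hA ht]; grind).of_eq (by grind [G₅₂])

/-- The left end `g5` may be negative, but then D ≥ 0 and `g7 ≤ g5`, so the interval is empty. -/
lemma hasTotal_G₅₃ (hA : 0 < N.A) :
    HasTotal (slab (N.lineA k) (N.lineC k) fun t =>
      ¬ N.lineA k t < N.lineB k t ∧ ¬ N.lineN k t < N.lineC k t ∧ N.lineA k t < N.lineC k t)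
      (N.G₅₃ k) := by
  have hb := N.crossing_bounds k
  have hb' := N.crossing_bounds_of_A_pos k hA
  by_cases h1 : N.F₁ < 0
  · exact (slab_Ioo (N.isTail_lineA k hA) (N.isTail_lineC k) (p := N.g5 k)
      (q := min (N.g1 k) (N.g7 k)) (by grind)
      (fun t ht => by simp only [N.crossings k ht, N.crossings_lineA k hA ht]; grind)).of_eq
        (by grind [G₅₃])
  · exact (slab_Ioo (N.isTail_lineA k hA) (N.isTail_lineC k) (p := N.g5 k)
      (q := N.g7 k) (by grind)
      (fun t ht => by simp only [N.crossings k ht, N.crossings_lineA k hA ht]; grind)).of_eq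
        (by grind [G₅₃])

lemma hasTotal_G₅₄ (hA : 0 < N.A) :
    HasTotal (slab (N.lineB k) (N.lineC k) fun t =>
      N.lineA k t < N.lineB k t ∧ ¬ N.lineN k t < N.lineC k t ∧ N.lineB k t < N.lineC k t)
      (N.G₅₄ k) := by
  have hb := N.crossing_bounds k
  have hb' := N.crossing_bounds_of_A_pos k hA
  by_cases h1 : N.F₁ < 0
  · exact (slab_Ioo (N.isTail_lineB k) (N.isTail_lineC k) (p := max (N.g1 k) (N.g5 k))
      (q := N.g3 k) (by grind)
      (fun t ht => by simp only [N.crossings k ht, N.crossings_lineA k hA ht]; grind)).of_eq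
        (by grind [G₅₄])
  · exact (slab_empty fun t ht => by
      simp only [N.crossings k ht, N.crossings_lineA k hA ht]; grind).of_eq (by grind [G₅₄])

/-- For D < 0, `lineA` lies below `lineN` and replaces it as an upper boundary; the four slabs
separate by `lineA` against `lineB` and then against `lineC`. -/
lemma hasTotal_G₆₁ (hD : N.D < 0) :
    HasTotal (slab (N.lineM k) (N.lineA k) fun t =>
      N.lineA k t < N.lineB k t ∧ N.lineA k t < N.lineC k t ∧ N.lineM k t < N.lineA k t)
      (N.G₆₁ k) := by
  have hA := N.A_pos_of_D_neg hD
  have hS := N.split_of_D_neg hD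
  have hb := N.crossing_bounds k
  have hb' := N.crossing_bounds_of_A_pos k hA
  by_cases h1 : N.F₁ < 0
  · by_cases h2 : N.F₂ < 0
    · exact (slab_Ioo (N.isTail_lineM k) (N.isTail_lineA k hA) (p := N.g1 k)
        (q := min (N.g6 k) (N.g7 k)) (by grind)
        (fun t ht => by simp only [N.crossings_lineA k hA ht]; grind)).of_eq (by grind [G₆₁])
    · exact (slab_Ioo (N.isTail_lineM k) (N.isTail_lineA k hA) (p := N.g1 k)
        (q := N.g7 k) (by grind)
        (fun t ht => by simp only [N.crossings_lineA k hA ht]; grind)).of_eq (by grind [G₆₁])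
  · exact (slab_empty fun t ht => by simp only [N.crossings_lineA k hA ht]; grind).of_eq
      (by grind [G₆₁])

lemma hasTotal_G₆₂ (hD : N.D < 0) :
    HasTotal (slab (N.lineM k) (N.lineC k) fun t =>
      N.lineA k t < N.lineB k t ∧ ¬ N.lineA k t < N.lineC k t ∧ N.lineM k t < N.lineC k t)
      (N.G₆₂ k) := by
  have hA := N.A_pos_of_D_neg hD
  have hS := N.split_of_D_neg hD
  have hb := N.crossing_bounds k
  have hb' := N.crossing_bounds_of_A_pos k hA
  by_cases h1 : N.F₁ < 0
  · exact (slab_Ioo (N.isTail_lineM k) (N.isTail_lineC k) (p := max (N.g1 k) (N.g7 k))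
      (q := N.g8 k) (by grind)
      (fun t ht => by simp only [N.crossings k ht, N.crossings_lineA k hA ht]; grind)).of_eq
        (by grind [G₆₂])
  · exact (slab_empty fun t ht => by
      simp only [N.crossings k ht, N.crossings_lineA k hA ht]; grind).of_eq (by grind [G₆₂])

lemma hasTotal_G₆₃ (hD : N.D < 0) :
    HasTotal (slab (N.lineM k) (N.lineB k) fun t =>
      ¬ N.lineA k t < N.lineB k t ∧ N.lineB k t < N.lineC k t ∧ N.lineM k t < N.lineB k t)
      (N.G₆₃ k) := by
  have hA := N.A_pos_of_D_neg hD
  have hS := N.split_of_D_neg hD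
  have hb := N.crossing_bounds k
  have hb' := N.crossing_bounds_of_A_pos k hA
  by_cases h1 : N.F₁ < 0
  · exact (slab_Ioo (N.isTail_lineM k) (N.isTail_lineB k) (p := N.τ k)
      (q := min (N.g1 k) (N.g3 k)) (by grind)
      (fun t ht => by simp only [N.crossings k ht, N.crossings_lineA k hA ht]; grind)).of_eq
        (by grind [G₆₃])
  · exact (slab_Ioo (N.isTail_lineM k) (N.isTail_lineB k) (p := N.τ k)
      (q := N.g3 k) (by grind)
      (fun t ht => by simp only [N.crossings k ht, N.crossings_lineA k hA ht]; grind)).of_eq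
        (by grind [G₆₃])

lemma hasTotal_G₆₄ (hD : N.D < 0) :
    HasTotal (slab (N.lineM k) (N.lineC k) fun t =>
      ¬ N.lineA k t < N.lineB k t ∧ ¬ N.lineB k t < N.lineC k t ∧ N.lineM k t < N.lineC k t)
      (N.G₆₄ k) := by
  have hA := N.A_pos_of_D_neg hD
  have hS := N.split_of_D_neg hD
  have hb := N.crossing_bounds k
  have hb' := N.crossing_bounds_of_A_pos k hA
  by_cases h1 : N.F₁ < 0
  · exact (slab_Ioo (N.isTail_lineM k) (N.isTail_lineC k) (p := N.g3 k)
      (q := min (N.g1 k) (N.g8 k)) (by grind)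
      (fun t ht => by simp only [N.crossings k ht, N.crossings_lineA k hA ht]; grind)).of_eq
        (by grind [G₆₄])
  · exact (slab_Ioo (N.isTail_lineM k) (N.isTail_lineC k) (p := N.g3 k)
      (q := N.g8 k) (by grind)
      (fun t ht => by simp only [N.crossings k ht, N.crossings_lineA k hA ht]; grind)).of_eq
        (by grind [G₆₄])

/-- For D ≥ 0, f₅ is not positive, so the slab is empty and the closed form vanishes as well. -/
lemma hasTotal_G₆₅ (hD : 0 ≤ N.D) :
    HasTotal (slab (N.lineM k) (N.lineN k) fun t =>
      ¬ N.lineB k t < N.lineN k t ∧ N.lineN k t < N.lineC k t ∧ N.lineM k t < N.lineN k t)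
      (N.G₆₅ k) := by
  have hS := N.nonSplit_of_D_nonneg hD
  have hb := N.crossing_bounds k
  by_cases h1 : 0 < N.F₃
  · by_cases h2 : 0 < 1 - N.θ₁ * N.θ₂
    · exact (slab_Ioo (N.isTail_lineM k) (N.isTail_lineN k) (p := N.g4 k)
        (q := min (N.g5 k) (N.g9 k)) (by grind)
        (fun t ht => by simp only [N.crossings k ht]; grind)).of_eq (by grind [G₆₅])
    · exact (slab_Ioo (N.isTail_lineM k) (N.isTail_lineN k) (p := N.g4 k)
        (q := N.g5 k) (by grind)
        (fun t ht => by simp only [N.crossings k ht]; grind)).of_eq (by grind [G₆₅])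
  · exact (slab_empty fun t ht => by simp only [N.crossings k ht]; grind).of_eq (by grind [G₆₅])

lemma hasTotal_G₆₆ (hD : 0 ≤ N.D) :
    HasTotal (slab (N.lineM k) (N.lineC k) fun t =>
      ¬ N.lineB k t < N.lineN k t ∧ ¬ N.lineN k t < N.lineC k t ∧ N.lineM k t < N.lineC k t)
      (N.G₆₆ k) := by
  have hS := N.nonSplit_of_D_nonneg hD
  have hb := N.crossing_bounds k
  by_cases h1 : 0 < N.F₃
  · exact (slab_Ioo (N.isTail_lineM k) (N.isTail_lineC k) (p := max (N.g4 k) (N.g5 k))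
      (q := N.g8 k) (by grind)
      (fun t ht => by simp only [N.crossings k ht]; grind)).of_eq (by grind [G₆₆])
  · exact (slab_empty fun t ht => by simp only [N.crossings k ht]; grind).of_eq (by grind [G₆₆])

lemma hasTotal_G₆₇ (hD : 0 ≤ N.D) :
    HasTotal (slab (N.lineM k) (N.lineB k) fun t =>
      N.lineB k t < N.lineN k t ∧ N.lineB k t < N.lineC k t ∧ N.lineM k t < N.lineB k t)
      (N.G₆₇ k) := by
  have hS := N.nonSplit_of_D_nonneg hD
  have hb := N.crossing_bounds k
  by_cases h1 : 0 < N.F₃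
  · exact (slab_Ioo (N.isTail_lineM k) (N.isTail_lineB k) (p := N.τ k)
      (q := min (N.g3 k) (N.g4 k)) (by grind)
      (fun t ht => by simp only [N.crossings k ht]; grind)).of_eq (by grind [G₆₇])
  · exact (slab_Ioo (N.isTail_lineM k) (N.isTail_lineB k) (p := N.τ k)
      (q := N.g3 k) (by grind)
      (fun t ht => by simp only [N.crossings k ht]; grind)).of_eq (by grind [G₆₇])

lemma hasTotal_G₆₈ (hD : 0 ≤ N.D) :
    HasTotal (slab (N.lineM k) (N.lineC k) fun t =>
      N.lineB k t < N.lineN k t ∧ ¬ N.lineB k t < N.lineC k t ∧ N.lineM k t < N.lineC k t)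
      (N.G₆₈ k) := by
  have hS := N.nonSplit_of_D_nonneg hD
  have hb := N.crossing_bounds k
  by_cases h1 : 0 < N.F₃
  · exact (slab_Ioo (N.isTail_lineM k) (N.isTail_lineC k) (p := N.g3 k)
      (q := min (N.g4 k) (N.g8 k)) (by grind)
      (fun t ht => by simp only [N.crossings k ht]; grind)).of_eq (by grind [G₆₈])
  · exact (slab_Ioo (N.isTail_lineM k) (N.isTail_lineC k) (p := N.g3 k)
      (q := N.g8 k) (by grind)
      (fun t ht => by simp only [N.crossings k ht]; grind)).of_eq (by grind [G₆₈])

/-- Up to τ the lower boundary is 0, whatever the upper line; this is the common initial part of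
`G₁`, `G₃`, `G₇` and of `G₉`. -/
lemma hasTotal_below_τ {U Ψ : ℝ → ℝ} (hU : IsTail U Ψ) {S : ℝ → Prop}
    (h : ∀ t, 0 < t → (S t ↔ ¬ N.τ k < t)) :
    HasTotal (slab (fun _ => 0) U S) (1 - Real.exp (-N.τ k) + Ψ (N.τ k) - Ψ 0) :=
  (slab_Ioc isTail_zero hU le_rfl (N.τ_pos k).le (fun t ht => by grind)).of_eq
    (by rw [neg_zero, Real.exp_zero]; ring)

lemma hasTotal_G₁₁ (hD : N.D < 0) :
    HasTotal (fun t =>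
      slab (fun _ => 0) (N.lineA k) (fun t => ¬ 0 < N.lineM k t) t +
      slab (N.lineM k) (N.lineA k) (fun t => 0 < N.lineM k t ∧ N.lineM k t < N.lineA k t) t)
      (N.G₁₁ k) := by
  have hA := N.A_pos_of_D_neg hD
  have hS := N.split_of_D_neg hD
  have hb := N.crossing_bounds k
  have hb' := N.crossing_bounds_of_A_pos k hA
  have h0 := N.hasTotal_below_τ k (N.isTail_lineA k hA) fun t ht => (N.lineM_pos_iff k t).not
  by_cases h2 : N.F₂ < 0
  · exact (h0.add (slab_Ioo (N.isTail_lineM k) (N.isTail_lineA k hA) (p := N.τ k) (q := N.g6 k)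
      (by grind) (fun t ht => by
        simp only [N.crossings k ht, N.crossings_lineA k hA ht]; grind))).of_eq (by grind [G₁₁])
  · exact (h0.add (slab_Ioi (N.isTail_lineM k) (N.isTail_lineA k hA) (p := N.τ k)
      (by grind) (fun t ht => by
        simp only [N.crossings k ht, N.crossings_lineA k hA ht]; grind))).of_eq (by grind [G₁₁])

lemma hasTotal_G₁₂ (hD : 0 ≤ N.D) :
    HasTotal (fun t =>
      slab (fun _ => 0) (N.lineN k) (fun t => ¬ 0 < N.lineM k t) t +
      slab (N.lineM k) (N.lineN k) (fun t => 0 < N.lineM k t ∧ N.lineM k t < N.lineN k t) t)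
      (N.G₁₂ k) := by
  have hS := N.nonSplit_of_D_nonneg hD
  have hb := N.crossing_bounds k
  have h0 := N.hasTotal_below_τ k (N.isTail_lineN k) fun t ht => (N.lineM_pos_iff k t).not
  by_cases h2 : 0 < 1 - N.θ₁ * N.θ₂
  · exact (h0.add (slab_Ioo (N.isTail_lineM k) (N.isTail_lineN k) (p := N.τ k) (q := N.g9 k)
      (by grind) (fun t ht => by simp only [N.crossings k ht]; grind))).of_eq (by grind [G₁₂])
  · exact (h0.add (slab_Ioi (N.isTail_lineM k) (N.isTail_lineN k) (p := N.τ k)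
      (by grind) (fun t ht => by simp only [N.crossings k ht]; grind))).of_eq (by grind [G₁₂])

lemma hasTotal_G₂₁ (hA : 0 < N.A) :
    HasTotal (slab (N.lineA k) (N.lineN k) fun t =>
      ¬ N.lineA k t < N.lineB k t ∧ N.lineA k t < N.lineN k t) (N.G₂₁ k) := by
  have hb := N.crossing_bounds k
  have hb' := N.crossing_bounds_of_A_pos k hA
  have hS := N.split_iff_D
  by_cases hD : N.D < 0
  · by_cases h1 : N.F₁ < 0
    · exact (slab_Ioo (N.isTail_lineA k hA) (N.isTail_lineN k) (p := 0) (q := N.g1 k)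
        (by grind) (fun t ht => by simp only [N.crossings_lineA k hA ht]; grind)).of_eq
        (by grind [G₂₁])
    · exact (slab_Ioi (N.isTail_lineA k hA) (N.isTail_lineN k) (p := 0)
        (by grind) (fun t ht => by simp only [N.crossings_lineA k hA ht]; grind)).of_eq
        (by grind [G₂₁])
  · exact (slab_empty fun t ht => by simp only [N.crossings_lineA k hA ht]; grind).of_eq
      (by grind [G₂₁])

lemma hasTotal_G₂₂ (hA : 0 < N.A) :
    HasTotal (slab (N.lineB k) (N.lineN k) fun t =>
      N.lineA k t < N.lineB k t ∧ N.lineB k t < N.lineN k t) (N.G₂₂ k) := by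
  have hb := N.crossing_bounds k
  have hb' := N.crossing_bounds_of_A_pos k hA
  by_cases h1 : N.F₁ < 0
  · by_cases h3 : 0 < N.F₃
    · exact (slab_Ioo (N.isTail_lineB k) (N.isTail_lineN k) (p := N.g1 k) (q := N.g4 k)
        (by grind) (fun t ht => by
          simp only [N.crossings k ht, N.crossings_lineA k hA ht]; grind)).of_eq (by grind [G₂₂])
    · exact (slab_Ioi (N.isTail_lineB k) (N.isTail_lineN k) (p := N.g1 k)
        (by grind) (fun t ht => by
          simp only [N.crossings k ht, N.crossings_lineA k hA ht]; grind)).of_eq (by grind [G₂₂])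
  · exact (slab_empty fun t ht => by simp only [N.crossings_lineA k hA ht]; grind).of_eq
      (by grind [G₂₂])

lemma hasTotal_G₃₁ (hD : N.D < 0) :
    HasTotal (fun t =>
      slab (fun _ => 0) (N.lineA k) (fun t => ¬ 0 < N.lineB k t) t +
      slab (N.lineB k) (N.lineA k) (fun t => 0 < N.lineB k t ∧ N.lineB k t < N.lineA k t) t)
      (N.G₃₁ k) := by
  have hA := N.A_pos_of_D_neg hD
  have hS := N.split_of_D_neg hD
  have hb := N.crossing_bounds k
  have hb' := N.crossing_bounds_of_A_pos k hA
  have h0 := N.hasTotal_below_τ k (N.isTail_lineA k hA) fun t ht => (N.lineB_pos_iff k t).not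
  by_cases h1 : N.F₁ < 0
  · exact (h0.add (slab_Ioo (N.isTail_lineB k) (N.isTail_lineA k hA) (p := N.τ k) (q := N.g1 k)
      (by grind) (fun t ht => by
        simp only [N.crossings k ht, N.crossings_lineA k hA ht]; grind))).of_eq (by grind [G₃₁])
  · exact (h0.add (slab_Ioi (N.isTail_lineB k) (N.isTail_lineA k hA) (p := N.τ k)
      (by grind) (fun t ht => by
        simp only [N.crossings k ht, N.crossings_lineA k hA ht]; grind))).of_eq (by grind [G₃₁])

lemma hasTotal_G₃₂ (hD : 0 ≤ N.D) :
    HasTotal (fun t =>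
      slab (fun _ => 0) (N.lineN k) (fun t => ¬ 0 < N.lineB k t) t +
      slab (N.lineB k) (N.lineN k) (fun t => 0 < N.lineB k t ∧ N.lineB k t < N.lineN k t) t)
      (N.G₃₂ k) := by
  have hS := N.nonSplit_of_D_nonneg hD
  have hb := N.crossing_bounds k
  have h0 := N.hasTotal_below_τ k (N.isTail_lineN k) fun t ht => (N.lineB_pos_iff k t).not
  by_cases h3 : 0 < N.F₃
  · exact (h0.add (slab_Ioo (N.isTail_lineB k) (N.isTail_lineN k) (p := N.τ k) (q := N.g4 k)
      (by grind) (fun t ht => by simp only [N.crossings k ht]; grind))).of_eq (by grind [G₃₂])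
  · exact (h0.add (slab_Ioi (N.isTail_lineB k) (N.isTail_lineN k) (p := N.τ k)
      (by grind) (fun t ht => by simp only [N.crossings k ht]; grind))).of_eq (by grind [G₃₂])

/-- The statement concerns `G₇` as a whole, because `G₇₁` and `G₇₂` need not be slab integrals one
by one: when f₇ < τ both contain Φ₂ at f₇, below the zero of `lineB`, and these values cancel only
in the sum. -/
lemma hasTotal_G₇_of_D_neg (hD : N.D < 0) :
    HasTotal (fun t =>
      (slab (fun _ => 0) (N.lineA k)
        (fun t => ¬ 0 < N.lineB k t ∧ N.lineA k t < N.lineC k t) t +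
      slab (fun _ => 0) (N.lineC k)
        (fun t => ¬ 0 < N.lineB k t ∧ ¬ N.lineA k t < N.lineC k t) t) +
      (slab (N.lineB k) (N.lineA k)
        (fun t => 0 < N.lineB k t ∧ N.lineA k t < N.lineC k t ∧ N.lineB k t < N.lineA k t) t +
      slab (N.lineB k) (N.lineC k)
        (fun t => 0 < N.lineB k t ∧ ¬ N.lineA k t < N.lineC k t ∧ N.lineB k t < N.lineC k t) t))
      (N.G₇ k) := by
  have hA := N.A_pos_of_D_neg hD
  have hS := N.split_of_D_neg hD
  have hb := N.crossing_bounds k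
  have hb' := N.crossing_bounds_of_A_pos k hA
  have h17 := N.g3_le_of_g1_lt_g7 k hA hD
  have h37 := N.g1_lt_of_g3_lt_g7 k hA
  have he : Real.exp (-0) = 1 := by simp
  have tA := N.isTail_lineA k hA
  have tB := N.isTail_lineB k
  have tC := N.isTail_lineC k
  -- Three arrangements: `lineA` meets `lineB` before `lineC`, so that `lineC` never bounds the
  -- cell; or `lineA` meets `lineC` first, after τ; or it does so no later than τ.
  by_cases h1 : N.F₁ < 0 ∧ N.g1 k < N.g7 k
  · exact (((slab_Ioc isTail_zero tA (p := 0) (q := N.τ k) le_rfl (by grind) (fun t ht => by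
        simp only [N.crossings k ht, N.crossings_lineA k hA ht]; grind)).add
      (slab_empty fun t ht => by
        simp only [N.crossings k ht, N.crossings_lineA k hA ht]; grind)).add
      ((slab_Ioc tB tA (p := N.τ k) (q := N.g1 k) (by grind) (by grind) (fun t ht => by
        simp only [N.crossings k ht, N.crossings_lineA k hA ht]; grind)).add
      (slab_empty fun t ht => by
        simp only [N.crossings k ht, N.crossings_lineA k hA ht]; grind))).of_eq
      (by grind [G₇, G₇₁, G₇₂, G₇₃, G₇₄])
  have h73 : N.g7 k ≤ N.g3 k := by grind
  by_cases h7 : N.τ k < N.g7 k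
  · exact (((slab_Ioc isTail_zero tA (p := 0) (q := N.τ k) le_rfl (by grind) (fun t ht => by
        simp only [N.crossings k ht, N.crossings_lineA k hA ht]; grind)).add
      (slab_empty fun t ht => by
        simp only [N.crossings k ht, N.crossings_lineA k hA ht]; grind)).add
      ((slab_Ioc tB tA (p := N.τ k) (q := N.g7 k) (by grind) (by grind) (fun t ht => by
        simp only [N.crossings k ht, N.crossings_lineA k hA ht]; grind)).add
      (slab_Ioc tB tC (p := N.g7 k) (q := N.g3 k) (by grind) h73 (fun t ht => by
        simp only [N.crossings k ht, N.crossings_lineA k hA ht]; grind)))).of_eq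
      (by grind [G₇, G₇₁, G₇₂, G₇₃, G₇₄])
  · exact (((slab_Ioc isTail_zero tA (p := 0) (q := N.g7 k) le_rfl (by grind) (fun t ht => by
        simp only [N.crossings k ht, N.crossings_lineA k hA ht]; grind)).add
      (slab_Ioc isTail_zero tC (p := N.g7 k) (q := N.τ k) (by grind) (by grind) fun t ht => by
        simp only [N.crossings k ht, N.crossings_lineA k hA ht]; grind)).add
      ((slab_empty fun t ht => by
        simp only [N.crossings k ht, N.crossings_lineA k hA ht]; grind).add
      (slab_Ioc tB tC (p := N.τ k) (q := N.g3 k) (by grind) (by grind) (fun t ht => by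
        simp only [N.crossings k ht, N.crossings_lineA k hA ht]; grind)))).of_eq
      (by grind [G₇, G₇₁, G₇₂, G₇₃, G₇₄])

/-- The degenerate case θ₁₂ = 0, where x_{2a} is always decoded. The row of `G₇₄` then does not
apply, and its expression would vanish anyway because κ = 1. -/
lemma κ_eq_one_of_g3_le_τ (h : N.g3 k ≤ N.τ k) : N.κ k = 1 := by
  have := N.v_pos k
  have h1 : N.τ k = N.θ₂ / N.v k := rfl
  have h3 : N.g3 k = N.θ₂ * (N.θ₁₂ + 1) / N.v k := rfl
  rw [h1, h3, div_le_div_iff_of_pos_right this] at h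
  have h12 : N.θ₁₂ = 0 := by nlinarith [N.θ₂_pos, N.θ₁₂_nonneg]
  simp [κ, h12]

lemma hasTotal_G₇_of_D_nonneg (hD : 0 ≤ N.D) :
    HasTotal (fun t =>
      slab (fun _ => 0) (N.lineC k) (fun t => ¬ 0 < N.lineB k t) t +
      slab (N.lineB k) (N.lineC k) (fun t => 0 < N.lineB k t ∧ N.lineB k t < N.lineC k t) t)
      (N.G₇ k) := by
  have hS := N.nonSplit_of_D_nonneg hD
  have hb := N.crossing_bounds k
  have hκ := N.κ_eq_one_of_g3_le_τ k
  have he : Real.exp (-0) = 1 := by simp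
  have h0 := N.hasTotal_below_τ k (N.isTail_lineC k) fun t ht => (N.lineB_pos_iff k t).not
  exact (h0.add (slab_Ioc (N.isTail_lineB k) (N.isTail_lineC k) (p := N.τ k) (q := N.g3 k)
    (by grind) (by grind) (fun t ht => by simp only [N.crossings k ht]; grind))).of_eq
    (by grind [G₇, G₇₁, G₇₂, G₇₃, G₇₄])

lemma g7_neg_of_A_nonpos (hA : N.A ≤ 0) : N.g7 k < 0 := by
  have hv := N.v_pos k; have hρ := N.ρ_pos; have h11 := N.θ₁₁_pos
  have h : N.g7 k = (N.θ₁₂ * N.A - N.θ₁₁ * N.ρ) / (N.v k * N.θ₁₁ * N.ρ) := rfl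
  rw [h]
  refine div_neg_of_neg_of_pos ?_ (by positivity)
  have h1 := mul_nonpos_of_nonneg_of_nonpos N.θ₁₂_nonneg hA
  have h2 : 0 < N.θ₁₁ * N.ρ := by positivity
  linarith

/-- When A ≤ 0, x_{1a} is never decoded and cells 2, 4, 5 are empty. That their closed forms vanish
too follows from F₁ ≥ 0, F₂ ≥ 0, D ≥ 0 and f₇ < 0. -/
lemma vanishing_of_A_nonpos (hA : N.A ≤ 0) : N.G₂ k = 0 ∧ N.G₄ k = 0 ∧ N.G₅ k = 0 := by
  have hs : ¬ N.Split := fun h => (N.split_iff.1 h).1.not_ge hA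
  have hr : ¬ N.α / (1 - N.α) > N.θ₁₁ := fun h => (N.θ₁₁_lt_iff.1 h).not_ge hA
  have h12 : 0 < N.θ₁₁ * N.θ₂ := mul_pos N.θ₁₁_pos N.θ₂_pos
  have h1 : ¬ N.F₁ < 0 := by
    have : N.F₁ = N.θ₁₁ * N.θ₂ * N.ρ - N.A := by simp only [F₁, A, ρ]; ring
    have := mul_pos h12 N.ρ_pos
    linarith
  have h2 : ¬ N.F₂ < 0 := by
    have : N.F₂ = N.θ₁₁ * N.θ₂ - N.A := by simp only [F₂, A]; ring
    linarith
  have h7 := N.g7_neg_of_A_nonpos k hA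
  have hD : 0 ≤ N.D := by rw [← nonSplit_iff_D, nonSplit_iff]; exact hs
  have hb := N.crossing_bounds k
  refine ⟨?_, ?_, ?_⟩
  · grind [G₂, G₂₁, G₂₂]
  · simp only [G₄, G₄₁, G₄₂, G₄₃, G₄₄, G₄₅, G₄₆, G₄₇, G₄₈, h1, h2, false_and, and_false, if_false]
    grind
  · grind [G₅, G₅₁, G₅₂, G₅₃, G₅₄]

/-! ### Decoding regions at one RRH

Points of the plane are pairs (gain of user `a`, gain of user `b`). -/

/-- `x_{1a}` is decoded under RSMA. -/
def regA : Set (ℝ × ℝ) := {p | 0 < N.A ∧ N.lineA k p.2 ≤ p.1}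

/-- `x_b` is decoded under RSMA. -/
def regB : Set (ℝ × ℝ) := {p | p.1 ≤ N.lineB k p.2}

/-- `x_{2a}` is decoded under RSMA. -/
def regC : Set (ℝ × ℝ) := {p | N.lineC k p.2 ≤ p.1}

/-- User `b` is decoded first under NOMA. -/
def regM : Set (ℝ × ℝ) := {p | p.1 ≤ N.lineM k p.2}

/-- User `a` is decoded first under NOMA. -/
def regN : Set (ℝ × ℝ) := {p | N.lineN k p.2 ≤ p.1}

/-- User `a` is decoded under NOMA after removal of user `b`. -/
def regO : Set (ℝ × ℝ) := {p | N.θ₁ / N.u k ≤ p.1}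

/-- Pairs of gains for which no first stage of NOMA succeeds. -/
def base : Set (ℝ × ℝ) := {p | (0 ≤ p.1 ∧ 0 ≤ p.2) ∧ p ∉ N.regN k ∧ p ∉ N.regM k}

/-- Cells 1 to 7 sort the points of `base` by the RSMA stages that succeed. They overlap (cell 1
contains cells 3, 6, 7, and cell 2 contains cell 5), so only the rectangles built from them are
disjoint. -/
def cell1 : Set (ℝ × ℝ) := {p | p ∈ N.base k ∧ p ∉ N.regA k}

def cell2 : Set (ℝ × ℝ) := {p | p ∈ N.base k ∧ p ∈ N.regA k ∧ p ∉ N.regB k}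

def cell3 : Set (ℝ × ℝ) := {p | p ∈ N.base k ∧ p ∉ N.regA k ∧ p ∉ N.regB k}

def cell4 : Set (ℝ × ℝ) :=
  {p | p ∈ N.base k ∧ p ∈ N.regA k ∧ p ∈ N.regB k ∧ p ∉ N.regC k}

def cell5 : Set (ℝ × ℝ) :=
  {p | p ∈ N.base k ∧ p ∈ N.regA k ∧ p ∉ N.regB k ∧ p ∉ N.regC k}

def cell6 : Set (ℝ × ℝ) :=
  {p | p ∈ N.base k ∧ p ∉ N.regA k ∧ p ∈ N.regB k ∧ p ∉ N.regC k}

def cell7 : Set (ℝ × ℝ) :=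
  {p | p ∈ N.base k ∧ p ∉ N.regA k ∧ p ∉ N.regB k ∧ p ∉ N.regC k}

def cell8 : Set (ℝ × ℝ) := {p | (0 ≤ p.1 ∧ 0 ≤ p.2) ∧ p ∉ N.regO k ∧ p ∈ N.regM k}

def cell9 : Set (ℝ × ℝ) := {p | (0 ≤ p.1 ∧ 0 ≤ p.2) ∧ p ∉ N.regO k ∧ p ∉ N.regM k}

section Measurability

@[fun_prop] lemma measurable_lineA : Measurable (N.lineA k) := by unfold lineA; fun_prop

@[fun_prop] lemma measurable_lineB : Measurable (N.lineB k) := by unfold lineB; fun_prop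

@[fun_prop] lemma measurable_lineC : Measurable (N.lineC k) := by unfold lineC; fun_prop

@[fun_prop] lemma measurable_lineM : Measurable (N.lineM k) := by unfold lineM; fun_prop

@[fun_prop] lemma measurable_lineN : Measurable (N.lineN k) := by unfold lineN; fun_prop

lemma measurableSet_quadrant : MeasurableSet {p : ℝ × ℝ | 0 ≤ p.1 ∧ 0 ≤ p.2} :=
  (measurableSet_le measurable_const measurable_fst).inter
    (measurableSet_le measurable_const measurable_snd)

lemma measurableSet_regA : MeasurableSet (N.regA k) :=
  (MeasurableSet.const (0 < N.A)).inter
    (measurableSet_le (f := fun p : ℝ × ℝ => N.lineA k p.2) (g := Prod.fst) (by fun_prop)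
      (by fun_prop))

lemma measurableSet_regB : MeasurableSet (N.regB k) :=
  measurableSet_le (by fun_prop) (by fun_prop)

lemma measurableSet_regC : MeasurableSet (N.regC k) :=
  measurableSet_le (by fun_prop) (by fun_prop)

lemma measurableSet_regM : MeasurableSet (N.regM k) :=
  measurableSet_le (by fun_prop) (by fun_prop)

lemma measurableSet_regN : MeasurableSet (N.regN k) :=
  measurableSet_le (by fun_prop) (by fun_prop)

lemma measurableSet_regO : MeasurableSet (N.regO k) :=
  measurableSet_le (by fun_prop) (by fun_prop)

lemma measurableSet_base : MeasurableSet (N.base k) :=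
  measurableSet_quadrant.inter
    ((N.measurableSet_regN k).compl.inter (N.measurableSet_regM k).compl)

lemma measurableSet_cell1 : MeasurableSet (N.cell1 k) :=
  (N.measurableSet_base k).inter (N.measurableSet_regA k).compl

lemma measurableSet_cell2 : MeasurableSet (N.cell2 k) :=
  (N.measurableSet_base k).inter
    ((N.measurableSet_regA k).inter (N.measurableSet_regB k).compl)

lemma measurableSet_cell3 : MeasurableSet (N.cell3 k) :=
  (N.measurableSet_base k).inter
    ((N.measurableSet_regA k).compl.inter (N.measurableSet_regB k).compl)

lemma measurableSet_cell4 : MeasurableSet (N.cell4 k) :=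
  (N.measurableSet_base k).inter ((N.measurableSet_regA k).inter
    ((N.measurableSet_regB k).inter (N.measurableSet_regC k).compl))

lemma measurableSet_cell5 : MeasurableSet (N.cell5 k) :=
  (N.measurableSet_base k).inter ((N.measurableSet_regA k).inter
    ((N.measurableSet_regB k).compl.inter (N.measurableSet_regC k).compl))

lemma measurableSet_cell6 : MeasurableSet (N.cell6 k) :=
  (N.measurableSet_base k).inter ((N.measurableSet_regA k).compl.inter
    ((N.measurableSet_regB k).inter (N.measurableSet_regC k).compl))

lemma measurableSet_cell7 : MeasurableSet (N.cell7 k) :=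
  (N.measurableSet_base k).inter ((N.measurableSet_regA k).compl.inter
    ((N.measurableSet_regB k).compl.inter (N.measurableSet_regC k).compl))

lemma measurableSet_cell8 : MeasurableSet (N.cell8 k) :=
  measurableSet_quadrant.inter ((N.measurableSet_regO k).compl.inter (N.measurableSet_regM k))

lemma measurableSet_cell9 : MeasurableSet (N.cell9 k) :=
  measurableSet_quadrant.inter
    ((N.measurableSet_regO k).compl.inter (N.measurableSet_regM k).compl)

end Measurability

/-! ### Probabilities of the cells -/

/-- Orderings of the lines that do not depend on the parameters. -/
lemma lines_order {t : ℝ} (ht : 0 < t) :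
    (0 < N.lineM k t ↔ 0 < N.lineB k t) ∧ (N.lineM k t < N.lineB k t ↔ 0 < N.lineB k t) ∧
    0 < N.lineN k t ∧ 0 ≤ N.lineC k t := by
  refine ⟨?_, ?_, N.lineN_pos k ht, N.lineC_nonneg k t⟩
  · rw [lineM_pos_iff, lineB_pos_iff]
  · rw [lineM_lt_lineB_iff, lineB_pos_iff]

/-- If `x_{1a}` is harder to decode than `x_a`, it is decoded only where `x_a` is. -/
lemma regA_imp_regN (hD : 0 ≤ N.D) {x t : ℝ} (ht : 0 < t) (h : (x, t) ∈ N.regA k) :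
    N.lineN k t ≤ x := by
  have h1 := (N.lineA_lt_lineN_iff k h.1 ht).not.2 hD.not_gt
  exact (not_lt.1 h1).trans h.2

lemma pairLaw_cell1 : pairLaw.real (N.cell1 k) = N.G₁ k := by
  have hm := N.measurableSet_cell1 k
  rcases lt_or_ge N.D 0 with hD | hD
  · have hA := N.A_pos_of_D_neg hD
    have hS := N.split_of_D_neg hD
    have h12 : N.G₁₂ k = 0 := by grind [G₁₂]
    have hv : HasTotal _ (N.G₁ k) := (N.hasTotal_G₁₁ k hD).of_eq (by rw [G₁, h12, add_zero])
    -- For D < 0, missing `regA` already implies missing `regN`. In the other case the implication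
    -- is reversed and `lineN` is the upper boundary.
    refine pairLaw_real_eq hm (L := fun t => max 0 (N.lineM k t)) (U := N.lineA k)
      (fun t ht => le_max_left _ _) ?_ ?_ hv ?_
    · intro t ht x h1 h2
      have h3 := N.lineA_lt_lineN_iff k hA ht
      simp only [cell1, base, regN, regM, regA, mem_ofPred_eq]
      grind
    · intro t ht x h
      simp only [cell1, base, regN, regM, regA, mem_ofPred_eq] at h
      grind
    · intro t ht
      have h1 := N.lineA_pos k hA ht
      simp only [slab]
      grind (splits := 30)
  · have hS := N.nonSplit_of_D_nonneg hD
    have h11 : N.G₁₁ k = 0 := by grind [G₁₁]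
    have hv : HasTotal _ (N.G₁ k) := (N.hasTotal_G₁₂ k hD).of_eq (by rw [G₁, h11, zero_add])
    refine pairLaw_real_eq hm (L := fun t => max 0 (N.lineM k t)) (U := N.lineN k)
      (fun t ht => le_max_left _ _) ?_ ?_ hv ?_
    · intro t ht x h1 h2
      have h3 := mt (N.regA_imp_regN k hD ht) (not_le.2 h2)
      simp only [cell1, base, regN, regM, mem_ofPred_eq]
      grind
    · intro t ht x h
      simp only [cell1, base, regN, regM, mem_ofPred_eq] at h
      grind
    · intro t ht
      have h1 := N.lines_order k ht
      simp only [slab]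
      grind (splits := 30)

lemma pairLaw_eq_zero_of_A_nonpos (hA : N.A ≤ 0) {s : Set (ℝ × ℝ)} (hs : MeasurableSet s)
    (h : s ⊆ N.regA k) : pairLaw.real s = 0 :=
  pairLaw_real_eq_zero hs fun _ _ _ hx => (h hx).1.not_ge hA

lemma pairLaw_cell2 : pairLaw.real (N.cell2 k) = N.G₂ k := by
  have hm := N.measurableSet_cell2 k
  rcases lt_or_ge 0 N.A with hA | hA
  · have hv := (N.hasTotal_G₂₁ k hA).add (N.hasTotal_G₂₂ k hA)
    -- `lineM` is not needed in the lower boundary: wherever it is positive it lies below `lineB`,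
    -- and elsewhere it lies below the positive `lineA`.
    refine pairLaw_real_eq hm (L := fun t => max (N.lineA k t) (N.lineB k t)) (U := N.lineN k)
      (fun t ht => (N.lineA_pos k hA ht).le.trans (le_max_left _ _)) ?_ ?_ hv ?_
    · intro t ht x h1 h2
      have h3 := N.lineA_pos k hA ht
      have h4 := N.lines_order k ht
      simp only [cell2, base, regN, regM, regA, regB, mem_ofPred_eq]
      grind
    · intro t ht x h
      simp only [cell2, base, regN, regM, regA, regB, mem_ofPred_eq] at h
      grind
    · intro t ht
      simp only [slab]
      grind (splits := 30)
  · rw [(N.vanishing_of_A_nonpos k hA).1]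
    exact N.pairLaw_eq_zero_of_A_nonpos k hA hm fun p hp => hp.2.1

lemma pairLaw_cell3 : pairLaw.real (N.cell3 k) = N.G₃ k := by
  have hm := N.measurableSet_cell3 k
  rcases lt_or_ge N.D 0 with hD | hD
  · have hA := N.A_pos_of_D_neg hD
    have hS := N.split_of_D_neg hD
    have h32 : N.G₃₂ k = 0 := by grind [G₃₂]
    have hv : HasTotal _ (N.G₃ k) := (N.hasTotal_G₃₁ k hD).of_eq (by rw [G₃, h32, add_zero])
    refine pairLaw_real_eq hm (L := fun t => max 0 (N.lineB k t)) (U := N.lineA k)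
      (fun t ht => le_max_left _ _) ?_ ?_ hv ?_
    · intro t ht x h1 h2
      have h3 := N.lineA_lt_lineN_iff k hA ht
      have h4 := N.lines_order k ht
      simp only [cell3, base, regN, regM, regA, regB, mem_ofPred_eq]
      grind
    · intro t ht x h
      simp only [cell3, base, regN, regM, regA, regB, mem_ofPred_eq] at h
      grind
    · intro t ht
      simp only [slab]
      have h3 := N.lineA_pos k hA ht
      grind
  · have hS := N.nonSplit_of_D_nonneg hD
    have h31 : N.G₃₁ k = 0 := by grind [G₃₁]
    have hv : HasTotal _ (N.G₃ k) := (N.hasTotal_G₃₂ k hD).of_eq (by rw [G₃, h31, zero_add])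
    refine pairLaw_real_eq hm (L := fun t => max 0 (N.lineB k t)) (U := N.lineN k)
      (fun t ht => le_max_left _ _) ?_ ?_ hv ?_
    · intro t ht x h1 h2
      have h3 := mt (N.regA_imp_regN k hD ht) (not_le.2 h2)
      have h4 := N.lines_order k ht
      simp only [cell3, base, regN, regM, regB, mem_ofPred_eq]
      grind
    · intro t ht x h
      simp only [cell3, base, regN, regM, regB, mem_ofPred_eq] at h
      grind
    · intro t ht
      have h1 := N.lines_order k ht
      simp only [slab]
      grind (splits := 30)

lemma pairLaw_cell4 : pairLaw.real (N.cell4 k) = N.G₄ k := by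
  have hm := N.measurableSet_cell4 k
  rcases lt_or_ge 0 N.A with hA | hA
  · have hv := (((((((N.hasTotal_G₄₁ k hA).add (N.hasTotal_G₄₂ k hA)).add
      (N.hasTotal_G₄₃ k hA)).add (N.hasTotal_G₄₄ k hA)).add (N.hasTotal_G₄₅ k hA)).add
      (N.hasTotal_G₄₆ k hA)).add (N.hasTotal_G₄₇ k hA)).add (N.hasTotal_G₄₈ k hA)
    refine pairLaw_real_eq hm (L := fun t => max (N.lineA k t) (N.lineM k t))
      (U := fun t => min (N.lineN k t) (min (N.lineB k t) (N.lineC k t)))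
      (fun t ht => (N.lineA_pos k hA ht).le.trans (le_max_left _ _)) ?_ ?_ hv ?_
    · intro t ht x h1 h2
      have h3 := N.lineA_pos k hA ht
      simp only [cell4, base, regN, regM, regA, regB, regC, mem_ofPred_eq]
      grind
    · intro t ht x h
      simp only [cell4, base, regN, regM, regA, regB, regC, mem_ofPred_eq] at h
      grind
    · intro t ht
      simp only [slab]
      grind (splits := 30)
  · rw [(N.vanishing_of_A_nonpos k hA).2.1]
    exact N.pairLaw_eq_zero_of_A_nonpos k hA hm fun p hp => hp.2.1

lemma pairLaw_cell5 : pairLaw.real (N.cell5 k) = N.G₅ k := by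
  have hm := N.measurableSet_cell5 k
  rcases lt_or_ge 0 N.A with hA | hA
  · have hv := (((N.hasTotal_G₅₁ k hA).add (N.hasTotal_G₅₂ k hA)).add
      (N.hasTotal_G₅₃ k hA)).add (N.hasTotal_G₅₄ k hA)
    refine pairLaw_real_eq hm (L := fun t => max (N.lineA k t) (N.lineB k t))
      (U := fun t => min (N.lineN k t) (N.lineC k t))
      (fun t ht => (N.lineA_pos k hA ht).le.trans (le_max_left _ _)) ?_ ?_ hv ?_
    · intro t ht x h1 h2
      have h3 := N.lineA_pos k hA ht
      have h4 := N.lines_order k ht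
      simp only [cell5, base, regN, regM, regA, regB, regC, mem_ofPred_eq]
      grind
    · intro t ht x h
      simp only [cell5, base, regN, regM, regA, regB, regC, mem_ofPred_eq] at h
      grind
    · intro t ht
      simp only [slab]
      grind (splits := 30)
  · rw [(N.vanishing_of_A_nonpos k hA).2.2]
    exact N.pairLaw_eq_zero_of_A_nonpos k hA hm fun p hp => hp.2.1

lemma pairLaw_cell6 : pairLaw.real (N.cell6 k) = N.G₆ k := by
  have hm := N.measurableSet_cell6 k
  rcases lt_or_ge N.D 0 with hD | hD
  · have hA := N.A_pos_of_D_neg hD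
    have hS := N.split_of_D_neg hD
    have hv : HasTotal _ (N.G₆ k) := ((((N.hasTotal_G₆₁ k hD).add (N.hasTotal_G₆₂ k hD)).add
      (N.hasTotal_G₆₃ k hD)).add (N.hasTotal_G₆₄ k hD)).of_eq
      (by simp [G₆, G₆₅, G₆₆, G₆₇, G₆₈, hS.2])
    -- A nonempty section needs `lineB` positive, hence `lineM` positive; this is why no slab of
    -- `G₆` starts at 0.
    refine pairLaw_real_eq hm (L := fun t => max 0 (N.lineM k t))
      (U := fun t => min (N.lineA k t) (min (N.lineB k t) (N.lineC k t)))
      (fun t ht => le_max_left _ _) ?_ ?_ hv ?_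
    · intro t ht x h1 h2
      have h3 := N.lineA_lt_lineN_iff k hA ht
      simp only [cell6, base, regN, regM, regA, regB, regC, mem_ofPred_eq]
      grind
    · intro t ht x h
      simp only [cell6, base, regN, regM, regA, regB, regC, mem_ofPred_eq] at h
      grind
    · intro t ht
      have h3 := N.lineA_pos k hA ht
      have h4 := N.lines_order k ht
      simp only [slab]
      grind (splits := 30)
  · have hS := N.nonSplit_of_D_nonneg hD
    have hv : HasTotal _ (N.G₆ k) := ((((N.hasTotal_G₆₅ k hD).add (N.hasTotal_G₆₆ k hD)).add
      (N.hasTotal_G₆₇ k hD)).add (N.hasTotal_G₆₈ k hD)).of_eq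
      (by simp [G₆, G₆₁, G₆₂, G₆₃, G₆₄, hS.2])
    refine pairLaw_real_eq hm (L := fun t => max 0 (N.lineM k t))
      (U := fun t => min (N.lineN k t) (min (N.lineB k t) (N.lineC k t)))
      (fun t ht => le_max_left _ _) ?_ ?_ hv ?_
    · intro t ht x h1 h2
      have h3 := mt (N.regA_imp_regN k hD ht) (not_le.2 (h2.trans_le (min_le_left _ _)))
      simp only [cell6, base, regN, regM, regB, regC, mem_ofPred_eq]
      grind
    · intro t ht x h
      simp only [cell6, base, regN, regM, regB, regC, mem_ofPred_eq] at h
      grind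
    · intro t ht
      have h4 := N.lines_order k ht
      simp only [slab]
      grind (splits := 30)

lemma pairLaw_cell7 : pairLaw.real (N.cell7 k) = N.G₇ k := by
  have hm := N.measurableSet_cell7 k
  rcases lt_or_ge N.D 0 with hD | hD
  · have hA := N.A_pos_of_D_neg hD
    refine pairLaw_real_eq hm (L := fun t => max 0 (N.lineB k t))
      (U := fun t => min (N.lineA k t) (N.lineC k t))
      (fun t ht => le_max_left _ _) ?_ ?_ (N.hasTotal_G₇_of_D_neg k hD) ?_
    · intro t ht x h1 h2
      have h3 := N.lineA_lt_lineN_iff k hA ht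
      have h4 := N.lines_order k ht
      simp only [cell7, base, regN, regM, regA, regB, regC, mem_ofPred_eq]
      grind
    · intro t ht x h
      simp only [cell7, base, regN, regM, regA, regB, regC, mem_ofPred_eq] at h
      grind
    · intro t ht
      have h3 := N.lineA_pos k hA ht
      have h4 := N.lines_order k ht
      simp only [slab]
      grind (splits := 30)
  -- D ≥ 0 means f₅ ≤ 0, so missing `regC` implies missing `regN` and then `regA`; `lineC` is the
  -- only upper boundary left.
  · have hlt : ∀ t, 0 < t → N.lineC k t ≤ N.lineN k t := by
      intro t ht
      rw [← not_lt, N.lineN_lt_lineC_iff k]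
      have := (N.g5_pos_iff k).not.2 hD.not_gt
      linarith
    refine pairLaw_real_eq hm (L := fun t => max 0 (N.lineB k t)) (U := N.lineC k)
      (fun t ht => le_max_left _ _) ?_ ?_ (N.hasTotal_G₇_of_D_nonneg k hD) ?_
    · intro t ht x h1 h2
      have h3 := mt (N.regA_imp_regN k hD ht) (not_le.2 (h2.trans_le (hlt t ht)))
      have h4 := N.lines_order k ht
      have h5 := hlt t ht
      simp only [cell7, base, regN, regM, regB, regC, mem_ofPred_eq]
      grind
    · intro t ht x h
      simp only [cell7, base, regN, regM, regB, regC, mem_ofPred_eq] at h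
      grind
    · intro t ht
      have h4 := N.lines_order k ht
      simp only [slab]
      grind (splits := 30)

/-! ### Cells 8 and 9: user b is decoded first at some RRH -/

/-- The gain of user `b` beyond which decoding `b` first is easier than decoding `a` alone. -/
def crossMO : ℝ := N.θ₂ * (1 + N.θ₁) / N.v k

lemma τ_le_crossMO : N.τ k ≤ N.crossMO k := by
  have := N.v_pos k; have := N.θ₁_pos; have := N.θ₂_pos
  have h : N.τ k = N.θ₂ / N.v k := rfl
  rw [h, crossMO]
  gcongr
  nlinarith

lemma lineM_lt_iff_lt_crossMO (t : ℝ) : N.lineM k t < N.θ₁ / N.u k ↔ t < N.crossMO k := by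
  have := N.u_pos k; have := N.v_pos k; have := N.θ₂_pos
  refine lt_iff_of_sub_eq (c := N.v k / (N.u k * N.θ₂)) (by positivity) ?_
  rw [lineM, crossMO]
  field_simp
  ring

/-- At τ and at `crossMO` the exponent of Φ₃ simplifies, since `lineM` equals 0 and θ₁/u there.
Hence `G₈` and `G₉` can be written without Φ₃. -/
lemma ph3_τ : N.ph3 k (N.τ k) =
    N.u k * N.θ₂ * Real.exp (-N.τ k) / (N.u k * N.θ₂ + N.v k) := by
  have hv := N.v_pos k
  have h : N.v k * N.τ k - N.θ₂ = 0 := by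
    have h : N.τ k = N.θ₂ / N.v k := rfl
    rw [h]; field_simp; ring
  have h1 : N.ph3 k (N.τ k) =
      N.u k * N.θ₂ * Real.exp (-((N.v k * N.τ k - N.θ₂) / (N.u k * N.θ₂)) - N.τ k)
      / (N.u k * N.θ₂ + N.v k) := by
    simp only [ph3, Φ₃, u, v]
    ring_nf
  rw [h1, h, zero_div, neg_zero, zero_sub]

lemma ph3_crossMO : N.ph3 k (N.crossMO k) =
    N.u k * N.θ₂ * (Real.exp (-(N.θ₁ / N.u k)) * Real.exp (-N.crossMO k))
      / (N.u k * N.θ₂ + N.v k) := by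
  have hv := N.v_pos k; have hu := N.u_pos k; have h2 := N.θ₂_pos
  have h : (N.v k * N.crossMO k - N.θ₂) / (N.u k * N.θ₂) = N.θ₁ / N.u k := by
    rw [crossMO]; field_simp; ring
  have h1 : N.ph3 k (N.crossMO k) =
      N.u k * N.θ₂ * Real.exp (-((N.v k * N.crossMO k - N.θ₂) / (N.u k * N.θ₂)) - N.crossMO k)
      / (N.u k * N.θ₂ + N.v k) := by
    simp only [ph3, Φ₃, u, v]
    ring_nf
  rw [h1, h, sub_eq_add_neg, Real.exp_add]

lemma G₈_eq : N.G₈ k = N.v k * Real.exp (-N.τ k) / (N.u k * N.θ₂ + N.v k)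
    - N.v k * (Real.exp (-(N.θ₁ / N.u k)) * Real.exp (-N.crossMO k))
      / (N.u k * N.θ₂ + N.v k) := by
  have h1 : N.τ k = N.θ₂ / N.v k := rfl
  rw [h1, crossMO, ← Real.exp_add]
  simp only [G₈, u, v]
  ring_nf

lemma G₉_eq : N.G₉ k = 1 - Real.exp (-(N.θ₁ / N.u k)) * (1 - Real.exp (-N.crossMO k))
    - Real.exp (-N.τ k)
    - (N.u k * N.θ₂ * (Real.exp (-(N.θ₁ / N.u k)) * Real.exp (-N.crossMO k))
        / (N.u k * N.θ₂ + N.v k)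
      - N.u k * N.θ₂ * Real.exp (-N.τ k) / (N.u k * N.θ₂ + N.v k)) := by
  have h1 : N.τ k = N.θ₂ / N.v k := rfl
  have h2 : N.θ₁ / N.u k = N.θ₁ * N.θ₂ / (N.l k .a * N.θ₂ * N.γa) := by
    have := N.θ₂_pos; have hu := N.u_pos k
    have h : N.l k .a * N.θ₂ * N.γa = N.u k * N.θ₂ := by simp only [u]; ring
    rw [h]; field_simp
  rw [h1, crossMO, ← Real.exp_add]
  conv_rhs => rw [h2]
  have h3 : N.θ₁ * N.θ₂ / (N.l k .a * N.θ₂ * N.γa) = N.θ₁ / (N.l k .a * N.γa) := h2.symm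
  simp only [G₉, h3, u, v]
  ring_nf

lemma pairLaw_cell8 : pairLaw.real (N.cell8 k) = N.G₈ k := by
  have hτ := N.τ_pos k
  have hle := N.τ_le_crossMO k
  have ho : 0 < N.θ₁ / N.u k := div_pos N.θ₁_pos (N.u_pos k)
  have hv := (slab_Ioc (S := fun t => 0 < N.lineM k t ∧ N.lineM k t < N.θ₁ / N.u k) isTail_zero
    (N.isTail_lineM k) hτ.le hle (fun t ht => by
      simp only [N.crossings k ht, N.lineM_lt_iff_lt_crossMO k t]; grind)).add
    (slab_Ioi (S := fun t => ¬ N.lineM k t < N.θ₁ / N.u k) isTail_zero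
      (IsTail.const (N.θ₁ / N.u k)) (hτ.le.trans hle) (fun t ht => by
      simp only [N.lineM_lt_iff_lt_crossMO k t]; grind))
  rw [ph3_τ, ph3_crossMO] at hv
  refine pairLaw_real_eq (N.measurableSet_cell8 k) (L := fun _ => 0)
    (U := fun t => min (N.θ₁ / N.u k) (N.lineM k t)) (fun _ _ => le_rfl) ?_ ?_
    (hv.of_eq ?_) ?_
  · intro t ht x h1 h2
    simp only [cell8, regO, regM, mem_ofPred_eq]
    grind
  · intro t ht x h
    simp only [cell8, regO, regM, mem_ofPred_eq] at h
    grind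
  · have := N.u_pos k; have := N.v_pos k; have := N.θ₂_pos
    rw [G₈_eq]
    field_simp
    ring
  · intro t ht
    simp only [slab]
    grind

lemma pairLaw_cell9 : pairLaw.real (N.cell9 k) = N.G₉ k := by
  have hτ := N.τ_pos k
  have hle := N.τ_le_crossMO k
  have ho : 0 < N.θ₁ / N.u k := div_pos N.θ₁_pos (N.u_pos k)
  have hv := (N.hasTotal_below_τ k (IsTail.const (N.θ₁ / N.u k))
    (S := fun t => ¬ 0 < N.lineM k t) fun t ht => (N.lineM_pos_iff k t).not).add
    (slab_Ioc (S := fun t => 0 < N.lineM k t ∧ N.lineM k t < N.θ₁ / N.u k)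
      (N.isTail_lineM k) (IsTail.const (N.θ₁ / N.u k)) hτ.le hle (fun t ht => by
      simp only [N.crossings k ht, N.lineM_lt_iff_lt_crossMO k t]; grind))
  rw [ph3_τ, ph3_crossMO] at hv
  refine pairLaw_real_eq (N.measurableSet_cell9 k) (L := fun t => max 0 (N.lineM k t))
    (U := fun _ => N.θ₁ / N.u k) (fun _ _ => le_max_left _ _) ?_ ?_
    (hv.of_eq ?_) ?_
  · intro t ht x h1 h2
    simp only [cell9, regO, regM, mem_ofPred_eq]
    grind
  · intro t ht x h
    simp only [cell9, regO, regM, mem_ofPred_eq] at h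
    grind
  · rw [G₉_eq, neg_zero, Real.exp_zero]
    ring
  · intro t ht
    simp only [slab]
    grind

/-! ### Decoding conditions in terms of the regions -/

variable {g : Gains}

lemma sinr1a_iff (hg : ∀ k m, 0 ≤ g k m) :
    N.θ₁₁ ≤ N.sinr1a N.α g k ↔ g.at k ∈ N.regA k := by
  have hu := N.u_pos k; have hv := N.v_pos k; have h11 := N.θ₁₁_pos; have hρ := N.ρ_pos
  have ha := hg k .a; have hb := hg k .b
  have h1 : N.sinr1a N.α g k = N.α * (N.u k * g k .a) /
      (N.ρ * (N.u k * g k .a) + N.v k * g k .b + 1) := by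
    simp only [sinr1a, u, v, ρ]; ring_nf
  have h2 : N.A = N.α - N.θ₁₁ * N.ρ := rfl
  have h3 : N.θ₁₁ ≤ N.sinr1a N.α g k ↔
      N.θ₁₁ * (N.v k * g k .b + 1) ≤ g k .a * (N.u k * N.A) := by
    rw [h1, le_div_iff₀ (by positivity), h2]
    constructor <;> intro h <;> linarith
  rw [h3]
  simp only [regA, lineA, Gains.at, mem_ofPred_eq]
  constructor
  · intro h
    -- With A ≤ 0 the right side of the cleared inequality is nonpositive while the left side is
    -- positive: the SINR of x_{1a} stays below its target at every gain.
    have hA : 0 < N.A := by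
      by_contra! hA
      have h4 := mul_nonpos_of_nonneg_of_nonpos (mul_nonneg ha hu.le) hA
      have h5 : 0 < N.θ₁₁ * (N.v k * g k .b + 1) := by positivity
      linarith
    exact ⟨hA, by rwa [div_le_iff₀ (by positivity)]⟩
  · rintro ⟨hA, h⟩
    rwa [div_le_iff₀ (by positivity)] at h

lemma sinrB_iff (hg : ∀ k m, 0 ≤ g k m) : N.θ₂ ≤ N.sinrB N.α g k ↔ g.at k ∈ N.regB k := by
  have hu := N.u_pos k; have h2 := N.θ₂_pos; have hρ := N.ρ_pos
  have ha := hg k .a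
  have h1 : N.sinrB N.α g k = N.v k * g k .b / (N.ρ * (N.u k * g k .a) + 1) := by
    simp only [sinrB, u, v, ρ]; ring_nf
  rw [h1, le_div_iff₀ (by positivity)]
  simp only [regB, lineB, Gains.at, mem_ofPred_eq]
  rw [le_div_iff₀ (by positivity)]
  constructor <;> intro h <;> linarith

lemma sinr2a_iff : N.θ₁₂ ≤ N.sinr2a N.α g k ↔ g.at k ∈ N.regC k := by
  have hu := N.u_pos k; have hρ := N.ρ_pos
  have h1 : N.sinr2a N.α g k = g k .a * (N.u k * N.ρ) := by
    simp only [sinr2a, u, ρ]; ring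
  rw [h1]
  simp only [regC, lineC, Gains.at, mem_ofPred_eq]
  rw [div_le_iff₀ (by positivity)]

lemma sinrBAb_iff (hg : ∀ k m, 0 ≤ g k m) : N.θ₂ ≤ N.sinrBAb g k ↔ g.at k ∈ N.regM k := by
  have hu := N.u_pos k; have h2 := N.θ₂_pos
  have ha := hg k .a
  have h1 : N.sinrBAb g k = N.v k * g k .b / (N.u k * g k .a + 1) := rfl
  rw [h1, le_div_iff₀ (by positivity)]
  simp only [regM, lineM, Gains.at, mem_ofPred_eq]
  rw [le_div_iff₀ (by positivity)]
  constructor <;> intro h <;> linarith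

lemma sinrABa_iff (hg : ∀ k m, 0 ≤ g k m) : N.θ₁ ≤ N.sinrABa g k ↔ g.at k ∈ N.regN k := by
  have hu := N.u_pos k; have hv := N.v_pos k
  have hb := hg k .b
  have h1 : N.sinrABa g k = N.u k * g k .a / (N.v k * g k .b + 1) := rfl
  rw [h1, le_div_iff₀ (by positivity)]
  simp only [regN, lineN, Gains.at, mem_ofPred_eq]
  rw [div_le_iff₀ hu, mul_comm (g k .a)]

lemma sinrBAa_iff : N.θ₁ ≤ N.sinrBAa g k ↔ g.at k ∈ N.regO k := by
  have hu := N.u_pos k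
  have h1 : N.sinrBAa g k = N.u k * g k .a := rfl
  rw [h1]
  simp only [regO, Gains.at, mem_ofPred_eq]
  rw [div_le_iff₀ hu, mul_comm (g k .a)]

lemma exists_RRH_iff {p : RRH → Prop} : (∃ k, p k) ↔ p .i ∨ p .j :=
  ⟨fun ⟨k, hk⟩ => by cases k <;> simp [hk], fun h => h.elim (⟨_, ·⟩) (⟨_, ·⟩)⟩

lemma nomaDecodesA_iff (hg : ∀ k m, 0 ≤ g k m) : N.NomaDecodesA g ↔
    (g.at .i ∈ N.regN .i ∨ g.at .j ∈ N.regN .j) ∨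
      (g.at .i ∈ N.regM .i ∨ g.at .j ∈ N.regM .j) ∧
      (g.at .i ∈ N.regO .i ∨ g.at .j ∈ N.regO .j) := by
  simp only [NomaDecodesA, sinrABa_iff _ _ hg, sinrBAb_iff _ _ hg, sinrBAa_iff,
    exists_RRH_iff]

lemma rsmaDecodesA_iff (hg : ∀ k m, 0 ≤ g k m) : N.RsmaDecodesA N.α g ↔
    (g.at .i ∈ N.regA .i ∨ g.at .j ∈ N.regA .j) ∧
      (g.at .i ∈ N.regB .i ∨ g.at .j ∈ N.regB .j) ∧
      (g.at .i ∈ N.regC .i ∨ g.at .j ∈ N.regC .j) := by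
  simp only [RsmaDecodesA, sinr1a_iff _ _ hg, sinrB_iff _ _ hg, sinr2a_iff, exists_RRH_iff]

/-- The selected scheme fails only if both fail: bit 0 with NOMA failing excludes an RSMA success,
which would have set the bit to 1, and conversely. The free choice when both fail has no effect. -/
lemma outageA_iff {z : Gains → Fin 2} (hz : N.IsFeedback z) (hg : ∀ k m, 0 ≤ g k m) :
    N.OutageA (z g) g ↔ ¬ N.NomaDecodesA g ∧ ¬ N.RsmaDecodesA N.α g := by
  have h1 := hz.noma g hg
  have h2 := hz.rsma g hg
  unfold OutageA
  split_ifs with h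
  · constructor
    · exact fun hn => ⟨hn, fun hr => by simp [h2 hn hr] at h⟩
    · exact And.left
  · exact ⟨fun hr => ⟨fun hn => h (h1 hn), hr⟩, And.right⟩

/-- Under RSMA only the share 1-α of the power of user a interferes with x_b. -/
lemma regM_subset_regB {p : ℝ × ℝ} (hp : 0 ≤ p.1) (h : p ∈ N.regM k) : p ∈ N.regB k := by
  have hu := N.u_pos k; have h2 := N.θ₂_pos; have hρ := N.ρ_pos
  simp only [regM, regB, lineM, lineB, mem_ofPred_eq] at *
  rw [le_div_iff₀ (by positivity)] at *
  have hα : N.ρ ≤ 1 := by simp only [ρ]; linarith [N.α_pos]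
  have h3 := mul_le_of_le_one_right (show 0 ≤ p.1 * (N.u k * N.θ₂) by positivity) hα
  linarith

lemma regN_subset_regO {p : ℝ × ℝ} (hp : 0 ≤ p.2) (h : p ∈ N.regN k) : p ∈ N.regO k := by
  have hu := N.u_pos k; have h1 := N.θ₁_pos; have hv := N.v_pos k
  simp only [regN, regO, lineN, mem_ofPred_eq] at *
  refine le_trans ?_ h
  gcongr
  nlinarith [mul_nonneg hv.le hp]

lemma θ₁₁_le_of_mem_regA {p : ℝ × ℝ} (hp : 0 ≤ p.2) (h : p ∈ N.regA k) :
    N.θ₁₁ ≤ N.A * (N.u k * p.1) := by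
  have hu := N.u_pos k; have h11 := N.θ₁₁_pos; have hv := N.v_pos k
  obtain ⟨hA, h⟩ := h
  rw [lineA, div_le_iff₀ (by positivity)] at h
  have h3 : 0 ≤ N.θ₁₁ * (N.v k * p.2) := by positivity
  linarith

/-- Below the threshold for decoding `a` alone, the two parts of the split message are never both
decodable, even at different RRHs. -/
lemma not_regA_and_regC {k' : RRH} {p q : ℝ × ℝ} (hp : 0 ≤ p.2) (hpO : p ∉ N.regO k)
    (hqO : q ∉ N.regO k') (hA : p ∈ N.regA k) : q ∉ N.regC k' := by
  have h1 := N.θ₁₁_le_of_mem_regA k hp hA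
  have hA0 := hA.1
  intro hC
  have hu := N.u_pos k; have hu' := N.u_pos k'; have hρ := N.ρ_pos; have h11 := N.θ₁₁_pos
  simp only [regO, regC, lineC, mem_ofPred_eq, not_le] at hpO hqO hC
  rw [lt_div_iff₀ ‹_›] at hpO hqO
  rw [div_le_iff₀ (by positivity)] at hC
  -- Decoding x_{1a} below the threshold θ₁ gives θ₁₁ < Aθ₁, that is D < 0. Decoding x_{2a} below it
  -- gives θ₁₂ < ρθ₁, and the factorization of D then makes D nonnegative.
  have h2 : 0 < N.A * (N.θ₁ - N.u k * p.1) := mul_pos hA0 (by linarith)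
  have h3 : 0 < N.ρ * (N.θ₁ - N.u k' * q.1) := mul_pos hρ (by linarith)
  have h4 := N.D_eq
  have h5 : N.D < 0 := by simp only [D]; linarith
  have h6 : 0 ≤ (1 + N.θ₁₁) * (N.θ₁ * N.ρ - N.θ₁₂) :=
    mul_nonneg (by linarith) (by linarith)
  linarith

/-! ### The outage region -/

/-- Pairs of gains for which user `a` is in outage. -/
def outageRegion : Set ((ℝ × ℝ) × (ℝ × ℝ)) :=
  N.cell1 .i ×ˢ N.cell1 .j ∪ N.cell2 .i ×ˢ N.cell2 .j ∪ N.cell2 .i ×ˢ N.cell3 .j ∪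
    N.cell3 .i ×ˢ N.cell2 .j ∪ N.cell4 .i ×ˢ N.cell4 .j ∪ N.cell4 .i ×ˢ N.cell5 .j ∪
    N.cell5 .i ×ˢ N.cell4 .j ∪ N.cell4 .i ×ˢ N.cell6 .j ∪ N.cell4 .i ×ˢ N.cell7 .j ∪
    N.cell5 .i ×ˢ N.cell6 .j ∪ N.cell6 .i ×ˢ N.cell4 .j ∪ N.cell6 .i ×ˢ N.cell5 .j ∪
    N.cell7 .i ×ˢ N.cell4 .j ∪ N.cell8 .i ×ˢ N.cell8 .j ∪ N.cell8 .i ×ˢ N.cell9 .j ∪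
    N.cell9 .i ×ˢ N.cell8 .j

/-- Once nonnegativity of the gains, the two inclusions and the four instances of
`not_regA_and_regC` are available, the geometry is no longer needed: a propositional equivalence in
twelve variables remains. -/
lemma outageA_iff_mem {z : Gains → Fin 2} (hz : N.IsFeedback z) (hg : ∀ k m, 0 ≤ g k m) :
    N.OutageA (z g) g ↔ (g.at .i, g.at .j) ∈ N.outageRegion := by
  have hi : 0 ≤ (g.at .i).1 ∧ 0 ≤ (g.at .i).2 := ⟨hg _ _, hg _ _⟩
  have hj : 0 ≤ (g.at .j).1 ∧ 0 ≤ (g.at .j).2 := ⟨hg _ _, hg _ _⟩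
  have m1 := N.regM_subset_regB .i hi.1
  have m2 := N.regM_subset_regB .j hj.1
  have n1 := N.regN_subset_regO .i hi.2
  have n2 := N.regN_subset_regO .j hj.2
  have c1 := N.not_regA_and_regC .i hi.2 (k' := .i) (q := g.at .i)
  have c2 := N.not_regA_and_regC .i hi.2 (k' := .j) (q := g.at .j)
  have c3 := N.not_regA_and_regC .j hj.2 (k' := .i) (q := g.at .i)
  have c4 := N.not_regA_and_regC .j hj.2 (k' := .j) (q := g.at .j)
  rw [N.outageA_iff hz hg, N.nomaDecodesA_iff hg, N.rsmaDecodesA_iff hg]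
  simp only [outageRegion, mem_union, mem_prod, cell1, cell2, cell3, cell4, cell5, cell6, cell7,
    cell8, cell9, base, mem_ofPred_eq]
  simp only [hi, hj, true_and, and_self]
  clear hi hj hz hg
  generalize (g.at .i ∈ N.regA .i) = Ai at *
  generalize (g.at .j ∈ N.regA .j) = Aj at *
  generalize (g.at .i ∈ N.regB .i) = Bi at *
  generalize (g.at .j ∈ N.regB .j) = Bj at *
  generalize (g.at .i ∈ N.regC .i) = Ci at *
  generalize (g.at .j ∈ N.regC .j) = Cj at *
  generalize (g.at .i ∈ N.regM .i) = Mi at *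
  generalize (g.at .j ∈ N.regM .j) = Mj at *
  generalize (g.at .i ∈ N.regN .i) = Ni at *
  generalize (g.at .j ∈ N.regN .j) = Nj at *
  generalize (g.at .i ∈ N.regO .i) = Oi at *
  generalize (g.at .j ∈ N.regO .j) = Oj at *
  grind (splits := 60)

lemma measurableSet_outageRegion : MeasurableSet N.outageRegion := by
  have hm := fun k => And.intro (N.measurableSet_cell1 k) <|
    And.intro (N.measurableSet_cell2 k) <| And.intro (N.measurableSet_cell3 k) <|
    And.intro (N.measurableSet_cell4 k) <| And.intro (N.measurableSet_cell5 k) <|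
    And.intro (N.measurableSet_cell6 k) <| And.intro (N.measurableSet_cell7 k) <|
    And.intro (N.measurableSet_cell8 k) (N.measurableSet_cell9 k)
  unfold outageRegion
  repeat' apply MeasurableSet.union
  all_goals exact MeasurableSet.prod (by simp only [hm]) (by simp only [hm])

lemma real_union_prod {S : Set ((ℝ × ℝ) × (ℝ × ℝ))} {s t : Set (ℝ × ℝ)}
    (hd : Disjoint S (s ×ˢ t)) (hs : MeasurableSet s) (ht : MeasurableSet t) :
    (pairLaw.prod pairLaw).real (S ∪ s ×ˢ t) =
      (pairLaw.prod pairLaw).real S + pairLaw.real s * pairLaw.real t := by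
  rw [measureReal_union hd (hs.prod ht), measureReal_prod_prod]

/-- Any two of the sixteen rectangles have disjoint cells in at least one coordinate, so measures
add along the fifteen unions and each rectangle factors over the RRHs. -/
lemma real_outageRegion : (pairLaw.prod pairLaw).real N.outageRegion =
    N.G₁ .i * N.G₁ .j + N.G₂ .i * N.G₂ .j + N.G₂ .i * N.G₃ .j + N.G₃ .i * N.G₂ .j
      + N.G₄ .i * N.G₄ .j + N.G₄ .i * N.G₅ .j + N.G₅ .i * N.G₄ .j + N.G₄ .i * N.G₆ .j
      + N.G₄ .i * N.G₇ .j + N.G₅ .i * N.G₆ .j + N.G₆ .i * N.G₄ .j + N.G₆ .i * N.G₅ .j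
      + N.G₇ .i * N.G₄ .j + N.G₈ .i * N.G₈ .j + N.G₈ .i * N.G₉ .j + N.G₉ .i * N.G₈ .j := by
  have hd : ∀ k, (Disjoint (N.cell1 k) (N.cell2 k) ∧ Disjoint (N.cell1 k) (N.cell4 k) ∧
      Disjoint (N.cell1 k) (N.cell5 k)) ∧ (Disjoint (N.cell2 k) (N.cell3 k) ∧
      Disjoint (N.cell2 k) (N.cell4 k) ∧ Disjoint (N.cell2 k) (N.cell6 k) ∧
      Disjoint (N.cell2 k) (N.cell7 k)) ∧ (Disjoint (N.cell3 k) (N.cell4 k) ∧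
      Disjoint (N.cell3 k) (N.cell5 k) ∧ Disjoint (N.cell3 k) (N.cell6 k)) ∧
      (Disjoint (N.cell4 k) (N.cell5 k) ∧ Disjoint (N.cell4 k) (N.cell6 k) ∧
      Disjoint (N.cell4 k) (N.cell7 k)) ∧ (Disjoint (N.cell5 k) (N.cell6 k) ∧
      Disjoint (N.cell5 k) (N.cell7 k)) ∧ Disjoint (N.cell6 k) (N.cell7 k) ∧
      (Disjoint (N.cell1 k) (N.cell8 k) ∧ Disjoint (N.cell2 k) (N.cell8 k) ∧
      Disjoint (N.cell3 k) (N.cell8 k) ∧ Disjoint (N.cell4 k) (N.cell8 k) ∧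
      Disjoint (N.cell5 k) (N.cell8 k) ∧ Disjoint (N.cell6 k) (N.cell8 k) ∧
      Disjoint (N.cell7 k) (N.cell8 k)) ∧ Disjoint (N.cell8 k) (N.cell9 k) := by
    intro k
    simp only [Set.disjoint_left, cell1, cell2, cell3, cell4, cell5, cell6, cell7, cell8, cell9,
      base, mem_ofPred_eq]
    and_intros <;> exact fun p h h' => by grind
  have hm := fun k => And.intro (N.measurableSet_cell2 k) <| And.intro (N.measurableSet_cell3 k) <|
    And.intro (N.measurableSet_cell4 k) <| And.intro (N.measurableSet_cell5 k) <|
    And.intro (N.measurableSet_cell6 k) <| And.intro (N.measurableSet_cell7 k) <|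
    And.intro (N.measurableSet_cell8 k) (N.measurableSet_cell9 k)
  have di := hd .i
  have dj := hd .j
  clear hd
  simp only [outageRegion]
  iterate 15
    rw [real_union_prod (by simp only [Set.disjoint_union_left, Set.disjoint_prod, di, dj,
      true_or, or_true, and_self]) (by simp only [hm]) (by simp only [hm])]
  simp only [measureReal_prod_prod, pairLaw_cell1, pairLaw_cell2, pairLaw_cell3, pairLaw_cell4,
    pairLaw_cell5, pairLaw_cell6, pairLaw_cell7, pairLaw_cell8, pairLaw_cell9]

end Network

end DURSMA

end

theorem theorem3 (N : DURSMA.Network)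
    {Ω : Type*} [MeasurableSpace Ω] (P : Measure Ω) [IsProbabilityMeasure P]
    (h : DURSMA.RRH → DURSMA.User → Ω → ℂ)
    (hlaw : ∀ k m, HasLaw (h k m) DURSMA.stdComplexGaussian P)
    (hindep : iIndepFun (fun km : DURSMA.RRH × DURSMA.User => h km.1 km.2) P)
    (z : DURSMA.Gains → Fin 2) (hz : N.IsFeedback z) :
    P.real {ω | N.OutageA (z (DURSMA.gains h ω)) (DURSMA.gains h ω)} =
      N.G₁ .i * N.G₁ .j + N.G₂ .i * N.G₂ .j + N.G₂ .i * N.G₃ .j + N.G₃ .i * N.G₂ .j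
        + N.G₄ .i * N.G₄ .j + N.G₄ .i * N.G₅ .j + N.G₅ .i * N.G₄ .j + N.G₄ .i * N.G₆ .j
        + N.G₄ .i * N.G₇ .j + N.G₅ .i * N.G₆ .j + N.G₆ .i * N.G₄ .j + N.G₆ .i * N.G₅ .j
        + N.G₇ .i * N.G₄ .j + N.G₈ .i * N.G₈ .j + N.G₈ .i * N.G₉ .j + N.G₉ .i * N.G₈ .j := by
  have hZ := DURSMA.hasLaw_gains P h hlaw hindep
  have hset : {ω | N.OutageA (z (DURSMA.gains h ω)) (DURSMA.gains h ω)} =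
      {ω | ((DURSMA.gains h ω).at .i, (DURSMA.gains h ω).at .j) ∈ N.outageRegion} := by
    ext ω
    exact N.outageA_iff_mem hz fun k m => sq_nonneg ‖h k m ω‖
  rw [hset, hZ.measureReal_eq (p := fun x => x ∈ N.outageRegion) N.measurableSet_outageRegion]
  exact N.real_outageRegion
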